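/- **Infinite ODE system formulation.** Let $\gamma\in(0,1)$, let $n$ be a positive integer with $n>2\gamma$, let $\mu=\mu_m$ be an eigenvalue of $-\Delta$ on the unit sphere $\mathbb S^{n-1}$, and let $0\le\kappa<\Lambda_{n,\gamma}:=2^{2\gamma}\Big(\frac{\Gamma(\frac{n+2\gamma}{4})}{\Gamma(\frac{n-2\gamma}{4})}\Big)^2$. Put $A=\frac12+\frac\gamma2+\frac12\sqrt{(\frac n2-1)^2+\mu}$, $B=\frac12-\frac\gamma2+\frac12\sqrt{(\frac n2-1)^2+\mu}$ and $$\Theta_m(z)=2^{2\gamma}\,\frac{\Gamma(A+\frac12 zi)\,\Gamma(A-\frac12 zi)}{\Gamma(B+\frac12 zi)\,\Gamma(B-\frac12 zi)},\qquad z\in\mathbb C .$$ Let $\mathcal L_m$ be the non-local operator on $\mathbb R$ with Fourier symbol $\Theta_m(\xi)-\kappa$, and let $$\mathcal G_m(t)=\frac1{2\pi}\lim_{R\to\infty}\int_{-R}^{R}\frac{e^{i\xi t}}{\Theta_m(\xi)-\kappa}\,d\xi ,\qquad t\neq0,$$ be its Green's function. Assume that every pole of the meromorphic function $1/(\Theta_m-\kappa)$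 is purely imaginary (that is, writing the poles as $\pm\tau_j\pm i\sigma_j$, all $\tau_j=0$). Then the poles are exactly $\pm i\sigma_j$, $j=0,1,2,\dots$, for a strictly increasing sequence $\sigma_j$ with $\sigma_0>0$; the limit defining $\mathcal G_m(t)$ exists for all $t\ne0$; and there are real constants $c_j$, depending only on $n,\gamma,\kappa,m$, with $$\mathcal G_m(t)=\sum_{j=0}^\infty c_j e^{-\sigma_j|t|}\qquad(t\neq0).$$ Moreover, let $h:\mathbb R\to\mathbb R$ be locally integrable with $h(t)=O(e^{-\delta t})$ as $t\to+\infty$ and $h(t)=O(e^{\delta_0t})$ as $t\to-\infty$, for some real $\delta,\delta_0>-\sigma_0$, and set $$w(t)=\int_{\mathbb R}\mathcal G_m(t-t')h(t')\,dt',\qquad w_j(t)=\int_{\mathbb R}e^{-\sigma_j|t-t'|}h(t')\,dt' .$$ Then: 1. The integral defining $w(t)$ converges absolutely for almost every $t$ and at every point $t$ of continuity of $h$, and $w$ solves $\mathcal L_mw=h$ in the weak sense: for every $\varphi\in C_c^\infty(\mathbb R)$, $w\,\mathcal L_m\varphi$ is integrable and $\int w\,\mathcal L_m\varphi\,dt=\int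 h\,\varphi\,dt$. 2. At every $t$ where the integral defining $w(t)$ converges absolutely, $w(t)=\sum_{j=0}^\infty c_jw_j(t)$, the series being absolutely convergent. 3. For every $j$, the integral defining $w_j(t)$ converges absolutely for every $t$, $w_j$ is $C^1$ with locally absolutely continuous derivative, and $$w_j''(t)-\sigma_j^2w_j(t)=-2\sigma_jh(t)$$ for almost every $t$ and at every point $t$ of continuity of $h$ (hence everywhere if $h$ is continuous). 4. In particular, if the right-hand side has the form $h(t)=f(t,w(t))$ for a.e. $t$, with some $f:\mathbb R\times\mathbb R\to\mathbb R$, then the $w_j$ solve the infinite system $w_j''-\sigma_j^2w_j=-2\sigma_jf\big(t,\sum_{k}c_kw_k\big)$ a.e., $j=0,1,2,\dots$, coupled only through the right-hand sides. -/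

import Mathlib

open MeasureTheory Filter Topology Asymptotics
open scoped ContDiff FourierTransform Laplacian

noncomputable section

namespace HardyGreen

/-- `μ` is an eigenvalue of `-Δ` on the unit sphere `𝕊^{n-1} ⊆ ℝⁿ`. A smooth function on the sphere
is represented by its extension `F` to `ℝⁿ ∖ {0}` which is constant along rays; on the unit sphere
the Euclidean Laplacian of this extension is the spherical Laplacian of the function. -/
def IsSphereEigenvalue (n : ℕ) (μ : ℝ) : Prop :=
  ∃ F : EuclideanSpace ℝ (Fin n) → ℝ,
    ContDiffOn ℝ ∞ F {0}ᶜ ∧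
    (∀ r : ℝ, 0 < r → ∀ x, F (r • x) = F x) ∧
    (∃ x, x ≠ 0 ∧ F x ≠ 0) ∧
    ∀ x, ‖x‖ = 1 → (Δ F) x = -μ * F x

/-- `A = 1/2 + γ/2 + (1/2) √((n/2 - 1)² + μ)`. -/
def constA (n : ℕ) (γ μ : ℝ) : ℝ :=
  1 / 2 + γ / 2 + 1 / 2 * Real.sqrt (((n : ℝ) / 2 - 1) ^ 2 + μ)

/-- `B = 1/2 - γ/2 + (1/2) √((n/2 - 1)² + μ)`. -/
def constB (n : ℕ) (γ μ : ℝ) : ℝ :=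
  1 / 2 - γ / 2 + 1 / 2 * Real.sqrt (((n : ℝ) / 2 - 1) ^ 2 + μ)

/-- The meromorphic extension to `ℂ` of the Fourier symbol of the projection of the conformal
fractional Laplacian on the cylinder `ℝ × 𝕊^{n-1}` over the eigenspace of `μ`:
`Θ(z) = 2^{2γ} Γ(A + iz/2) Γ(A - iz/2) / (Γ(B + iz/2) Γ(B - iz/2))`. -/
def symbol (n : ℕ) (γ μ : ℝ) (z : ℂ) : ℂ :=
  (((2 : ℝ) ^ (2 * γ) : ℝ) : ℂ) *
    (Complex.Gamma ((constA n γ μ : ℂ) + z * Complex.I / 2) *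
      Complex.Gamma ((constA n γ μ : ℂ) - z * Complex.I / 2)) /
    (Complex.Gamma ((constB n γ μ : ℂ) + z * Complex.I / 2) *
      Complex.Gamma ((constB n γ μ : ℂ) - z * Complex.I / 2))

/-- The Hardy constant `Λ_{n,γ} = 2^{2γ} (Γ((n+2γ)/4) / Γ((n-2γ)/4))²`. -/
def hardyConstant (n : ℕ) (γ : ℝ) : ℝ :=
  (2 : ℝ) ^ (2 * γ) *
    (Real.Gamma (((n : ℝ) + 2 * γ) / 4) / Real.Gamma (((n : ℝ) - 2 * γ) / 4)) ^ 2

/-- `z` is a pole of the meromorphic function `1 / (Θ - κ)`. -/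
def IsResolventPole (n : ℕ) (γ μ κ : ℝ) (z : ℂ) : Prop :=
  meromorphicOrderAt (fun ζ : ℂ => (symbol n γ μ ζ - (κ : ℂ))⁻¹) z < 0

/-- The truncated inverse Fourier integral `(1/2π) ∫_{-R}^{R} e^{iξt} / (Θ(ξ) - κ) dξ`. -/
def greenTrunc (n : ℕ) (γ μ κ R t : ℝ) : ℂ :=
  (1 / (2 * Real.pi) : ℂ) *
    ∫ ξ in (-R)..R,
      Complex.exp (Complex.I * (ξ : ℂ) * (t : ℂ)) / (symbol n γ μ (ξ : ℂ) - (κ : ℂ))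

/-- The Green's function `𝓖(t) = (1/2π) ∫_ℝ e^{iξt} / (Θ(ξ) - κ) dξ`. For `γ ≤ 1/2` the integral
is not absolutely convergent, so it is the limit of the truncated integrals. -/
def green (n : ℕ) (γ μ κ t : ℝ) : ℝ :=
  limUnder atTop (fun R : ℝ => (greenTrunc n γ μ κ R t).re)

/-- The convolution `(𝓖 * h)(t) = ∫ 𝓖(t - s) h(s) ds`. -/
def greenConv (n : ℕ) (γ μ κ : ℝ) (h : ℝ → ℝ) (t : ℝ) : ℝ :=
  ∫ s, green n γ μ κ (t - s) * h s

/-- The convolution `(e^{-σ|·|} * h)(t) = ∫ e^{-σ|t - s|} h(s) ds`. -/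
def expConv (σ : ℝ) (h : ℝ → ℝ) (t : ℝ) : ℝ :=
  ∫ s, Real.exp (-σ * |t - s|) * h s

/-- The operator `𝓛 = P_γ^{(m)} - κ` on test functions: the Fourier multiplier with (real, even)
symbol `Θ(ξ) - κ`. Mathlib's Fourier variable is `x = ξ / 2π`. -/
def hardyOp (n : ℕ) (γ μ κ : ℝ) (φ : ℝ → ℝ) (t : ℝ) : ℝ :=
  (𝓕⁻ (fun x : ℝ => (symbol n γ μ ((2 * Real.pi * x : ℝ) : ℂ) - (κ : ℂ)) *
    𝓕 (fun s : ℝ => (φ s : ℂ)) x) t).re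

/-- `w` solves the non-local equation `𝓛 w = h` on `ℝ` in the weak sense. Since the symbol is real
and even, `𝓛` is formally symmetric. -/
def IsWeakSolution (n : ℕ) (γ μ κ : ℝ) (h w : ℝ → ℝ) : Prop :=
  ∀ φ : ℝ → ℝ, ContDiff ℝ ∞ φ → HasCompactSupport φ →
    Integrable (fun t => w t * hardyOp n γ μ κ φ t) ∧
    ∫ t, w t * hardyOp n γ μ κ φ t = ∫ t, h t * φ t

end HardyGreen

end

noncomputable section

namespace HardyGreen

/-! ### Rational functions with interlacing zeros and poles -/

/-! With `w = iz/2`, `u = w²` and `g_A(w) = 1/(Γ(A+w)Γ(A-w))`, the symbol is `2^{2γ} g_B/g_A`, so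
`1/(Θ-κ)` is a constant times `g_A/(g_B - κ' g_A)` with `κ' = 2^{-2γ}κ`. The point is that this
quotient is a Stieltjes function of `u`: a sum `∑ b_k s_k/(s_k - u)` with `b_k ≥ 0`, `∑ b_k < ∞` and
`s_k > 0`.

By Euler's product, `g_A` and `g_B` are limits of polynomials in `u` with zeros `(A+j)²` and
`(B+j)²`. These interlace because `A - B = γ ∈ (0,1)`. Hence the zeros of each truncated denominator
are real and again interlace with the `(A+j)²`, and the partial fraction coefficients are positive
(`exists_isTruncExpansion`). Compactness gives a limit expansion (`exists_limit_expansion`). No mass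
is lost in the limit since `g_B/g_A` is unbounded on the imaginary axis (`tsum_eq_of_expansion`).
The Hardy condition makes `Θ(0) > κ`, by log-convexity of `Γ` and `μ ≥ 0`, and keeps the zeros away
from `u = 0`.

On the real line this reads `1/(Θ(ξ)-κ) = ∑ m_k σ_k²/(σ_k²+ξ²)` with `σ_k = 2√s_k`. Fourier
inversion gives `𝓖(t) = ∑ (m_k σ_k/2) e^{-σ_k|t|}`, a positive integrable kernel, so sums and
integrals may be interchanged by domination with `𝓖` itself. Each convolution with `e^{-σ|t|}`
solves its second order equation by direct differentiation (`expConv_regularity`).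

For the weak equation, `𝓛φ` must be known to decay exponentially. The same Stieltjes theorem,
applied to the pair `(B+1, A)`, shows that `Θ(ξ)/(ξ²+4B²)` is up to a constant the transform of
another such kernel `G'`. So `𝓛φ` is `G'` convolved with a test function, minus `κφ`. Then `𝓖 * 𝓛φ =
φ` on the Fourier side, and Fubini moves `𝓖` onto `h` (`isWeakSolution_of_symbol`). -/

lemma prod_sub_comm {K : Type*} [Field K] (n : ℕ) (a : ℕ → K) (u : K) :
    ∏ j ∈ Finset.range n, (a j - u) = (-1) ^ n * ∏ j ∈ Finset.range n, (u - a j) := by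
  have : ∀ j ∈ Finset.range n, a j - u = -1 * (u - a j) := fun j _ => by ring
  rw [Finset.prod_congr rfl this, Finset.prod_mul_distrib]
  simp

lemma neg_one_pow_mul_prod_nonneg {n k : ℕ} (hk : k ≤ n) {a : ℕ → ℝ} {x : ℝ}
    (h1 : ∀ j < k, a j ≤ x) (h2 : ∀ j, k ≤ j → j < n → x ≤ a j) :
    0 ≤ (-1) ^ k * ∏ j ∈ Finset.range n, (a j - x) := by
  rw [← Finset.prod_range_mul_prod_Ico _ hk, prod_sub_comm, ← mul_assoc, ← mul_assoc, ← mul_pow]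
  norm_num
  refine mul_nonneg (Finset.prod_nonneg fun j hj => ?_) (Finset.prod_nonneg fun j hj => ?_)
  · exact sub_nonneg.2 (h1 j (Finset.mem_range.1 hj))
  · exact sub_nonneg.2 (h2 j (Finset.mem_Ico.1 hj).1 (Finset.mem_Ico.1 hj).2)

lemma exists_root_of_sign {f : ℝ → ℝ} {a b : ℝ} (hab : a ≤ b) (hf : ContinuousOn f (Set.Icc a b))
    (k : ℕ) (ha : 0 ≤ (-1) ^ k * f a) (hb : (-1) ^ k * f b ≤ 0) :
    ∃ x ∈ Set.Icc a b, f x = 0 := by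
  obtain ⟨x, hx, h⟩ := intermediate_value_Icc' hab
    ((continuousOn_const (c := ((-1 : ℝ) ^ k))).mul hf) (show (0 : ℝ) ∈ _ from ⟨hb, ha⟩)
  refine ⟨x, hx, ?_⟩
  simpa using h

/-- If the zeros `β` and the poles `α` of `c ∏ (β j - u) / ∏ (α j - u)` interlace, the values
`κ < c` are attained between consecutive poles. -/
lemma exists_roots_of_interlacing {n : ℕ} {α β : ℕ → ℝ} (hβα : ∀ j, β j < α j)
    (hαβ : ∀ j, α j < β (j + 1)) {c κ ε : ℝ} (hκ : 0 ≤ κ) (hc : 0 < c) (hε : ε ≤ β 0)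
    (hpε : 0 < c * ∏ j ∈ Finset.range n, (β j - ε) - κ * ∏ j ∈ Finset.range n, (α j - ε)) :
    ∃ s : ℕ → ℝ, ε ≤ s 0 ∧ (∀ k, s k ≤ β k) ∧ (∀ k, α k < s (k + 1)) ∧
      ∀ k < n, c * ∏ j ∈ Finset.range n, (β j - s k) =
        κ * ∏ j ∈ Finset.range n, (α j - s k) := by
  have hβm : StrictMono β := strictMono_nat_of_lt_succ fun j => (hβα j).trans (hαβ j)
  have hαm : StrictMono α := strictMono_nat_of_lt_succ fun j => (hαβ j).trans (hβα _)
  set p : ℝ → ℝ := fun u =>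
    c * ∏ j ∈ Finset.range n, (β j - u) - κ * ∏ j ∈ Finset.range n, (α j - u) with hp
  have hpc : Continuous p := by fun_prop
  -- At `β k` the first product vanishes and the second has exactly the `k` factors with `j < k`
  -- negative. At `α m` the roles are exchanged. So the sign of `p` changes between `α (k-1)` and `β
  -- k`.
  have hpβ : ∀ k < n, (-1) ^ k * p (β k) ≤ 0 := by
    intro k hk
    have h0 : ∏ j ∈ Finset.range n, (β j - β k) = 0 :=
      Finset.prod_eq_zero (Finset.mem_range.2 hk) (sub_self _)
    have h1 := neg_one_pow_mul_prod_nonneg (a := α) (x := β k) hk.le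
      (fun j hj => (hαβ j).le.trans (hβm.monotone hj))
      (fun j hj _ => (hβm.monotone hj).trans (hβα j).le)
    simp only [hp, h0]
    nlinarith
  have key : ∀ k, ∃ x, x ≤ β k ∧ (k = 0 → ε ≤ x) ∧ (∀ m, k = m + 1 → α m < x) ∧
      (k < n → p x = 0) := by
    intro k
    by_cases hk : k < n
    · cases k with
      | zero =>
        obtain ⟨x, hx, h⟩ := exists_root_of_sign hε hpc.continuousOn 0
          (by rw [pow_zero, one_mul]; exact hpε.le) (hpβ 0 hk)
        exact ⟨x, hx.2, fun _ => hx.1, fun m hm => by omega, fun _ => h⟩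
      | succ m =>
        have h0 : ∏ j ∈ Finset.range n, (α j - α m) = 0 :=
          Finset.prod_eq_zero (Finset.mem_range.2 (by omega)) (sub_self _)
        have h1 := neg_one_pow_mul_prod_nonneg (a := β) (x := α m) hk.le
          (fun j hj => (hβα j).le.trans (hαm.monotone (by omega)))
          (fun j hj _ => (hαβ m).le.trans (hβm.monotone hj))
        obtain ⟨x, hx, h⟩ := exists_root_of_sign (hαβ m).le hpc.continuousOn (m + 1)
          (by simp only [hp, h0]; nlinarith) (hpβ _ hk)
        refine ⟨x, hx.2, by simp, fun m' hm => ?_, fun _ => h⟩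
        obtain rfl : m = m' := by omega
        -- The root cannot be the left endpoint: `p (α m)` is a nonzero multiple of `∏ (β j - α m)`.
        -- At the right endpoint equality is possible, for instance when `κ = 0`.
        refine lt_of_le_of_ne hx.1 fun hne => ?_
        rw [← hne] at h
        simp only [hp, h0, mul_zero, sub_zero] at h
        have h2 : ∏ j ∈ Finset.range n, (β j - α m) ≠ 0 := by
          refine Finset.prod_ne_zero_iff.2 fun j _ => sub_ne_zero.2 ?_
          rcases le_or_gt j m with hj | hj
          · exact ((hβα j).trans_le (hαm.monotone hj)).ne
          · exact ((hαβ m).trans_le (hβm.monotone hj)).ne'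
        exact (mul_ne_zero hc.ne' h2) h
    -- For `k ≥ n` there is no root to find; `β k` is a filler that keeps the interlacing valid for
    -- every index.
    · refine ⟨β k, le_rfl, ?_, ?_, fun h => absurd h hk⟩
      · rintro rfl; exact hε
      · rintro m rfl; exact hαβ m
  choose s hs1 hs2 hs3 hs4 using key
  exact ⟨s, hs2 0 rfl, hs1, fun k => hs3 _ k rfl, fun k hk => sub_eq_zero.1 (hs4 k hk)⟩

section Field

open Polynomial

variable {K : Type*} [Field K]

lemma degree_nodal_sub_nodal_lt (n : ℕ) (a b : ℕ → K) :
    (Lagrange.nodal (Finset.range n) a - Lagrange.nodal (Finset.range n) b).degree < (n : ℕ) := by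
  rcases Nat.eq_zero_or_pos n with rfl | hn
  · simp
  · refine (Polynomial.degree_sub_lt_left ?_ Lagrange.nodal_ne_zero ?_).trans_le ?_
    · simp [Lagrange.degree_nodal]
    · simp [Lagrange.nodal_monic.leadingCoeff]
    · simp [Lagrange.degree_nodal]

/-- Up to the common sign both sides have leading term `(c - κ) uⁿ`, so their difference has degree
below `n`; it vanishes at the `n` distinct points `s k`. -/
lemma mul_prod_sub_mul_prod_eq {n : ℕ} {α β s : ℕ → K} {c κ : K}
    (hs : Set.InjOn s (Finset.range n))
    (h : ∀ k < n, c * ∏ j ∈ Finset.range n, (β j - s k) =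
      κ * ∏ j ∈ Finset.range n, (α j - s k)) (u : K) :
    c * ∏ j ∈ Finset.range n, (β j - u) - κ * ∏ j ∈ Finset.range n, (α j - u) =
      (c - κ) * ∏ j ∈ Finset.range n, (s j - u) := by
  have hQ : C c * (Lagrange.nodal (Finset.range n) β - Lagrange.nodal (Finset.range n) s) -
      C κ * (Lagrange.nodal (Finset.range n) α - Lagrange.nodal (Finset.range n) s) = 0 := by
    refine Polynomial.eq_zero_of_degree_lt_of_eval_index_eq_zero (Finset.range n) hs ?_ fun k hk => ?_
    · rw [Finset.card_range]
      refine (degree_sub_le _ _).trans_lt (max_lt ?_ ?_) <;>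
      · rw [← smul_eq_C_mul]
        exact (degree_smul_le _ _).trans_lt (degree_nodal_sub_nodal_lt _ _ _)
    · have := h k (Finset.mem_range.1 hk)
      rw [prod_sub_comm, prod_sub_comm, mul_left_comm, mul_left_comm κ] at this
      have := mul_left_cancel₀ (pow_ne_zero n (neg_ne_zero.2 one_ne_zero)) this
      simp [Lagrange.eval_nodal, Finset.prod_eq_zero hk, this]
  have := congrArg (fun q => (-1) ^ n * q.eval u) hQ
  simp only [eval_sub, eval_mul, eval_C, Lagrange.eval_nodal, eval_zero, mul_zero] at this
  rw [prod_sub_comm, prod_sub_comm, prod_sub_comm]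
  linear_combination this

/-- Lagrange interpolation at the nodes `s k` of `∏ (u - α j) - ∏ (u - s j)`, which has degree below
`n` and takes the value `∏ (s k - α j)` at `s k`. -/
lemma prod_sub_eq_partial_fractions {n : ℕ} {α s : ℕ → K} (hs : Set.InjOn s (Finset.range n))
    {u : K} (hu : ∀ k < n, u ≠ s k) :
    ∏ j ∈ Finset.range n, (α j - u) = (∏ j ∈ Finset.range n, (s j - u)) *
      (1 + ∑ k ∈ Finset.range n, (α k - s k) *
        (∏ j ∈ (Finset.range n).erase k, (α j - s k) / (s j - s k)) / (s k - u)) := by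
  have hI := Lagrange.eq_interpolate_of_eval_eq
    (f := Lagrange.nodal (Finset.range n) α - Lagrange.nodal (Finset.range n) s)
    (fun k => ∏ j ∈ Finset.range n, (s k - α j)) hs
    (by rw [Finset.card_range]; exact degree_nodal_sub_nodal_lt _ _ _)
    (fun k hk => by simp [Lagrange.eval_nodal, Finset.prod_eq_zero hk])
  have h2 := congrArg (fun q => q.eval u) hI
  simp only [Lagrange.eval_interpolate_not_at_node _ (fun k hk => hu k (Finset.mem_range.1 hk)),
    eval_sub, Lagrange.eval_nodal] at h2
  have h3 : ∀ k ∈ Finset.range n, Lagrange.nodalWeight (Finset.range n) s k * (u - s k)⁻¹ *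
      ∏ j ∈ Finset.range n, (s k - α j) = (α k - s k) *
        (∏ j ∈ (Finset.range n).erase k, (α j - s k) / (s j - s k)) / (s k - u) := by
    intro k hk
    rw [Lagrange.nodalWeight, ← Finset.mul_prod_erase _ _ hk]
    have : ∀ j ∈ (Finset.range n).erase k, (α j - s k) / (s j - s k) =
        (s k - s j)⁻¹ * (s k - α j) := by
      intro j _
      rw [← neg_sub (s k), ← neg_sub (s k) (s j), neg_div_neg_eq, div_eq_inv_mul]
    rw [Finset.prod_congr rfl this, Finset.prod_mul_distrib, ← neg_sub (s k) (α k),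
      ← neg_sub u (s k), neg_mul, neg_div_neg_eq]
    ring
  rw [Finset.sum_congr rfl h3] at h2
  rw [prod_sub_comm, prod_sub_comm]
  linear_combination (-1) ^ n * h2

end Field

/-- Since `α j` lies between `s j` and `s (j + 1)`, the numbers `α j - s k` and `s j - s k` have the
same sign for every `j ≠ k`. -/
lemma partial_fraction_coeff_pos {n : ℕ} {α β s : ℕ → ℝ} (hβα : ∀ j, β j < α j)
    (hsβ : ∀ k, s k ≤ β k) (hαs : ∀ k, α k < s (k + 1)) (k : ℕ) :
    0 < (α k - s k) * ∏ j ∈ (Finset.range n).erase k, (α j - s k) / (s j - s k) := by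
  have hsα : ∀ k, s k < α k := fun k => (hsβ k).trans_lt (hβα k)
  have hsm : StrictMono s := strictMono_nat_of_lt_succ fun j => (hsα j).trans (hαs j)
  have hαm : StrictMono α := strictMono_nat_of_lt_succ fun j => (hαs j).trans (hsα _)
  refine mul_pos (sub_pos.2 (hsα k)) (Finset.prod_pos fun j hj => ?_)
  rcases lt_or_gt_of_ne (Finset.mem_erase.1 hj).1 with h | h
  · refine div_pos_of_neg_of_neg (sub_neg.2 ?_) (sub_neg.2 (hsm h))
    obtain ⟨m, rfl⟩ : ∃ m, k = m + 1 := ⟨k - 1, by omega⟩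
    exact (hαm.monotone (by omega : j ≤ m)).trans_lt (hαs m)
  · exact div_pos (sub_pos.2 ((hsm h).trans (hsα j))) (sub_pos.2 (hsm h))

/-! ### The entire function `1 / (Γ(A + w) Γ(A - w))` and its Euler product -/

/-- The even entire function `w ↦ 1 / (Γ(A + w) Γ(A - w))`. -/
def gammaInv (A : ℝ) (w : ℂ) : ℂ :=
  (Complex.Gamma (A + w))⁻¹ * (Complex.Gamma (A - w))⁻¹

/-- The Euler products of `1 / (Γ(A + w) Γ(A - w))`, as functions of `u = w²`. -/
def gammaInvSeq (A : ℝ) (N : ℕ) {K : Type*} [Field K] [Algebra ℝ K] (u : K) : K :=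
  (∏ j ∈ Finset.range (N + 1), (algebraMap ℝ K ((A + j) ^ 2) - u)) /
    algebraMap ℝ K ((N : ℝ) ^ (2 * A) * (N.factorial : ℝ) ^ 2)

lemma gammaInvSeq_complex (A : ℝ) (N : ℕ) (u : ℂ) :
    gammaInvSeq A N u = (∏ j ∈ Finset.range (N + 1), ((((A + j) ^ 2 : ℝ) : ℂ) - u)) /
      (((N : ℝ) ^ (2 * A) * (N.factorial : ℝ) ^ 2 : ℝ) : ℂ) := rfl

lemma gammaInvSeq_real (A : ℝ) (N : ℕ) (u : ℝ) :
    gammaInvSeq A N u = (∏ j ∈ Finset.range (N + 1), ((A + j) ^ 2 - u)) /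
      ((N : ℝ) ^ (2 * A) * (N.factorial : ℝ) ^ 2) := rfl

lemma gammaInvSeq_ofReal (A : ℝ) (N : ℕ) (u : ℝ) :
    gammaInvSeq A N (u : ℂ) = ((gammaInvSeq A N u : ℝ) : ℂ) := by
  rw [gammaInvSeq_complex, gammaInvSeq_real]
  push_cast
  rfl

lemma gammaInv_neg (A : ℝ) (w : ℂ) : gammaInv A (-w) = gammaInv A w := by
  simp only [gammaInv, sub_neg_eq_add, ← sub_eq_add_neg, mul_comm]

lemma differentiable_gammaInv (A : ℝ) : Differentiable ℂ (gammaInv A) := by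
  unfold gammaInv
  exact (Complex.differentiable_one_div_Gamma.comp (by fun_prop)).mul
    (Complex.differentiable_one_div_Gamma.comp (by fun_prop))

lemma gammaInv_eq_zero_iff {A : ℝ} {w : ℂ} :
    gammaInv A w = 0 ↔ ∃ j : ℕ, w ^ 2 = (((A + j) ^ 2 : ℝ) : ℂ) := by
  simp only [gammaInv, mul_eq_zero, inv_eq_zero, Complex.Gamma_eq_zero_iff, ← exists_or]
  refine exists_congr fun j => ?_
  rw [← sub_eq_zero (a := w ^ 2), ← sub_eq_zero (a := (A : ℂ) + w),
    ← sub_eq_zero (a := (A : ℂ) - w), ← mul_eq_zero, ← neg_eq_zero (a := _ - _)]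
  push_cast
  ring_nf

/-- At a pole `s = -m` the convention `Γ(s) = 0` gives `1/Γ` its correct value `0`, and the Euler
product is eventually `0` too because its factor `j = m` vanishes. -/
lemma tendsto_inv_GammaSeq (s : ℂ) :
    Tendsto (fun n => (Complex.GammaSeq s n)⁻¹) atTop (𝓝 (Complex.Gamma s)⁻¹) := by
  by_cases h : Complex.Gamma s = 0
  · obtain ⟨m, rfl⟩ := (Complex.Gamma_eq_zero_iff s).1 h
    rw [h]
    refine tendsto_const_nhds.congr' ?_
    filter_upwards [eventually_ge_atTop m] with n hn
    have : ∏ j ∈ Finset.range (n + 1), (-(m : ℂ) + j) = 0 :=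
      Finset.prod_eq_zero (Finset.mem_range.2 (by omega)) (neg_add_cancel _)
    simp [Complex.GammaSeq, this]
  · exact (Complex.GammaSeq_tendsto_Gamma s).inv₀ h

lemma tendsto_gammaInvSeq (A : ℝ) (w : ℂ) :
    Tendsto (fun N => gammaInvSeq A N (w ^ 2)) atTop (𝓝 (gammaInv A w)) := by
  refine ((tendsto_inv_GammaSeq (A + w)).mul (tendsto_inv_GammaSeq (A - w))).congr' ?_
  filter_upwards [eventually_ge_atTop 1] with n hn
  have hn0 : (n : ℂ) ≠ 0 := by exact_mod_cast (by omega : n ≠ 0)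
  have h1 : (((n : ℝ) ^ (2 * A) : ℝ) : ℂ) = (n : ℂ) ^ ((A : ℂ) + w) * (n : ℂ) ^ ((A : ℂ) - w) := by
    rw [← Complex.cpow_add _ _ hn0, Complex.ofReal_cpow (by positivity)]
    congr 1
    push_cast
    ring
  have h2 : ∏ j ∈ Finset.range (n + 1), ((((A + j) ^ 2 : ℝ) : ℂ) - w ^ 2) =
      (∏ j ∈ Finset.range (n + 1), ((A : ℂ) + w + j)) *
        ∏ j ∈ Finset.range (n + 1), ((A : ℂ) - w + j) := by
    rw [← Finset.prod_mul_distrib]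
    refine Finset.prod_congr rfl fun j _ => ?_
    push_cast
    ring
  rw [gammaInvSeq_complex, h2, Complex.ofReal_mul, h1, Complex.GammaSeq, Complex.GammaSeq,
    inv_div, inv_div, div_mul_div_comm]
  congr 1
  push_cast
  ring

/-- The Euler products depend on `w` only through `w²`, so on the real and imaginary axes the
function is a limit of real numbers. All sign arguments go through this real sequence. -/
lemma exists_gammaInv_eq_ofReal (A : ℝ) {w : ℂ} {r : ℝ} (hw : w ^ 2 = r) :
    ∃ L : ℝ, gammaInv A w = L ∧ Tendsto (fun N => gammaInvSeq A N r) atTop (𝓝 L) := by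
  have h := tendsto_gammaInvSeq A w
  simp only [hw, gammaInvSeq_ofReal] at h
  have hre := (Complex.continuous_re.tendsto _).comp h
  have him := (Complex.continuous_im.tendsto _).comp h
  simp only [Function.comp_def, Complex.ofReal_re, Complex.ofReal_im] at hre him
  have h0 := tendsto_nhds_unique him tendsto_const_nhds
  exact ⟨_, Complex.ext rfl (by simpa using h0), hre⟩

lemma gammaInvSeq_nonneg_of_le {A : ℝ} {k N : ℕ} (hk : k ≤ N + 1) {x : ℝ}
    (h1 : ∀ j < k, (A + j) ^ 2 ≤ x) (h2 : ∀ j : ℕ, k ≤ j → x ≤ (A + j) ^ 2) :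
    0 ≤ (-1) ^ k * gammaInvSeq A N x := by
  rw [gammaInvSeq_real, ← mul_div_assoc]
  refine div_nonneg ?_ (by positivity)
  exact neg_one_pow_mul_prod_nonneg (a := fun j : ℕ => (A + j) ^ 2) hk h1 fun j hj _ => h2 j hj

lemma gammaInv_sign {A : ℝ} {k : ℕ} {w : ℂ} {x : ℝ} (hw : w ^ 2 = x)
    (h1 : ∀ j < k, (A + j) ^ 2 ≤ x) (h2 : ∀ j : ℕ, k ≤ j → x ≤ (A + j) ^ 2) :
    0 ≤ (-1) ^ k * (gammaInv A w).re := by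
  obtain ⟨L, hL, hT⟩ := exists_gammaInv_eq_ofReal A hw
  rw [hL, Complex.ofReal_re]
  refine ge_of_tendsto (hT.const_mul _) ?_
  filter_upwards [eventually_ge_atTop k] with N hN
  exact gammaInvSeq_nonneg_of_le (by omega) h1 h2

/-- Limits of the products give only `≥ 0`; strictness follows because every zero has `w² ≥ A²`. -/
lemma gammaInv_pos {A : ℝ} (hA : 0 < A) {w : ℂ} {x : ℝ} (hw : w ^ 2 = x) (hx : x < A ^ 2) :
    0 < (gammaInv A w).re := by
  have hj : ∀ j : ℕ, A ^ 2 ≤ (A + j) ^ 2 := fun j => by gcongr; simp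
  have h0 := gammaInv_sign (k := 0) hw (by simp) fun j _ => hx.le.trans (hj j)
  obtain ⟨L, hL, -⟩ := exists_gammaInv_eq_ofReal A hw
  refine lt_of_le_of_ne (by simpa using h0) fun h => ?_
  have : gammaInv A w = 0 := by
    rw [hL] at h ⊢
    simpa using h.symm
  obtain ⟨j, hj'⟩ := gammaInv_eq_zero_iff.1 this
  rw [hw] at hj'
  have := Complex.ofReal_injective hj'
  linarith [hj j]

/-! ### Truncated partial fraction expansions -/

/-- Over a common denominator the two normalisations differ by the factor `N^(2(A-B))`, which plays
the role of `c` in the interlacing lemmas and exceeds `κ` for large `N`. -/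
lemma gammaInvSeq_sub_eq {A B κ : ℝ} {N : ℕ} (hN : 1 ≤ N) {K : Type*} [Field K] [Algebra ℝ K]
    (u : K) :
    gammaInvSeq B N u - algebraMap ℝ K κ * gammaInvSeq A N u =
      (algebraMap ℝ K ((N : ℝ) ^ (2 * (A - B))) *
        ∏ j ∈ Finset.range (N + 1), (algebraMap ℝ K ((B + j) ^ 2) - u) -
      algebraMap ℝ K κ * ∏ j ∈ Finset.range (N + 1), (algebraMap ℝ K ((A + j) ^ 2) - u)) /
        algebraMap ℝ K ((N : ℝ) ^ (2 * A) * (N.factorial : ℝ) ^ 2) := by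
  have hN0 : (0 : ℝ) < N := by exact_mod_cast hN
  have h : (N : ℝ) ^ (2 * A) * (N.factorial : ℝ) ^ 2 =
      (N : ℝ) ^ (2 * (A - B)) * ((N : ℝ) ^ (2 * B) * (N.factorial : ℝ) ^ 2) := by
    rw [← mul_assoc, ← Real.rpow_add hN0]
    ring_nf
  have h0 : algebraMap ℝ K ((N : ℝ) ^ (2 * (A - B))) ≠ 0 := by
    rw [Ne, map_eq_zero]; positivity
  rw [gammaInvSeq, gammaInvSeq, h,
    map_mul (algebraMap ℝ K) ((N : ℝ) ^ (2 * (A - B))), sub_div, mul_div_mul_left _ _ h0, mul_div_assoc]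

/-- The data of a partial fraction expansion at level `N`. -/
def IsTruncExpansion (A B κ ε : ℝ) (N : ℕ) (s b : ℕ → ℝ) (T : ℝ) : Prop :=
  ε ≤ s 0 ∧ (∀ k, s k ≤ (B + k) ^ 2) ∧ (∀ k : ℕ, (A + k) ^ 2 ≤ s (k + 1)) ∧ (∀ k, 0 ≤ b k) ∧
  (∀ n, ∑ k ∈ Finset.range n, b k ≤ T) ∧
  ∀ u : ℂ, (∀ k, u ≠ s k) → gammaInvSeq A N u = (gammaInvSeq B N u - κ * gammaInvSeq A N u) *
    (T + ∑' k, (b k : ℂ) * (u / (s k - u)))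

lemma exists_isTruncExpansion {A B κ ε : ℝ} (hB : 0 < B) (hBA : B < A) (hAB : A < B + 1)
    (hκ : 0 ≤ κ) (hε : 0 < ε) (hεB : ε ≤ B ^ 2) {N : ℕ} (hN : 1 ≤ N)
    (hc : κ < (N : ℝ) ^ (2 * (A - B)))
    (hHε : 0 < gammaInvSeq B N ε - κ * gammaInvSeq A N ε) :
    ∃ s b T, IsTruncExpansion A B κ ε N s b T := by
  have hβα : ∀ j : ℕ, (B + j) ^ 2 < (A + j) ^ 2 := fun j => by gcongr
  have hαβ : ∀ j : ℕ, (A + j) ^ 2 < (B + (j + 1 : ℕ)) ^ 2 := fun j => by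
    push_cast
    have : 0 < A := hB.trans hBA
    gcongr ?_ ^ 2
    linarith
  set c : ℝ := (N : ℝ) ^ (2 * (A - B)) with hcdef
  have hN0 : (0 : ℝ) < N := by exact_mod_cast hN
  have hD : 0 < (N : ℝ) ^ (2 * A) * (N.factorial : ℝ) ^ 2 := by positivity
  have hHε' := gammaInvSeq_sub_eq (A := A) (B := B) (κ := κ) hN (K := ℝ) ε
  simp only [Algebra.algebraMap_self, RingHom.id_apply] at hHε'
  rw [hHε', div_pos_iff_of_pos_right hD] at hHε
  obtain ⟨s, hs0, hsβ, hαs, hroot⟩ := exists_roots_of_interlacing hβα hαβ hκ (hκ.trans_lt hc)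
    (by simpa using hεB) hHε
  have hsα : ∀ k, s k < (A + k) ^ 2 := fun k => (hsβ k).trans_lt (hβα k)
  have hsm : StrictMono s := strictMono_nat_of_lt_succ fun j => (hsα j).trans (hαs j)
  have hspos : ∀ k, 0 < s k := fun k => (hε.trans_le hs0).trans_le (hsm.monotone k.zero_le)
  set r : ℕ → ℝ := fun k => ((A + k) ^ 2 - s k) *
    ∏ j ∈ (Finset.range (N + 1)).erase k, ((A + j) ^ 2 - s k) / (s j - s k) with hr
  have hrpos : ∀ k, 0 < r k := partial_fraction_coeff_pos hβα hsβ hαs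
  have hcκ : 0 < c - κ := sub_pos.2 hc
  -- From `r/(s-u) = r/s + (r/s)·u/(s-u)`: the value at `u = 0` is collected in `T`, and the
  -- remaining terms are `O(s⁻²)·r` rather than `O(s⁻¹)·r`. The constant `1/(c-κ)` is the excess of
  -- `T` over `∑ b k`.
  set b : ℕ → ℝ := fun k => if k < N + 1 then r k / (s k * (c - κ)) else 0 with hb
  have hb0 : ∀ k, 0 ≤ b k := fun k => by
    simp only [hb]
    split_ifs
    · have := hrpos k; have := hspos k; positivity
    · exact le_rfl
  have hbsum : HasSum b (∑ k ∈ Finset.range (N + 1), b k) :=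
    hasSum_sum_of_ne_finset_zero fun k hk => if_neg (by simpa using hk)
  refine ⟨s, b, 1 / (c - κ) + ∑ k ∈ Finset.range (N + 1), b k, hs0, hsβ, fun k => (hαs k).le, hb0,
    fun n => ?_, fun u hu => ?_⟩
  · have := sum_le_hasSum (Finset.range n) (fun k _ => hb0 k) hbsum
    have : 0 < 1 / (c - κ) := by positivity
    linarith
  · have hinj : Set.InjOn (fun k => (s k : ℂ)) (Finset.range (N + 1)) :=
      (Complex.ofReal_injective.comp hsm.injective).injOn
    have hpf := prod_sub_eq_partial_fractions (α := fun j : ℕ => (((A + j) ^ 2 : ℝ) : ℂ)) hinj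
      (u := u) (fun k _ => hu k)
    have hfac := mul_prod_sub_mul_prod_eq (α := fun j : ℕ => (((A + j) ^ 2 : ℝ) : ℂ))
      (β := fun j : ℕ => (((B + j) ^ 2 : ℝ) : ℂ)) (c := (c : ℂ)) (κ := (κ : ℂ)) hinj
      (fun k hk => by exact_mod_cast hroot k hk) u
    have hsub := gammaInvSeq_sub_eq (A := A) (B := B) (κ := κ) hN (K := ℂ) u
    simp only [Complex.coe_algebraMap] at hsub
    have hcκ' : (c : ℂ) - κ ≠ 0 := by exact_mod_cast hcκ.ne'
    rw [hsub, hfac, gammaInvSeq_complex, hpf, mul_comm ((c : ℂ) - κ), div_mul_eq_mul_div, mul_assoc]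
    congr 2
    rw [tsum_eq_sum (s := Finset.range (N + 1)) (fun k hk => by
      simp only [hb, if_neg (show ¬ k < N + 1 by simpa using hk)]; simp)]
    push_cast
    rw [add_assoc, ← Finset.sum_add_distrib, mul_add, mul_one_div_cancel hcκ', Finset.mul_sum]
    congr 1
    refine Finset.sum_congr rfl fun k hk => ?_
    have h1 : (s k : ℂ) - u ≠ 0 := sub_ne_zero.2 (hu k).symm
    have h2 : (s k : ℂ) ≠ 0 := by exact_mod_cast (hspos k).ne'
    have h3 : (b k : ℂ) = (r k : ℂ) / (s k * (c - κ)) := by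
      simp only [hb, if_pos (Finset.mem_range.1 hk)]
      push_cast
      rfl
    rw [h3]
    simp only [hr]
    push_cast
    field_simp
    ring

/-! ### Passing to the limit -/

lemma exists_tendsto_ultrafilter {ι : Type*} (𝒰 : Ultrafilter ι) {x : ι → ℝ} {a b : ℝ}
    (h : ∀ᶠ i in 𝒰, x i ∈ Set.Icc a b) : ∃ l ∈ Set.Icc a b, Tendsto x 𝒰 (𝓝 l) :=
  isCompact_Icc.ultrafilter_le_nhds (𝒰.map x) (Filter.le_principal_iff.2 h)

lemma eventually_isTruncExpansion {A B κ ε : ℝ} (hB : 0 < B) (hBA : B < A) (hAB : A < B + 1)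
    (hκ : 0 ≤ κ) (hε : 0 < ε) (hεB : ε ≤ B ^ 2)
    (hHε : 0 < (gammaInv B (√ε : ℝ) - κ * gammaInv A (√ε : ℝ)).re) :
    ∀ᶠ N in atTop, ∃ d : (ℕ → ℝ) × (ℕ → ℝ) × ℝ,
      IsTruncExpansion A B κ ε N d.1 d.2.1 d.2.2 := by
  have hsq : ((√ε : ℝ) : ℂ) ^ 2 = (ε : ℝ) := by exact_mod_cast Real.sq_sqrt hε.le
  obtain ⟨LA, hLA, hTA⟩ := exists_gammaInv_eq_ofReal A hsq
  obtain ⟨LB, hLB, hTB⟩ := exists_gammaInv_eq_ofReal B hsq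
  rw [hLA, hLB] at hHε
  have hpos : 0 < LB - κ * LA := by simpa using hHε
  have hc : Tendsto (fun N : ℕ => (N : ℝ) ^ (2 * (A - B))) atTop atTop :=
    (tendsto_rpow_atTop (by linarith)).comp tendsto_natCast_atTop_atTop
  filter_upwards [eventually_ge_atTop 1, hc.eventually_gt_atTop κ,
    (hTB.sub (hTA.const_mul κ)).eventually_const_lt hpos] with N hN h1 h2
  obtain ⟨s, b, T, h⟩ := exists_isTruncExpansion hB hBA hAB hκ hε hεB hN h1 h2
  exact ⟨(s, b, T), h⟩

lemma summable_shift_inv_sq (C : ℝ) : Summable fun k : ℕ => C / ((k : ℝ) - 1) ^ 2 := by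
  rw [← summable_nat_add_iff 1]
  have := (Real.summable_one_div_nat_pow (p := 2)).2 (by norm_num)
  refine (this.mul_left C).congr fun k => ?_
  push_cast
  ring

/-- Dominated convergence with only a uniform bound on the coefficients: `s i k ≥ (k-1)²` gives `‖s
i k - u‖ > (k-1)²/2` for large `k`, so the tail is `O(k⁻²)`. The finitely many other terms are
bounded because they converge. -/
lemma tendsto_tsum_ratio {ι : Type*} {l : Filter ι} {s b : ι → ℕ → ℝ} {s' b' : ℕ → ℝ} {M : ℝ}
    (hs : ∀ᶠ i in l, ∀ k : ℕ, (k : ℝ) ^ 2 ≤ s i (k + 1))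
    (hb : ∀ᶠ i in l, ∀ k, b i k ∈ Set.Icc 0 M)
    (hs' : ∀ k, Tendsto (s · k) l (𝓝 (s' k))) (hb' : ∀ k, Tendsto (b · k) l (𝓝 (b' k)))
    {u : ℂ} (hu : ∀ k, u ≠ s' k) :
    (∀ᶠ i in l, ∀ k, u ≠ s i k) ∧
    Tendsto (fun i => ∑' k, (b i k : ℂ) * (u / (s i k - u))) l
      (𝓝 (∑' k, (b' k : ℂ) * (u / (s' k - u)))) := by
  obtain ⟨K, hK⟩ : ∃ K : ℕ, ∀ k : ℕ, K ≤ k → 2 * ‖u‖ + 1 ≤ ((k : ℝ)) ^ 2 := by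
    have : Tendsto (fun k : ℕ => (k : ℝ) ^ 2) atTop atTop :=
      (tendsto_pow_atTop two_ne_zero).comp tendsto_natCast_atTop_atTop
    exact eventually_atTop.1 (this.eventually_ge_atTop _)
  have hlarge : ∀ᶠ i in l, ∀ k, K < k → ((k : ℝ) - 1) ^ 2 / 2 < ‖(s i k : ℂ) - u‖ := by
    filter_upwards [hs] with i hi k hk
    obtain ⟨m, rfl⟩ : ∃ m, k = m + 1 := ⟨k - 1, by omega⟩
    have h1 := hK m (by omega)
    have h2 := hi m
    have h3 := norm_sub_norm_le (s i (m + 1) : ℂ) u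
    rw [Complex.norm_real, Real.norm_of_nonneg ((sq_nonneg _).trans h2)] at h3
    push_cast
    rw [add_sub_cancel_right]
    linarith
  have htend : ∀ k, Tendsto (fun i => (b i k : ℂ) * (u / (s i k - u))) l
      (𝓝 ((b' k : ℂ) * (u / (s' k - u)))) := fun k => by
    refine ((Complex.continuous_ofReal.tendsto _).comp (hb' k)).mul (tendsto_const_nhds.div ?_
      (sub_ne_zero.2 (hu k).symm))
    exact ((Complex.continuous_ofReal.tendsto _).comp (hs' k)).sub_const u
  constructor
  · have hsmall : ∀ᶠ i in l, ∀ k ∈ Finset.range (K + 1), u ≠ s i k := by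
      rw [Filter.eventually_all_finset]
      intro k _
      exact (((Complex.continuous_ofReal.tendsto _).comp (hs' k)).eventually_ne (hu k).symm).mono
        fun i hi => Ne.symm hi
    filter_upwards [hsmall, hlarge] with i h1 h2 k
    rcases le_or_gt k K with hk | hk
    · exact h1 k (Finset.mem_range.2 (by omega))
    · intro h
      have := h2 k hk
      rw [h, sub_self, norm_zero] at this
      have : 0 ≤ ((k : ℝ) - 1) ^ 2 / 2 := by positivity
      linarith
  · refine tendsto_tsum_of_dominated_convergence
      (bound := fun k : ℕ => (if k ∈ Finset.range (K + 1) then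
        ‖(b' k : ℂ) * (u / (s' k - u))‖ + 1 else 0) + (M * (2 * ‖u‖)) / ((k : ℝ) - 1) ^ 2)
      ?_ htend ?_
    · refine Summable.add ?_ (summable_shift_inv_sq _)
      exact summable_of_ne_finset_zero (s := Finset.range (K + 1)) fun k hk => if_neg hk
    · have hsmall : ∀ᶠ i in l, ∀ k ∈ Finset.range (K + 1), ‖(b i k : ℂ) * (u / (s i k - u))‖ ≤
          ‖(b' k : ℂ) * (u / (s' k - u))‖ + 1 := by
        rw [Filter.eventually_all_finset]
        intro k _
        exact (htend k).norm.eventually_le_const (lt_add_one _)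
      filter_upwards [hsmall, hlarge, hb] with i h1 h2 h3 k
      have hM : 0 ≤ M := (h3 k).1.trans (h3 k).2
      by_cases hk : k ∈ Finset.range (K + 1)
      · rw [if_pos hk]
        have : 0 ≤ (M * (2 * ‖u‖)) / ((k : ℝ) - 1) ^ 2 := by positivity
        linarith [h1 k hk]
      · rw [if_neg hk, zero_add, norm_mul, norm_div, Complex.norm_real,
          Real.norm_of_nonneg (h3 k).1]
        have hk' : K < k := by simpa using hk
        -- The bound divides by `(k-1)²`, which is `0` at `k = 1`; that index is excluded since `K =
        -- 0` would give `2‖u‖ + 1 ≤ 0`.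
        have hk1 : 1 < k := by
          by_contra hcon
          have : K = 0 := by omega
          have h6 := hK 0 (by omega)
          have h7 := norm_nonneg u
          norm_num at h6
          linarith
        have hk0 : (0 : ℝ) < (k : ℝ) - 1 := by
          have : (1 : ℝ) < k := by exact_mod_cast hk1
          linarith
        have h5 := h2 k hk'
        calc b i k * (‖u‖ / ‖(s i k : ℂ) - u‖) ≤ M * (‖u‖ / (((k : ℝ) - 1) ^ 2 / 2)) := by
              gcongr
              exact (h3 k).2
          _ = _ := by field_simp

/-- Each `s k` stays in a fixed compact interval by interlacing and each `b k` in `[0, T + 1]`, so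
all of them converge along one ultrafilter, in place of a diagonal subsequence. For the total mass
only `∑ b k ≤ T` survives at this stage, since mass could escape to infinity. -/
lemma exists_limit_expansion {A B κ ε : ℝ} (hB : 0 < B) (hBA : B < A) (hAB : A < B + 1)
    (hκ : 0 ≤ κ) (hε : 0 < ε) (hεB : ε ≤ B ^ 2)
    (hH0 : 0 < (gammaInv B 0 - κ * gammaInv A 0).re)
    (hHε : 0 < (gammaInv B (√ε : ℝ) - κ * gammaInv A (√ε : ℝ)).re) :
    ∃ (s b : ℕ → ℝ) (T : ℝ), ε ≤ s 0 ∧ (∀ k, s k ≤ (B + k) ^ 2) ∧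
      (∀ k : ℕ, (A + k) ^ 2 ≤ s (k + 1)) ∧ (∀ k, 0 ≤ b k) ∧
      (∀ n, ∑ k ∈ Finset.range n, b k ≤ T) ∧
      ∀ w : ℂ, (∀ k, w ^ 2 ≠ s k) → gammaInv A w = (gammaInv B w - κ * gammaInv A w) *
        (T + ∑' k, (b k : ℂ) * (w ^ 2 / (s k - w ^ 2))) := by
  obtain ⟨d, hd⟩ := Filter.skolem.1 (eventually_isTruncExpansion hB hBA hAB hκ hε hεB hHε)
  have h𝒰 : (hyperfilter ℕ : Filter ℕ) ≤ atTop := Nat.hyperfilter_le_atTop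
  obtain ⟨LA, hLA, hTA⟩ := exists_gammaInv_eq_ofReal A (w := 0) (r := 0) (by simp)
  obtain ⟨LB, hLB, hTB⟩ := exists_gammaInv_eq_ofReal B (w := 0) (r := 0) (by simp)
  have hpos : 0 < LB - κ * LA := by rw [hLA, hLB] at hH0; simpa using hH0
  -- At `u = 0` the series vanishes, so the constant at level `N` is the quotient of the Euler
  -- products at `0`, whose limit exists.
  have hT : Tendsto (fun N => (d N).2.2) atTop (𝓝 (LA / (LB - κ * LA))) := by
    have h1 := hTB.sub (hTA.const_mul κ)
    refine (hTA.div h1 hpos.ne').congr' ?_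
    filter_upwards [hd, h1.eventually_const_lt hpos] with N hN hN1
    have h2 := hN.2.2.2.2.2 0 fun k => by
      have h3 : 0 < (d N).1 k := by
        cases k with
        | zero => exact hε.trans_le hN.1
        | succ m =>
          refine lt_of_lt_of_le ?_ (hN.2.2.1 m)
          have : 0 < A := hB.trans hBA
          positivity
      exact_mod_cast h3.ne
    have h3 : gammaInvSeq A N (0 : ℝ) =
        (gammaInvSeq B N (0 : ℝ) - κ * gammaInvSeq A N (0 : ℝ)) * (d N).2.2 := by
      have h0 := gammaInvSeq_ofReal A N 0
      have h0' := gammaInvSeq_ofReal B N 0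
      rw [Complex.ofReal_zero] at h0 h0'
      rw [h0, h0'] at h2
      simp only [zero_div, mul_zero, tsum_zero, add_zero] at h2
      exact_mod_cast h2
    show gammaInvSeq A N (0 : ℝ) / _ = _
    rw [h3, mul_div_cancel_left₀]
    exact hN1.ne'
  set T := LA / (LB - κ * LA)
  have hsk : ∀ k : ℕ, ∃ l : ℝ, (l ≤ (B + k) ^ 2 ∧ (k = 0 → ε ≤ l) ∧
      ∀ m : ℕ, k = m + 1 → (A + m) ^ 2 ≤ l) ∧
      Tendsto (fun N => (d N).1 k) (hyperfilter ℕ) (𝓝 l) := by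
    intro k
    cases k with
    | zero =>
      obtain ⟨l, hl, hl'⟩ := exists_tendsto_ultrafilter (hyperfilter ℕ) (x := fun N => (d N).1 0)
        (a := ε) (b := (B + (0 : ℕ)) ^ 2) (h𝒰 (hd.mono fun N h => ⟨h.1, h.2.1 0⟩))
      exact ⟨l, ⟨hl.2, fun _ => hl.1, by simp⟩, hl'⟩
    | succ m =>
      obtain ⟨l, hl, hl'⟩ := exists_tendsto_ultrafilter (hyperfilter ℕ)
        (x := fun N => (d N).1 (m + 1)) (a := (A + m) ^ 2) (b := (B + (m + 1 : ℕ)) ^ 2)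
        (h𝒰 (hd.mono fun N h => ⟨h.2.2.1 m, h.2.1 (m + 1)⟩))
      refine ⟨l, ⟨hl.2, by simp, fun m' hm => ?_⟩, hl'⟩
      obtain rfl : m = m' := by omega
      exact hl.1
  have hbM : ∀ᶠ N in (hyperfilter ℕ : Filter ℕ), ∀ k, (d N).2.1 k ∈ Set.Icc 0 (T + 1) := by
    refine h𝒰 ?_
    filter_upwards [hd, hT.eventually_le_const (lt_add_one T)] with N h1 h2 k
    refine ⟨h1.2.2.2.1 k, le_trans ?_ ((h1.2.2.2.2.1 (k + 1)).trans h2)⟩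
    exact Finset.single_le_sum (f := (d N).2.1) (fun j _ => h1.2.2.2.1 j)
      (Finset.mem_range.2 k.lt_succ_self)
  have hbk : ∀ k, ∃ l ∈ Set.Icc 0 (T + 1),
      Tendsto (fun N => (d N).2.1 k) (hyperfilter ℕ) (𝓝 l) := fun k =>
    exists_tendsto_ultrafilter _ (hbM.mono fun N h => h k)
  choose s hs hs' using hsk
  choose b hb hb' using hbk
  refine ⟨s, b, T, (hs 0).2.1 rfl, fun k => (hs k).1, fun k => (hs _).2.2 k rfl,
    fun k => (hb k).1, fun n => ?_, fun w hw => ?_⟩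
  · exact le_of_tendsto_of_tendsto (tendsto_finsetSum _ fun k _ => hb' k) (hT.mono_left h𝒰)
      (h𝒰 (hd.mono fun N h => h.2.2.2.2.1 n))
  · obtain ⟨h1, h2⟩ := tendsto_tsum_ratio (l := (hyperfilter ℕ : Filter ℕ))
      (s := fun N => (d N).1) (b := fun N => (d N).2.1)
      (h𝒰 (hd.mono fun N h k => le_trans (by
        have : 0 < A := hB.trans hBA
        gcongr
        linarith) (h.2.2.1 k))) hbM hs' hb' hw
    have hA := (tendsto_gammaInvSeq A w).mono_left h𝒰
    have hB := (tendsto_gammaInvSeq B w).mono_left h𝒰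
    refine tendsto_nhds_unique hA (Tendsto.congr' ?_ ((hB.sub (hA.const_mul (κ : ℂ))).mul
      (((Complex.continuous_ofReal.tendsto _).comp (hT.mono_left h𝒰)).add h2)))
    filter_upwards [h1, h𝒰 hd] with N hN1 hN2
    exact (hN2.2.2.2.2.2 _ hN1).symm

/-! ### Growth along the imaginary axis -/

/-- As `a j ≤ b j`, the quotient `∏ a / ∏ b` only decreases when further factors are included;
cross-multiplied so that vanishing factors cause no trouble. -/
lemma prod_range_mul_prod_range_le {a b : ℕ → ℝ} (ha : ∀ j, 0 ≤ a j) (hab : ∀ j, a j ≤ b j)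
    {J n : ℕ} (hJ : J ≤ n) :
    (∏ j ∈ Finset.range n, a j) * ∏ j ∈ Finset.range J, b j ≤
      (∏ j ∈ Finset.range n, b j) * ∏ j ∈ Finset.range J, a j := by
  rw [← Finset.prod_range_mul_prod_Ico _ hJ, ← Finset.prod_range_mul_prod_Ico _ hJ]
  have h1 : ∏ j ∈ Finset.Ico J n, a j ≤ ∏ j ∈ Finset.Ico J n, b j :=
    Finset.prod_le_prod (fun j _ => ha j) fun j _ => hab j
  have h2 : 0 ≤ (∏ j ∈ Finset.range J, a j) * ∏ j ∈ Finset.range J, b j :=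
    mul_nonneg (Finset.prod_nonneg fun j _ => ha j)
      (Finset.prod_nonneg fun j _ => (ha j).trans (hab j))
  nlinarith [mul_le_mul_of_nonneg_left h1 h2]

/-- Normalised by its value at `y = 0`, the ratio `A`-product over `B`-product is bounded by its
first `J` factors, each at most `1`. The bound does not involve `N` and survives the limit. -/
lemma gammaInvSeq_comparison {A B : ℝ} (hB : 0 < B) (hBA : B < A) {N J : ℕ} (hJ : J ≤ N + 1)
    (y : ℝ) :
    gammaInvSeq A N (-y ^ 2) * gammaInvSeq B N (0 : ℝ) *
        ∏ j ∈ Finset.range J, (((B + j) ^ 2 + y ^ 2) * (A + j) ^ 2) ≤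
      gammaInvSeq B N (-y ^ 2) * gammaInvSeq A N (0 : ℝ) *
        ∏ j ∈ Finset.range J, (((A + j) ^ 2 + y ^ 2) * (B + j) ^ 2) := by
  have h := prod_range_mul_prod_range_le (n := N + 1) (J := J)
    (a := fun j : ℕ => ((A + j) ^ 2 + y ^ 2) * (B + j) ^ 2)
    (b := fun j : ℕ => ((B + j) ^ 2 + y ^ 2) * (A + j) ^ 2) (fun j => by positivity) (fun j => by
      have : (B + j) ^ 2 ≤ (A + j) ^ 2 := by gcongr
      nlinarith [mul_le_mul_of_nonneg_left this (sq_nonneg y)]) hJ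
  simp only [Finset.prod_mul_distrib] at h ⊢
  simp only [gammaInvSeq_real, sub_neg_eq_add, sub_zero]
  rw [div_mul_div_comm, div_mul_div_comm, div_mul_eq_mul_div, div_mul_eq_mul_div,
    mul_comm ((N : ℝ) ^ (2 * B) * _)]
  exact div_le_div_of_nonneg_right h (by positivity)

lemma gammaInv_imaginary_comparison {A B : ℝ} (hB : 0 < B) (hBA : B < A) (J : ℕ) (y : ℝ) :
    (gammaInv A (y * Complex.I)).re * (gammaInv B 0).re *
        ∏ j ∈ Finset.range J, (((B + j) ^ 2 + y ^ 2) * (A + j) ^ 2) ≤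
      (gammaInv B (y * Complex.I)).re * (gammaInv A 0).re *
        ∏ j ∈ Finset.range J, (((A + j) ^ 2 + y ^ 2) * (B + j) ^ 2) := by
  have hw : ((y : ℂ) * Complex.I) ^ 2 = ((-y ^ 2 : ℝ) : ℂ) := by
    rw [mul_pow, Complex.I_sq]; push_cast; ring
  obtain ⟨a, ha, hTa⟩ := exists_gammaInv_eq_ofReal A hw
  obtain ⟨b, hb, hTb⟩ := exists_gammaInv_eq_ofReal B hw
  obtain ⟨a0, ha0, hTa0⟩ := exists_gammaInv_eq_ofReal A (w := 0) (r := 0) (by simp)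
  obtain ⟨b0, hb0, hTb0⟩ := exists_gammaInv_eq_ofReal B (w := 0) (r := 0) (by simp)
  rw [ha, hb, ha0, hb0]
  simp only [Complex.ofReal_re]
  refine le_of_tendsto_of_tendsto ((hTa.mul hTb0).mul_const _) ((hTb.mul hTa0).mul_const _) ?_
  filter_upwards [eventually_ge_atTop J] with N hN
  exact gammaInvSeq_comparison hB hBA (by omega) y

/-- `Γ(A + iy) Γ(A - iy) / (Γ(B + iy) Γ(B - iy))` is unbounded in `y ∈ ℝ` if `A > B`. -/
lemma gammaInv_ratio_unbounded {A B : ℝ} (hB : 0 < B) (hBA : B < A) (D : ℝ) :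
    ∃ y : ℝ, D * (gammaInv A (y * Complex.I)).re < (gammaInv B (y * Complex.I)).re := by
  by_contra! hcon
  have hA : 0 < A := hB.trans hBA
  have hpos : ∀ {C : ℝ}, 0 < C → ∀ y : ℝ, 0 < (gammaInv C (y * Complex.I)).re := fun hC y =>
    gammaInv_pos hC (x := -y ^ 2) (by rw [mul_pow, Complex.I_sq]; push_cast; ring)
      (by nlinarith [sq_nonneg y, pow_pos hC 2])
  have hA0 : 0 < (gammaInv A 0).re := by simpa using hpos hA 0
  have hB0 : 0 < (gammaInv B 0).re := by simpa using hpos hB 0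
  -- If the ratio were bounded by `D`, the comparison would turn this into an inequality between
  -- finite products.
  have h1 : ∀ (J : ℕ) (y : ℝ), (gammaInv B 0).re *
      ∏ j ∈ Finset.range J, (((B + j) ^ 2 + y ^ 2) * (A + j) ^ 2) ≤ D * (gammaInv A 0).re *
        ∏ j ∈ Finset.range J, (((A + j) ^ 2 + y ^ 2) * (B + j) ^ 2) := fun J y => by
    have h := gammaInv_imaginary_comparison hB hBA J y
    have hP : 0 ≤ (gammaInv A 0).re *
        ∏ j ∈ Finset.range J, (((A + j) ^ 2 + y ^ 2) * (B + j) ^ 2) :=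
      mul_nonneg hA0.le (Finset.prod_nonneg fun j _ => by positivity)
    have h2 := mul_le_mul_of_nonneg_right (hcon y) hP
    refine le_of_mul_le_mul_left ?_ (hpos hA y)
    linarith
  -- Divide by `y^(2J)` with `x = 1/y²`; then `x → 0` removes the terms depending on `y`.
  have h2 : ∀ (J : ℕ) (x : ℝ), 0 < x → (gammaInv B 0).re *
      ∏ j ∈ Finset.range J, (((B + j) ^ 2 * x + 1) * (A + j) ^ 2) ≤ D * (gammaInv A 0).re *
        ∏ j ∈ Finset.range J, (((A + j) ^ 2 * x + 1) * (B + j) ^ 2) := fun J x hx => by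
    have h := h1 J (√(1 / x))
    rw [Real.sq_sqrt (by positivity)] at h
    have h3 : ∀ C C' : ℝ, ∏ j ∈ Finset.range J, (((C + j) ^ 2 * x + 1) * (C' + j) ^ 2) =
        x ^ J * ∏ j ∈ Finset.range J, (((C + j) ^ 2 + 1 / x) * (C' + j) ^ 2) := fun C C' => by
      conv_rhs => rw [← Finset.card_range J, ← Finset.prod_const, Finset.card_range]
      rw [← Finset.prod_mul_distrib]
      refine Finset.prod_congr rfl fun j _ => ?_
      field_simp
    rw [h3, h3]
    have := mul_le_mul_of_nonneg_left h (pow_pos hx J).le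
    linarith
  have h3 : ∀ J : ℕ, (gammaInv B 0).re * ∏ j ∈ Finset.range J, (A + j) ^ 2 ≤
      D * (gammaInv A 0).re * ∏ j ∈ Finset.range J, (B + j) ^ 2 := fun J => by
    have hc : ∀ C C' : ℝ, Tendsto (fun x : ℝ =>
        ∏ j ∈ Finset.range J, (((C + j) ^ 2 * x + 1) * (C' + j) ^ 2)) (𝓝[>] 0)
        (𝓝 (∏ j ∈ Finset.range J, (C' + j) ^ 2)) := fun C C' => by
      have hcont : Continuous fun x : ℝ =>
        ∏ j ∈ Finset.range J, (((C + j) ^ 2 * x + 1) * (C' + j) ^ 2) := by fun_prop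
      simpa using (hcont.tendsto 0).mono_left nhdsWithin_le_nhds
    refine le_of_tendsto_of_tendsto ((hc B A).const_mul _) ((hc A B).const_mul _) ?_
    filter_upwards [self_mem_nhdsWithin] with x hx
    exact h2 J x hx
  obtain ⟨a0, ha0, hTa0⟩ := exists_gammaInv_eq_ofReal A (w := 0) (r := 0) (by simp)
  obtain ⟨b0, hb0, hTb0⟩ := exists_gammaInv_eq_ofReal B (w := 0) (r := 0) (by simp)
  rw [ha0, Complex.ofReal_re] at hA0
  rw [hb0, Complex.ofReal_re] at hB0
  rw [ha0, hb0] at h3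
  simp only [Complex.ofReal_re] at h3
  have hc : Tendsto (fun N : ℕ => (N : ℝ) ^ (2 * (A - B))) atTop atTop :=
    (tendsto_rpow_atTop (by linarith)).comp tendsto_natCast_atTop_atTop
  -- With `J = N + 1` the finite products are the Euler products at `0`, and their normalisations
  -- differ by `N^(2(A-B)) → ∞`, which contradicts boundedness.
  have htop : Tendsto (fun N : ℕ => b0 * gammaInvSeq A N (0 : ℝ) * (N : ℝ) ^ (2 * (A - B)))
      atTop atTop := Tendsto.pos_mul_atTop (mul_pos hB0 hA0) (hTa0.const_mul _) hc
  refine not_tendsto_atTop_of_tendsto_nhds (hTb0.const_mul (D * a0)) ?_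
  refine tendsto_atTop_mono' _ ?_ htop
  filter_upwards [eventually_ge_atTop 1] with N hN
  have hN0 : (0 : ℝ) < N := by exact_mod_cast hN
  have h4 := h3 (N + 1)
  have hsplit : (N : ℝ) ^ (2 * A) = (N : ℝ) ^ (2 * (A - B)) * (N : ℝ) ^ (2 * B) := by
    rw [← Real.rpow_add hN0]; ring_nf
  simp only [gammaInvSeq_real, sub_zero]
  rw [hsplit, ← mul_div_assoc, ← mul_div_assoc, div_mul_eq_mul_div]
  have hx : 0 < (N : ℝ) ^ (2 * (A - B)) := by positivity
  have hy : 0 < (N : ℝ) ^ (2 * B) := by positivity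
  rw [div_le_div_iff₀ (by positivity) (by positivity)]
  have hz : 0 < (N : ℝ) ^ (2 * (A - B)) * ((N : ℝ) ^ (2 * B) * (N.factorial : ℝ) ^ 2) := by
    positivity
  nlinarith [mul_le_mul_of_nonneg_right h4 hz.le]

/-! ### The Stieltjes expansion -/

/-- For `w = iy` the bracket is `T - ∑ b k y²/(s k + y²) ≥ T - ∑ b k`. If the right side were
positive, `g_B/g_A - κ` would be bounded by its inverse for all `y`, against
`gammaInv_ratio_unbounded`. -/
lemma tsum_eq_of_expansion {A B κ : ℝ} (hB : 0 < B) (hBA : B < A) {s b : ℕ → ℝ} {T : ℝ}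
    (hs : ∀ k, 0 < s k) (hb : ∀ k, 0 ≤ b k) (hT : ∀ n, ∑ k ∈ Finset.range n, b k ≤ T)
    (hexp : ∀ w : ℂ, (∀ k, w ^ 2 ≠ s k) → gammaInv A w = (gammaInv B w - κ * gammaInv A w) *
      (T + ∑' k, (b k : ℂ) * (w ^ 2 / (s k - w ^ 2)))) :
    HasSum b T := by
  have hsum : Summable b := summable_of_sum_range_le hb hT
  have hle : ∑' k, b k ≤ T := hsum.tsum_le_of_sum_range_le hT
  rcases hle.eq_or_lt with h | h
  · exact h ▸ hsum.hasSum
  exfalso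
  obtain ⟨y, hy⟩ := gammaInv_ratio_unbounded hB hBA (κ + 1 / (T - ∑' k, b k))
  have hd : 0 < T - ∑' k, b k := sub_pos.2 h
  have hw : ((y : ℂ) * Complex.I) ^ 2 = ((-y ^ 2 : ℝ) : ℂ) := by
    rw [mul_pow, Complex.I_sq]; push_cast; ring
  have h1 := hexp (y * Complex.I) fun k => by
    rw [hw]
    have : -y ^ 2 ≠ s k := by nlinarith [hs k, sq_nonneg y]
    exact_mod_cast this
  obtain ⟨a, ha, -⟩ := exists_gammaInv_eq_ofReal A hw
  obtain ⟨b', hb', -⟩ := exists_gammaInv_eq_ofReal B hw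
  have hapos := gammaInv_pos (hB.trans hBA) hw (by nlinarith [sq_nonneg y, pow_pos (hB.trans hBA) 2])
  rw [ha, hb'] at hy h1
  rw [ha] at hapos
  simp only [Complex.ofReal_re] at hy hapos
  set f : ℕ → ℝ := fun k => b k * (y ^ 2 / (s k + y ^ 2)) with hf
  have hterm : ∀ k, (b k : ℂ) * (((y : ℂ) * Complex.I) ^ 2 / (s k - ((y : ℂ) * Complex.I) ^ 2)) =
      ((-f k : ℝ) : ℂ) := fun k => by
    rw [hw, hf]
    push_cast
    ring
  have hfb : ∀ k, f k ≤ b k := fun k => by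
    refine mul_le_of_le_one_right (hb k) (div_le_one_of_le₀ ?_ ?_) <;> nlinarith [hs k, sq_nonneg y]
  have hf0 : ∀ k, 0 ≤ f k := fun k => by have := hb k; have := hs k; positivity
  have hfs : ∑' k, f k ≤ ∑' k, b k :=
    (Summable.of_nonneg_of_le hf0 hfb hsum).tsum_le_tsum hfb hsum
  simp_rw [hterm] at h1
  rw [← Complex.ofReal_tsum, tsum_neg] at h1
  have h2 : a = (b' - κ * a) * (T - ∑' k, f k) := by
    rw [sub_eq_add_neg T]
    exact_mod_cast h1
  have h3 : T - ∑' k, b k ≤ T - ∑' k, f k := by linarith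
  have h4 : 0 < b' - κ * a := by
    by_contra hneg
    have : (b' - κ * a) * (T - ∑' k, f k) ≤ 0 :=
      mul_nonpos_of_nonpos_of_nonneg (not_lt.1 hneg) (hd.le.trans h3)
    linarith
  have h5 : (b' - κ * a) * (T - ∑' k, b k) ≤ a := by
    conv_rhs => rw [h2]
    gcongr
  have h6 : b' - κ * a ≤ a / (T - ∑' k, b k) := (le_div_iff₀ hd).2 h5
  rw [add_mul, one_div, inv_mul_eq_div] at hy
  linarith

lemma summable_mul_div_sub {s b : ℕ → ℝ} (hb : Summable b) (hs : Tendsto s atTop atTop) (u : ℂ) :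
    Summable fun k => (b k : ℂ) * (u / (s k - u)) := by
  have h1 : Tendsto (fun k => (s k : ℂ) - u) atTop (Bornology.cobounded ℂ) := by
    have : Tendsto (fun k => (s k : ℂ)) atTop (Bornology.cobounded ℂ) := by
      rw [← tendsto_norm_atTop_iff_cobounded]
      simp only [Complex.norm_real]
      exact tendsto_norm_atTop_atTop.comp hs
    exact (tendsto_sub_const_cobounded u).comp this
  have h2 : (fun k => u / ((s k : ℂ) - u)) =O[atTop] fun _ => (1 : ℝ) := by
    refine Tendsto.isBigO_one ℝ (c := 0) ?_
    simpa [div_eq_mul_inv] using ((tendsto_inv₀_cobounded).comp h1).const_mul u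
  refine summable_of_isBigO_nat hb.norm ?_
  have h3 : (fun k => (b k : ℂ)) =O[atTop] fun k => ‖b k‖ :=
    Asymptotics.isBigO_of_le _ fun k => by simp
  simpa using h3.mul h2

/-- Away from the `s k` the expansion turns a zero of the denominator into a common zero of
`gammaInv A` and `gammaInv B`. That would give `A + i = B + j`, impossible for `0 < A - B < 1`. -/
lemma sq_eq_of_zero {A B κ : ℝ} (hB : 0 < B) (hBA : B < A) (hAB : A < B + 1) {s b : ℕ → ℝ}
    (hexp : ∀ w : ℂ, (∀ k, w ^ 2 ≠ s k) → gammaInv A w = (gammaInv B w - κ * gammaInv A w) *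
        ∑' k, (b k : ℂ) * (s k / (s k - w ^ 2))) {w : ℂ}
    (hw : gammaInv B w - κ * gammaInv A w = 0) : ∃ k, w ^ 2 = s k := by
  by_contra! h
  have h1 := hexp w h
  rw [hw, zero_mul] at h1
  rw [h1, mul_zero, sub_zero] at hw
  obtain ⟨i, hi⟩ := gammaInv_eq_zero_iff.1 h1
  obtain ⟨j, hj⟩ := gammaInv_eq_zero_iff.1 hw
  have h2 : (A + i) ^ 2 = (B + j) ^ 2 := Complex.ofReal_injective (hi ▸ hj)
  have h3 : A + i = B + j := by
    have : 0 < A := hB.trans hBA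
    exact (pow_left_inj₀ (by positivity) (by positivity) two_ne_zero).1 h2
  have h4 : (i : ℝ) < j := by linarith
  have h5 : (j : ℝ) < i + 1 := by linarith
  norm_cast at h4 h5
  omega

/-- If `0 < B < A < B + 1`, the reciprocal of
`Γ(A + w) Γ(A - w) / (Γ(B + w) Γ(B - w)) - κ` is a Stieltjes function of `w²`. -/
theorem exists_stieltjes_expansion {A B κ ε : ℝ} (hB : 0 < B) (hBA : B < A) (hAB : A < B + 1)
    (hκ : 0 ≤ κ) (hε : 0 < ε) (hεB : ε ≤ B ^ 2)
    (hH0 : 0 < (gammaInv B 0 - κ * gammaInv A 0).re)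
    (hHε : 0 < (gammaInv B (√ε : ℝ) - κ * gammaInv A (√ε : ℝ)).re) :
    ∃ s b : ℕ → ℝ, ε ≤ s 0 ∧ (∀ k, s k ≤ (B + k) ^ 2) ∧
      (∀ k : ℕ, (A + k) ^ 2 ≤ s (k + 1)) ∧ (∀ k, 0 ≤ b k) ∧ Summable b ∧
      (∀ w : ℂ, (∀ k, w ^ 2 ≠ s k) → gammaInv A w = (gammaInv B w - κ * gammaInv A w) *
        ∑' k, (b k : ℂ) * (s k / (s k - w ^ 2))) ∧
      ∀ (w : ℂ) (k : ℕ), w ^ 2 = s k → gammaInv B w - κ * gammaInv A w = 0 := by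
  obtain ⟨s, b, T, hs0, hsβ, hαs, hb, hbT, hexp⟩ :=
    exists_limit_expansion hB hBA hAB hκ hε hεB hH0 hHε
  have hA : 0 < A := hB.trans hBA
  have hspos : ∀ k, 0 < s k := by
    rintro (_ | k)
    · exact hε.trans_le hs0
    · refine lt_of_lt_of_le ?_ (hαs k)
      positivity
  have hsum := tsum_eq_of_expansion hB hBA hspos hb hbT hexp
  have hs_tendsto : Tendsto s atTop atTop := by
    rw [← tendsto_add_atTop_iff_nat 1]
    refine tendsto_atTop_mono hαs ?_
    exact (tendsto_pow_atTop two_ne_zero).comp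
      (tendsto_atTop_add_const_left _ _ tendsto_natCast_atTop_atTop)
  have hexp' : ∀ w : ℂ, (∀ k, w ^ 2 ≠ s k) → gammaInv A w =
      (gammaInv B w - κ * gammaInv A w) * ∑' k, (b k : ℂ) * (s k / (s k - w ^ 2)) := by
    intro w hw
    refine (hexp w hw).trans ?_
    congr 1
    -- With `T = ∑ b k` the constant is absorbed termwise: `1 + u/(s-u) = s/(s-u)`.
    have hofReal := Complex.hasSum_ofReal.2 hsum
    rw [← hofReal.tsum_eq, ← hofReal.summable.tsum_add (summable_mul_div_sub hsum.summable hs_tendsto _)]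
    refine tsum_congr fun k => ?_
    have := sub_ne_zero.2 (hw k).symm
    field_simp
    ring
  refine ⟨s, b, hs0, hsβ, hαs, hb, hsum.summable, hexp', ?_⟩
  -- A limit coefficient `b k` might vanish, so the expansion alone does not show that `s k` is a
  -- zero. Instead a sign change on `[lo, B + k]`, with `lo = √ε` or `A + k - 1`, yields a zero `x`;
  -- its square is some `s j`, and interlacing forces `j = k`.
  have hbetween : ∀ k : ℕ, ∃ lo : ℝ, 0 < lo ∧ lo ≤ B + k ∧ (∀ m : ℕ, k = m + 1 → lo = A + m) ∧
      0 ≤ (-1) ^ k * (gammaInv B (lo : ℝ) - κ * gammaInv A (lo : ℝ)).re := by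
    rintro (_ | k)
    · refine ⟨√ε, Real.sqrt_pos.2 hε, ?_, by simp, by simpa using hHε.le⟩
      simpa using Real.sqrt_le_left hB.le |>.2 hεB
    · refine ⟨A + k, by positivity, by push_cast; linarith, fun m hm => ?_, ?_⟩
      · obtain rfl : k = m := by omega
        rfl
      · have h0 : gammaInv A ((A + k : ℝ) : ℂ) = 0 :=
          gammaInv_eq_zero_iff.2 ⟨k, by push_cast; rfl⟩
        rw [h0, mul_zero, sub_zero]
        refine gammaInv_sign (x := (A + k) ^ 2) (by push_cast; rfl) (fun j hj => ?_) fun j hj => ?_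
        · have : (j : ℝ) ≤ k := by exact_mod_cast Nat.lt_succ_iff.1 hj
          gcongr
        · have : ((k + 1 : ℕ) : ℝ) ≤ j := by exact_mod_cast hj
          push_cast at this
          gcongr ?_ ^ 2
          linarith
  intro w k hwk
  obtain ⟨lo, hlo0, hlo, hloA, hsign⟩ := hbetween k
  have hcont : Continuous fun x : ℝ => (gammaInv B (x : ℂ) - κ * gammaInv A (x : ℂ)).re :=
    Complex.continuous_re.comp (((differentiable_gammaInv B).continuous.comp
      Complex.continuous_ofReal).sub (continuous_const.mul
        ((differentiable_gammaInv A).continuous.comp Complex.continuous_ofReal)))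
  have hhi : (-1) ^ k * (gammaInv B ((B + k : ℝ) : ℂ) - κ * gammaInv A ((B + k : ℝ) : ℂ)).re ≤ 0 := by
    have h0 : gammaInv B ((B + k : ℝ) : ℂ) = 0 := gammaInv_eq_zero_iff.2 ⟨k, by push_cast; rfl⟩
    have h1 : 0 ≤ (-1) ^ k * (gammaInv A ((B + k : ℝ) : ℂ)).re := by
      refine gammaInv_sign (x := (B + k) ^ 2) (by push_cast; rfl) (fun j hj => ?_) fun j hj => ?_
      · have : ((j + 1 : ℕ) : ℝ) ≤ k := by exact_mod_cast hj
        push_cast at this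
        gcongr ?_ ^ 2
        linarith
      · have : (k : ℝ) ≤ j := by exact_mod_cast hj
        gcongr
    rw [h0, zero_sub, Complex.neg_re, Complex.re_ofReal_mul]
    nlinarith
  obtain ⟨x, hx, hroot⟩ := exists_root_of_sign hlo hcont.continuousOn k hsign hhi
  have hx2 : ((x : ℂ)) ^ 2 = ((x ^ 2 : ℝ) : ℂ) := by push_cast; rfl
  have hzero : gammaInv B (x : ℂ) - κ * gammaInv A (x : ℂ) = 0 := by
    obtain ⟨a, ha, -⟩ := exists_gammaInv_eq_ofReal A hx2
    obtain ⟨b', hb', -⟩ := exists_gammaInv_eq_ofReal B hx2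
    rw [ha, hb'] at hroot ⊢
    have : b' - κ * a = 0 := by simpa using hroot
    exact_mod_cast this
  obtain ⟨j, hj⟩ := sq_eq_of_zero hB hBA hAB hexp' hzero
  have hj' : x ^ 2 = s j := by rw [hx2] at hj; exact_mod_cast hj
  have hx0 : 0 < x := hlo0.trans_le hx.1
  have hjk : j = k := by
    rcases lt_trichotomy j k with h | h | h
    · exfalso
      obtain ⟨m, rfl⟩ : ∃ m, k = m + 1 := ⟨k - 1, by omega⟩
      have h1 : A + m ≤ x := hloA m rfl ▸ hx.1
      have h2 : x ≤ B + j := by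
        have : x ^ 2 ≤ (B + j) ^ 2 := hj' ▸ hsβ j
        exact (pow_le_pow_iff_left₀ hx0.le (by positivity) two_ne_zero).1 this
      have h3 : (j : ℝ) ≤ m := by exact_mod_cast Nat.lt_succ_iff.1 h
      linarith
    · exact h
    · exfalso
      obtain ⟨m, rfl⟩ : ∃ m, j = m + 1 := ⟨j - 1, by omega⟩
      have h2 : A + m ≤ x := by
        have : (A + m) ^ 2 ≤ x ^ 2 := hj' ▸ hαs m
        exact (pow_le_pow_iff_left₀ (by positivity) hx0.le two_ne_zero).1 this
      have h3 : (k : ℝ) ≤ m := by exact_mod_cast Nat.lt_succ_iff.1 h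
      linarith [hx.2]
  have h1 : w ^ 2 = (x : ℂ) ^ 2 := by rw [hwk, hj, hjk]
  rcases sq_eq_sq_iff_eq_or_eq_neg.1 h1 with rfl | rfl
  · exact hzero
  · rw [gammaInv_neg, gammaInv_neg]
    exact hzero

/-! ### The kernels `e^{-σ|t|}` -/

lemma integrable_integral_cexp_mul_exp_neg_abs {σ : ℝ} (hσ : 0 < σ) (ξ : ℝ) :
    Integrable (fun t : ℝ => Complex.exp (Complex.I * ξ * t) * (Real.exp (-σ * |t|) : ℂ)) ∧
    ∫ t : ℝ, Complex.exp (Complex.I * ξ * t) * (Real.exp (-σ * |t|) : ℂ) =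
      ((2 * σ / (σ ^ 2 + ξ ^ 2) : ℝ) : ℂ) := by
  have h1 : Set.EqOn (fun t : ℝ => Complex.exp ((σ + Complex.I * ξ) * t))
      (fun t : ℝ => Complex.exp (Complex.I * ξ * t) * (Real.exp (-σ * |t|) : ℂ)) (Set.Iic 0) := by
    intro t ht
    simp only
    rw [abs_of_nonpos ht, Complex.ofReal_exp, ← Complex.exp_add]
    push_cast
    ring_nf
  have h2 : Set.EqOn (fun t : ℝ => Complex.exp ((-σ + Complex.I * ξ) * t))
      (fun t : ℝ => Complex.exp (Complex.I * ξ * t) * (Real.exp (-σ * |t|) : ℂ)) (Set.Ioi 0) := by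
    intro t ht
    simp only
    rw [abs_of_pos ht, Complex.ofReal_exp, ← Complex.exp_add]
    push_cast
    ring_nf
  have hre1 : 0 < ((σ : ℂ) + Complex.I * ξ).re := by simpa using hσ
  have hre2 : (-(σ : ℂ) + Complex.I * ξ).re < 0 := by simpa using hσ
  have i1 := (integrableOn_exp_mul_complex_Iic hre1 0).congr_fun h1 measurableSet_Iic
  have i2 := (integrableOn_exp_mul_complex_Ioi hre2 0).congr_fun h2 measurableSet_Ioi
  refine ⟨?_, ?_⟩
  · rw [← integrableOn_univ, ← Set.Iic_union_Ioi (a := (0 : ℝ))]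
    exact i1.union i2
  · rw [← intervalIntegral.integral_Iic_add_Ioi i1 i2, ← setIntegral_congr_fun measurableSet_Iic h1,
      ← setIntegral_congr_fun measurableSet_Ioi h2, integral_exp_mul_complex_Iic hre1,
      integral_exp_mul_complex_Ioi hre2]
    have n1 : (σ : ℂ) + Complex.I * ξ ≠ 0 := fun h => by rw [h] at hre1; simp at hre1
    have n2 : -(σ : ℂ) + Complex.I * ξ ≠ 0 := fun h => by rw [h] at hre2; simp at hre2
    have n3 : (σ : ℂ) ^ 2 + (ξ : ℂ) ^ 2 ≠ 0 := by
      have : σ ^ 2 + ξ ^ 2 ≠ 0 := by positivity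
      exact_mod_cast this
    simp only [Complex.ofReal_zero, mul_zero, Complex.exp_zero]
    push_cast
    field_simp
    linear_combination (-2 * (σ : ℂ) * ξ ^ 2) * Complex.I_sq

lemma integrable_exp_neg_abs {σ : ℝ} (hσ : 0 < σ) :
    Integrable (fun t : ℝ => Real.exp (-σ * |t|)) := by
  have := (integrable_integral_cexp_mul_exp_neg_abs hσ 0).1.re
  refine this.congr (Eventually.of_forall fun t => ?_)
  simp only [Complex.ofReal_zero, mul_zero, zero_mul, Complex.exp_zero, one_mul]
  exact Complex.ofReal_re _

lemma integral_exp_neg_abs {σ : ℝ} (hσ : 0 < σ) : ∫ t : ℝ, Real.exp (-σ * |t|) = 2 / σ := by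
  have := (integrable_integral_cexp_mul_exp_neg_abs hσ 0).2
  simp only [Complex.ofReal_zero, mul_zero, zero_mul, Complex.exp_zero, one_mul,
    integral_complex_ofReal] at this
  rw [Complex.ofReal_injective this]
  field_simp
  ring

lemma fourier_exp_neg_abs {σ : ℝ} (hσ : 0 < σ) (x : ℝ) :
    𝓕 (fun t : ℝ => (Real.exp (-σ * |t|) : ℂ)) x =
      ((2 * σ / (σ ^ 2 + (2 * Real.pi * x) ^ 2) : ℝ) : ℂ) := by
  rw [Real.fourier_real_eq_integral_exp_smul, ← neg_sq (2 * Real.pi * x),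
    ← (integrable_integral_cexp_mul_exp_neg_abs hσ (-(2 * Real.pi * x))).2]
  refine integral_congr_ae (Eventually.of_forall fun t => ?_)
  simp only [smul_eq_mul]
  push_cast
  ring_nf

lemma integrable_inv_sq_add_sq {σ : ℝ} (hσ : 0 < σ) :
    Integrable fun x : ℝ => 1 / (σ ^ 2 + x ^ 2) := by
  have h := (integrable_inv_one_add_sq.comp_div hσ.ne').const_mul (1 / σ ^ 2)
  refine h.congr (Eventually.of_forall fun x => ?_)
  simp only
  field_simp

/-- The cosine transform of `1 / (σ² + ξ²)`. -/
lemma integral_cexp_div_sq_add_sq {σ : ℝ} (hσ : 0 < σ) (t : ℝ) :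
    ∫ ξ : ℝ, Complex.exp (Complex.I * ξ * t) * ((1 / (σ ^ 2 + ξ ^ 2) : ℝ) : ℂ) =
      ((Real.pi / σ * Real.exp (-σ * |t|) : ℝ) : ℂ) := by
  have hint := (integrable_integral_cexp_mul_exp_neg_abs hσ 0).1
  simp only [Complex.ofReal_zero, mul_zero, zero_mul, Complex.exp_zero, one_mul] at hint
  have hF : Integrable (𝓕 (fun t : ℝ => (Real.exp (-σ * |t|) : ℂ))) := by
    have h1 := (((integrable_inv_sq_add_sq hσ).comp_mul_left'
      (mul_ne_zero two_ne_zero Real.pi_ne_zero)).const_mul (2 * σ)).ofReal (𝕜 := ℂ)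
    refine h1.congr (Eventually.of_forall fun x => ?_)
    simp only [fourier_exp_neg_abs hσ]
    push_cast
    simp only [mul_one_div]
    rfl
  have hcont : Continuous fun t : ℝ => (Real.exp (-σ * |t|) : ℂ) := by fun_prop
  -- Fourier inversion applied to the transform of `e^{-σ|t|}`, followed by the rescaling `ξ = 2πv`.
  have hinv := congrFun (hcont.fourierInv_fourier_eq hint hF) t
  rw [Real.fourierInv_eq'] at hinv
  simp only [fourier_exp_neg_abs hσ] at hinv
  have hsub := Measure.integral_comp_mul_left
    (fun ξ : ℝ => Complex.exp (Complex.I * ξ * t) * ((1 / (σ ^ 2 + ξ ^ 2) : ℝ) : ℂ))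
    (2 * Real.pi)
  have h3 : ∀ v : ℝ, Complex.exp (↑(2 * Real.pi * inner ℝ v t) * Complex.I) •
      ((2 * σ / (σ ^ 2 + (2 * Real.pi * v) ^ 2) : ℝ) : ℂ) = (2 * σ : ℂ) *
      (Complex.exp (Complex.I * ((2 * Real.pi * v : ℝ) : ℂ) * t) *
        ((1 / (σ ^ 2 + (2 * Real.pi * v) ^ 2) : ℝ) : ℂ)) := fun v => by
    simp only [RCLike.inner_apply, conj_trivial, smul_eq_mul]
    push_cast
    ring_nf
  simp only [h3] at hinv
  rw [integral_const_mul, hsub, abs_of_pos (by positivity), Complex.real_smul] at hinv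
  have hpi : (Real.pi : ℂ) ≠ 0 := by exact_mod_cast Real.pi_ne_zero
  have hσ' : (σ : ℂ) ≠ 0 := by exact_mod_cast hσ.ne'
  rw [Complex.ofReal_mul, ← hinv]
  generalize (∫ ξ : ℝ, Complex.exp (Complex.I * ξ * t) * ((1 / (σ ^ 2 + ξ ^ 2) : ℝ) : ℂ)) = J
  push_cast
  field_simp

lemma ae_ne_zero : ∀ᵐ t : ℝ, t ≠ 0 := by
  simp [ae_iff, measure_singleton]

/-! ### Superpositions of exponentials -/

/-- `G(t) = ∑ (m_k σ_k / 2) e^{-σ_k |t|}` away from the origin. -/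
structure IsExpKernel (σ m : ℕ → ℝ) (G : ℝ → ℝ) : Prop where
  strictMono : StrictMono σ
  pos : 0 < σ 0
  nonneg : ∀ k, 0 ≤ m k
  summable : Summable m
  hasSum : ∀ t, t ≠ 0 → HasSum (fun k => m k * σ k / 2 * Real.exp (-σ k * |t|)) (G t)

namespace IsExpKernel

variable {σ m : ℕ → ℝ} {G : ℝ → ℝ} (hG : IsExpKernel σ m G)
include hG

lemma sigma_pos (k : ℕ) : 0 < σ k := hG.pos.trans_le (hG.strictMono.monotone k.zero_le)

lemma sigma_ge (k : ℕ) : σ 0 ≤ σ k := hG.strictMono.monotone k.zero_le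

lemma term_nonneg (k : ℕ) (t : ℝ) : 0 ≤ m k * σ k / 2 * Real.exp (-σ k * |t|) := by
  have := hG.nonneg k
  have := hG.sigma_pos k
  positivity

lemma kernel_nonneg {t : ℝ} (ht : t ≠ 0) : 0 ≤ G t :=
  (hG.hasSum t ht).nonneg fun k => hG.term_nonneg k t

lemma kernel_neg {t : ℝ} (ht : t ≠ 0) : G (-t) = G t := by
  have := hG.hasSum (-t) (neg_ne_zero.2 ht)
  rw [abs_neg] at this
  exact this.unique (hG.hasSum t ht)

/-- Split `|t|` into `r` and `|t| - r`: the first part absorbs the factor `σ k` through `x e^{-x} ≤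
1`, and the second decays at least at the rate `σ 0`. -/
lemma kernel_le {r t : ℝ} (hr : 0 < r) (hrt : r ≤ |t|) :
    G t ≤ (∑' k, m k) * (Real.exp (σ 0 * r) / (2 * r)) * Real.exp (-σ 0 * |t|) := by
  have ht : t ≠ 0 := abs_pos.1 (hr.trans_le hrt)
  have hs := (hG.summable.hasSum.mul_right (Real.exp (σ 0 * r) / (2 * r))).mul_right
    (Real.exp (-σ 0 * |t|))
  refine hasSum_le (fun k => ?_) (hG.hasSum t ht) hs
  have h1 : σ k * r ≤ Real.exp (σ k * r) := by linarith [Real.add_one_le_exp (σ k * r)]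
  have h2 : Real.exp (-σ k * |t|) ≤
      Real.exp (-(σ k * r)) * Real.exp (σ 0 * r) * Real.exp (-σ 0 * |t|) := by
    rw [← Real.exp_add, ← Real.exp_add]
    refine Real.exp_le_exp.2 ?_
    nlinarith [mul_le_mul_of_nonneg_left hrt (sub_nonneg.2 (hG.sigma_ge k))]
  have h3 : σ k * Real.exp (-(σ k * r)) ≤ 1 / r := by
    rw [Real.exp_neg, le_div_iff₀ hr, mul_right_comm, ← div_eq_mul_inv]
    exact div_le_one_of_le₀ h1 (Real.exp_pos _).le
  have hm := hG.nonneg k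
  have hσ := hG.sigma_pos k
  calc m k * σ k / 2 * Real.exp (-σ k * |t|)
      ≤ m k * σ k / 2 * (Real.exp (-(σ k * r)) * Real.exp (σ 0 * r) * Real.exp (-σ 0 * |t|)) := by
        gcongr
    _ = m k / 2 * (σ k * Real.exp (-(σ k * r))) * Real.exp (σ 0 * r) * Real.exp (-σ 0 * |t|) := by
        ring
    _ ≤ m k / 2 * (1 / r) * Real.exp (σ 0 * r) * Real.exp (-σ 0 * |t|) := by gcongr
    _ = _ := by field_simp

/-- The series says nothing at `t = 0`, so that point is treated apart. -/
lemma measurable : Measurable G := by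
  have h1 : Measurable fun t => if t = 0 then 0 else G t := by
    refine measurable_of_tendsto_metrizable (f := fun n t => if t = 0 then 0 else
      ∑ k ∈ Finset.range n, m k * σ k / 2 * Real.exp (-σ k * |t|)) (fun n => ?_) ?_
    · exact Measurable.ite (measurableSet_singleton 0) measurable_const (by fun_prop)
    · refine tendsto_pi_nhds.2 fun t => ?_
      by_cases ht : t = 0
      · simp [ht]
      · simpa [ht] using (hG.hasSum t ht).tendsto_sum_nat
  have h2 : G = fun t => if t = 0 then G 0 else (if t = 0 then 0 else G t) := by
    ext t
    by_cases ht : t = 0 <;> simp [ht]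
  rw [h2]
  exact Measurable.ite (measurableSet_singleton 0) measurable_const h1

lemma integrable_term (k : ℕ) : Integrable fun t => m k * σ k / 2 * Real.exp (-σ k * |t|) :=
  (integrable_exp_neg_abs (hG.sigma_pos k)).const_mul _

/-- This explains the normalisation `m k σ k / 2`: `m k` is the mass of the `k`-th exponential, so
summability of `m` is integrability of `G`. -/
lemma integral_term (k : ℕ) : ∫ t, m k * σ k / 2 * Real.exp (-σ k * |t|) = m k := by
  rw [integral_const_mul, integral_exp_neg_abs (hG.sigma_pos k)]
  have := (hG.sigma_pos k).ne'
  field_simp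

lemma integrable : Integrable G := by
  refine ⟨hG.measurable.aestronglyMeasurable, ?_⟩
  have h1 : ∫⁻ t, ‖G t‖ₑ = ∫⁻ t, ∑' k, ENNReal.ofReal (m k * σ k / 2 * Real.exp (-σ k * |t|)) := by
    refine lintegral_congr_ae (ae_ne_zero.mono fun t ht => ?_)
    simp only
    rw [Real.enorm_of_nonneg (hG.kernel_nonneg ht), ← (hG.hasSum t ht).tsum_eq,
      ENNReal.ofReal_tsum_of_nonneg (fun k => hG.term_nonneg k t) (hG.hasSum t ht).summable]
  have h2 : ∀ k, ∫⁻ t, ENNReal.ofReal (m k * σ k / 2 * Real.exp (-σ k * |t|)) =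
      ENNReal.ofReal (m k) := fun k => by
    rw [← ofReal_integral_eq_lintegral_ofReal (hG.integrable_term k)
      (Eventually.of_forall fun t => hG.term_nonneg k t), hG.integral_term]
  rw [HasFiniteIntegral, h1, lintegral_tsum fun k => by fun_prop]
  simp_rw [h2]
  rw [← ENNReal.ofReal_tsum_of_nonneg hG.nonneg hG.summable]
  exact ENNReal.ofReal_lt_top

/-- For `|t| ≤ 1` the weight is bounded and `G` integrable; for `|t| ≥ 1` the bound `kernel_le` with
`r = 1` leaves the rate `σ 0 - η > 0`. -/
lemma integrable_exp_mul {η : ℝ} (hη0 : 0 ≤ η) (hη : η < σ 0) :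
    Integrable fun t => Real.exp (η * |t|) * G t := by
  have hC : 0 ≤ (∑' k, m k) * (Real.exp (σ 0 * 1) / (2 * 1)) :=
    mul_nonneg (tsum_nonneg hG.nonneg) (by positivity)
  refine Integrable.mono' ((hG.integrable.const_mul (Real.exp η)).add
    ((integrable_exp_neg_abs (sub_pos.2 hη)).const_mul
      ((∑' k, m k) * (Real.exp (σ 0 * 1) / (2 * 1))))) ?_ (ae_ne_zero.mono fun t ht => ?_)
  · exact (Measurable.mul (by fun_prop) hG.measurable).aestronglyMeasurable
  · have h0 := hG.kernel_nonneg ht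
    rw [Real.norm_of_nonneg (by positivity)]
    simp only [Pi.add_apply]
    rcases le_total |t| 1 with h | h
    · refine le_add_of_le_of_nonneg ?_ (mul_nonneg hC (Real.exp_pos _).le)
      gcongr
      nlinarith
    · refine le_add_of_nonneg_of_le (by positivity) ?_
      refine (mul_le_mul_of_nonneg_left (hG.kernel_le one_pos h) (Real.exp_pos _).le).trans_eq ?_
      rw [mul_left_comm, ← Real.exp_add]
      ring_nf

/-- Termwise integration; the dominating sum is `G` itself, since all terms are nonnegative and the
phase has modulus one. -/
lemma hasSum_fourier (x : ℝ) :
    HasSum (fun k => ((m k * (σ k ^ 2 / (σ k ^ 2 + (2 * Real.pi * x) ^ 2)) : ℝ) : ℂ))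
      (𝓕 (fun t => (G t : ℂ)) x) := by
  have h := hasSum_integral_of_dominated_convergence (μ := (volume : Measure ℝ))
    (F := fun k (t : ℝ) => Complex.exp (↑(-2 * Real.pi * t * x) * Complex.I) •
      ((m k * σ k / 2 * Real.exp (-σ k * |t|) : ℝ) : ℂ))
    (f := fun t => Complex.exp (↑(-2 * Real.pi * t * x) * Complex.I) • (G t : ℂ))
    (fun k t => m k * σ k / 2 * Real.exp (-σ k * |t|))
    (fun k => (by fun_prop : Continuous _).aestronglyMeasurable)
    (fun k => Eventually.of_forall fun t => by
      rw [norm_smul, Complex.norm_exp_ofReal_mul_I, one_mul, Complex.norm_real,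
        Real.norm_of_nonneg (hG.term_nonneg k t)])
    (ae_ne_zero.mono fun t ht => (hG.hasSum t ht).summable)
    (hG.integrable.congr (ae_ne_zero.mono fun t ht => (hG.hasSum t ht).tsum_eq.symm))
    (ae_ne_zero.mono fun t ht => (Complex.hasSum_ofReal.2 (hG.hasSum t ht)).const_smul _)
  have hk : ∀ k, ∫ t : ℝ, Complex.exp (↑(-2 * Real.pi * t * x) * Complex.I) •
      ((m k * σ k / 2 * Real.exp (-σ k * |t|) : ℝ) : ℂ) =
      ((m k * (σ k ^ 2 / (σ k ^ 2 + (2 * Real.pi * x) ^ 2)) : ℝ) : ℂ) := fun k => by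
    have h1 := fourier_exp_neg_abs (hG.sigma_pos k) x
    rw [Real.fourier_real_eq_integral_exp_smul] at h1
    have h2 : ∀ t : ℝ, Complex.exp (↑(-2 * Real.pi * t * x) * Complex.I) •
      ((m k * σ k / 2 * Real.exp (-σ k * |t|) : ℝ) : ℂ) = ((m k * σ k / 2 : ℝ) : ℂ) *
        (Complex.exp (↑(-2 * Real.pi * t * x) * Complex.I) • (Real.exp (-σ k * |t|) : ℂ)) :=
      fun t => by
        simp only [smul_eq_mul]
        push_cast
        ring
    simp_rw [h2]
    rw [integral_const_mul, h1, ← Complex.ofReal_mul]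
    congr 1
    ring
  simp_rw [hk] at h
  rwa [← Real.fourier_real_eq_integral_exp_smul (fun t => (G t : ℂ)) x] at h

end IsExpKernel

/-! ### The Green's function -/

lemma integrable_cexp_mul_inv_sq_add_sq {σ : ℝ} (hσ : 0 < σ) (t : ℝ) :
    Integrable fun ξ : ℝ => Complex.exp (Complex.I * ξ * t) * ((1 / (σ ^ 2 + ξ ^ 2) : ℝ) : ℂ) := by
  refine (integrable_inv_sq_add_sq hσ).mono' ?_ (Eventually.of_forall fun ξ => ?_)
  · have : ∀ ξ : ℝ, σ ^ 2 + ξ ^ 2 ≠ 0 := fun ξ => by positivity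
    exact Continuous.aestronglyMeasurable (by fun_prop (disch := exact this _))
  · rw [norm_mul, Complex.norm_real, Real.norm_of_nonneg (by positivity),
      show Complex.I * ξ * t = ((ξ * t : ℝ) : ℂ) * Complex.I by push_cast; ring,
      Complex.norm_exp_ofReal_mul_I, one_mul]

lemma integral_inv_sq_add_sq {σ : ℝ} (hσ : 0 < σ) :
    ∫ ξ : ℝ, 1 / (σ ^ 2 + ξ ^ 2) = Real.pi / σ := by
  have h := integral_cexp_div_sq_add_sq hσ 0
  simp only [Complex.ofReal_zero, mul_zero, Complex.exp_zero, one_mul, abs_zero, Real.exp_zero,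
    mul_one, integral_complex_ofReal] at h
  exact Complex.ofReal_injective h

/-- One integration by parts: the two boundary terms give `2/(σ²|t|)` and the derivative term
`π/(σ²|t|)`. The bound is uniform in `R`, and its `σ⁻²` cancels the factor `σ²` in the
superposition. -/
lemma norm_integral_cexp_div_sq_add_sq_le {σ t R : ℝ} (hσ : 0 < σ) (ht : t ≠ 0) (hR : 0 ≤ R) :
    ‖∫ ξ in (-R)..R, Complex.exp (Complex.I * ξ * t) * ((1 / (σ ^ 2 + ξ ^ 2) : ℝ) : ℂ)‖ ≤
      (2 + Real.pi) / (σ ^ 2 * |t|) := by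
  have hden : ∀ ξ : ℝ, σ ^ 2 + ξ ^ 2 ≠ 0 := fun ξ => by positivity
  have hIt : Complex.I * t ≠ 0 := mul_ne_zero Complex.I_ne_zero (by exact_mod_cast ht)
  have hv : ∀ ξ : ℝ, HasDerivAt (fun ξ : ℝ => Complex.exp (Complex.I * ξ * t) / (Complex.I * t))
      (Complex.exp (Complex.I * ξ * t)) ξ := fun ξ => by
    have h1 : HasDerivAt (fun ξ : ℝ => Complex.I * (ξ : ℂ) * t) (Complex.I * t) ξ := by
      simpa using ((Complex.ofRealCLM.hasDerivAt (x := ξ)).const_mul Complex.I).mul_const (t : ℂ)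
    have h2 := h1.cexp.div_const (Complex.I * t)
    rwa [mul_div_cancel_right₀ _ hIt] at h2
  have hu : ∀ ξ : ℝ, HasDerivAt (fun ξ : ℝ => ((1 / (σ ^ 2 + ξ ^ 2) : ℝ) : ℂ))
      ((-(2 * ξ) / (σ ^ 2 + ξ ^ 2) ^ 2 : ℝ) : ℂ) ξ := fun ξ => by
    have h1 : HasDerivAt (fun ξ : ℝ => σ ^ 2 + ξ ^ 2) (2 * ξ) ξ := by
      simpa using (hasDerivAt_pow 2 ξ).const_add (σ ^ 2)
    have h2 := h1.inv (hden ξ)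
    simp only [one_div]
    exact h2.ofReal_comp
  have hnv : ∀ ξ : ℝ, ‖Complex.exp (Complex.I * ξ * t) / (Complex.I * t)‖ = 1 / |t| := fun ξ => by
    rw [norm_div, show Complex.I * ξ * t = ((ξ * t : ℝ) : ℂ) * Complex.I by push_cast; ring,
      Complex.norm_exp_ofReal_mul_I, norm_mul, Complex.norm_I, one_mul, Complex.norm_real,
      Real.norm_eq_abs]
  have hu'c : Continuous fun ξ : ℝ => ((-(2 * ξ) / (σ ^ 2 + ξ ^ 2) ^ 2 : ℝ) : ℂ) := by
    fun_prop (disch := exact fun ξ => pow_ne_zero _ (hden ξ))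
  have hparts := intervalIntegral.integral_mul_deriv_eq_deriv_mul (a := -R) (b := R)
    (fun ξ _ => hu ξ) (fun ξ _ => hv ξ) (hu'c.intervalIntegrable _ _)
    ((by fun_prop : Continuous fun ξ : ℝ => Complex.exp (Complex.I * ξ * t)).intervalIntegrable _ _)
  simp_rw [mul_comm (Complex.exp _)]
  rw [hparts]
  have hb : ∀ ξ : ℝ, ‖((1 / (σ ^ 2 + ξ ^ 2) : ℝ) : ℂ) *
      (Complex.exp (Complex.I * ξ * t) / (Complex.I * t))‖ ≤ 1 / (σ ^ 2 * |t|) := fun ξ => by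
    rw [norm_mul, hnv, Complex.norm_real, Real.norm_of_nonneg (by positivity), div_mul_div_comm,
      one_mul]
    have : 0 < |t| := abs_pos.2 ht
    gcongr
    nlinarith [sq_nonneg ξ]
  have hi : ‖∫ ξ in (-R)..R, ((-(2 * ξ) / (σ ^ 2 + ξ ^ 2) ^ 2 : ℝ) : ℂ) *
      (Complex.exp (Complex.I * ξ * t) / (Complex.I * t))‖ ≤ Real.pi / (σ ^ 2 * |t|) := by
    have hpt : ∀ ξ : ℝ, ‖((-(2 * ξ) / (σ ^ 2 + ξ ^ 2) ^ 2 : ℝ) : ℂ) *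
      (Complex.exp (Complex.I * ξ * t) / (Complex.I * t))‖ ≤
        1 / (σ * |t|) * (1 / (σ ^ 2 + ξ ^ 2)) := fun ξ => by
      rw [norm_mul, hnv, Complex.norm_real, norm_div, norm_neg, norm_pow, norm_mul,
        Real.norm_of_nonneg (by positivity : 0 ≤ σ ^ 2 + ξ ^ 2), Real.norm_eq_abs ξ,
        Real.norm_of_nonneg zero_le_two]
      have h1 : 2 * |ξ| * σ ≤ σ ^ 2 + ξ ^ 2 := by nlinarith [sq_nonneg (|ξ| - σ), sq_abs ξ]
      have h0 : 0 < |t| := abs_pos.2 ht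
      have h2 : 0 < σ ^ 2 + ξ ^ 2 := by positivity
      rw [div_mul_div_comm, div_mul_div_comm, div_le_div_iff₀ (by positivity) (by positivity)]
      nlinarith [mul_le_mul_of_nonneg_right h1 (mul_pos h2 h0).le]
    have hint := (integrable_inv_sq_add_sq hσ).const_mul (1 / (σ * |t|))
    refine (intervalIntegral.norm_integral_le_of_norm_le (by linarith)
      (Eventually.of_forall fun ξ _ => hpt ξ) hint.intervalIntegrable).trans ?_
    rw [intervalIntegral.integral_of_le (by linarith)]
    refine (setIntegral_le_integral hint (Eventually.of_forall fun ξ => ?_)).trans_eq ?_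
    · exact (norm_nonneg _).trans (hpt ξ)
    · rw [integral_const_mul, integral_inv_sq_add_sq hσ]
      have := (abs_pos.2 ht).ne'
      field_simp
  refine (norm_sub_le _ _).trans ((add_le_add ((norm_sub_le _ _).trans
    (add_le_add (hb R) (hb (-R)))) hi).trans_eq ?_)
  ring

lemma summable_exp_kernel {σ m : ℕ → ℝ} (hσ : StrictMono σ) (h0 : 0 < σ 0) (hm : ∀ k, 0 ≤ m k)
    (hs : Summable m) {t : ℝ} (ht : t ≠ 0) :
    Summable fun k => m k * σ k / 2 * Real.exp (-σ k * |t|) := by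
  have hσp : ∀ k, 0 < σ k := fun k => h0.trans_le (hσ.monotone k.zero_le)
  refine Summable.of_nonneg_of_le (fun k => ?_) (fun k => ?_) (hs.mul_right (1 / (2 * |t|)))
  · have := hm k; have := hσp k; positivity
  · have h1 : σ k * |t| ≤ Real.exp (σ k * |t|) := by linarith [Real.add_one_le_exp (σ k * |t|)]
    have ht' := abs_pos.2 ht
    have h2 : σ k * Real.exp (-σ k * |t|) ≤ 1 / |t| := by
      rw [neg_mul, Real.exp_neg, le_div_iff₀ ht', mul_right_comm, ← div_eq_mul_inv]
      exact div_le_one_of_le₀ h1 (Real.exp_pos _).le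
    calc m k * σ k / 2 * Real.exp (-σ k * |t|) = m k / 2 * (σ k * Real.exp (-σ k * |t|)) := by ring
      _ ≤ m k / 2 * (1 / |t|) := by have := hm k; gcongr
      _ = _ := by field_simp

/-- The truncated Fourier integrals of `∑ m_k σ_k² / (σ_k² + ξ²)` converge away from the origin. -/
lemma tendsto_fourier_trunc {σ m : ℕ → ℝ} (hσ : StrictMono σ) (h0 : 0 < σ 0) (hm : ∀ k, 0 ≤ m k)
    (hs : Summable m) {f : ℝ → ℂ}
    (hf : ∀ ξ : ℝ, HasSum (fun k => ((m k * (σ k ^ 2 / (σ k ^ 2 + ξ ^ 2)) : ℝ) : ℂ)) (f ξ))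
    {t : ℝ} (ht : t ≠ 0) :
    Tendsto (fun R : ℝ => (1 / (2 * Real.pi) : ℂ) *
        ∫ ξ in (-R)..R, Complex.exp (Complex.I * ξ * t) * f ξ) atTop
      (𝓝 ((∑' k, m k * σ k / 2 * Real.exp (-σ k * |t|) : ℝ) : ℂ)) := by
  have hσp : ∀ k, 0 < σ k := fun k => h0.trans_le (hσ.monotone k.zero_le)
  set J : ℕ → ℝ → ℂ := fun k R =>
    ∫ ξ in (-R)..R, Complex.exp (Complex.I * ξ * t) * ((1 / (σ k ^ 2 + ξ ^ 2) : ℝ) : ℂ) with hJ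
  have hsumJ : ∀ R : ℝ, HasSum (fun k => ((m k * σ k ^ 2 : ℝ) : ℂ) * J k R)
      (∫ ξ in (-R)..R, Complex.exp (Complex.I * ξ * t) * f ξ) := fun R => by
    have h := intervalIntegral.hasSum_integral_of_dominated_convergence (μ := volume)
      (a := -R) (b := R)
      (F := fun k (ξ : ℝ) => Complex.exp (Complex.I * ξ * t) *
        ((m k * (σ k ^ 2 / (σ k ^ 2 + ξ ^ 2)) : ℝ) : ℂ))
      (f := fun ξ : ℝ => Complex.exp (Complex.I * ξ * t) * f ξ) (fun k _ => m k)
      (fun k => by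
        have : ∀ ξ : ℝ, σ k ^ 2 + ξ ^ 2 ≠ 0 := fun ξ => by have := hσp k; positivity
        exact Continuous.aestronglyMeasurable (by fun_prop (disch := exact this _)))
      (fun k => Eventually.of_forall fun ξ _ => by
        have h1 := hσp k
        have h2 := hm k
        rw [norm_mul, show Complex.I * ξ * t = ((ξ * t : ℝ) : ℂ) * Complex.I by push_cast; ring,
          Complex.norm_exp_ofReal_mul_I, one_mul, Complex.norm_real,
          Real.norm_of_nonneg (by positivity)]
        refine mul_le_of_le_one_right h2 (div_le_one_of_le₀ ?_ (by positivity))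
        nlinarith [sq_nonneg ξ])
      (Eventually.of_forall fun _ _ => hs) intervalIntegrable_const
      (Eventually.of_forall fun ξ _ => (hf ξ).mul_left _)
    have hk : ∀ k, ∫ ξ in (-R)..R, Complex.exp (Complex.I * ξ * t) *
        ((m k * (σ k ^ 2 / (σ k ^ 2 + ξ ^ 2)) : ℝ) : ℂ) = ((m k * σ k ^ 2 : ℝ) : ℂ) * J k R := by
      intro k
      rw [hJ, ← intervalIntegral.integral_const_mul]
      refine intervalIntegral.integral_congr fun ξ _ => ?_
      push_cast
      ring
    simp_rw [hk] at h
    exact h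
  have hlim : ∀ k, Tendsto (J k) atTop
      (𝓝 ((Real.pi / σ k * Real.exp (-σ k * |t|) : ℝ) : ℂ)) := fun k => by
    rw [← integral_cexp_div_sq_add_sq (hσp k) t]
    exact intervalIntegral_tendsto_integral (integrable_cexp_mul_inv_sq_add_sq (hσp k) t)
      tendsto_neg_atTop_atBot tendsto_id
  -- The uniform bound leaves a multiple of `m k` as majorant, so the limit `R → ∞` may be taken
  -- termwise although the full integral need not converge absolutely.
  have hmain : Tendsto (fun R => ∑' k, (1 / (2 * Real.pi) : ℂ) *
      (((m k * σ k ^ 2 : ℝ) : ℂ) * J k R)) atTop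
      (𝓝 (∑' k, ((m k * σ k / 2 * Real.exp (-σ k * |t|) : ℝ) : ℂ))) :=
    tendsto_tsum_of_dominated_convergence
    (bound := fun k => m k * (1 / (2 * Real.pi) * ((2 + Real.pi) / |t|))) (hs.mul_right _)
    (fun k => by
      have h1 := (((hlim k).const_mul ((m k * σ k ^ 2 : ℝ) : ℂ))).const_mul (1 / (2 * Real.pi) : ℂ)
      convert h1 using 2
      have : (σ k : ℂ) ≠ 0 := by exact_mod_cast (hσp k).ne'
      have : (Real.pi : ℂ) ≠ 0 := by exact_mod_cast Real.pi_ne_zero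
      push_cast
      field_simp)
    (by
      filter_upwards [eventually_ge_atTop 0] with R hR k
      have h1 := norm_integral_cexp_div_sq_add_sq_le (hσp k) ht hR
      have h2 := hσp k
      have h3 := hm k
      have h4 := abs_pos.2 ht
      rw [norm_mul, norm_mul, Complex.norm_real,
        Real.norm_of_nonneg (by positivity : 0 ≤ m k * σ k ^ 2)]
      have h5 : ‖(1 / (2 * Real.pi) : ℂ)‖ = 1 / (2 * Real.pi) := by
        rw [show (1 / (2 * Real.pi) : ℂ) = ((1 / (2 * Real.pi) : ℝ) : ℂ) by push_cast; rfl,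
          Complex.norm_real, Real.norm_of_nonneg (by positivity)]
      rw [h5]
      calc 1 / (2 * Real.pi) * (m k * σ k ^ 2 * ‖J k R‖)
          ≤ 1 / (2 * Real.pi) * (m k * σ k ^ 2 * ((2 + Real.pi) / (σ k ^ 2 * |t|))) := by gcongr
        _ = _ := by field_simp)
  rw [Complex.ofReal_tsum]
  refine hmain.congr fun R => ?_
  rw [tsum_mul_left, (hsumJ R).tsum_eq]

/-- The Green's function is a superposition of exponentials if `1 / (Θ - κ)` is a superposition of
the functions `1 / (σ² + ξ²)` on the real line. -/
lemma green_isExpKernel {n : ℕ} {γ μ κ : ℝ} {σ m : ℕ → ℝ} (hσ : StrictMono σ) (h0 : 0 < σ 0)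
    (hm : ∀ k, 0 ≤ m k) (hs : Summable m)
    (hf : ∀ ξ : ℝ, HasSum (fun k => ((m k * (σ k ^ 2 / (σ k ^ 2 + ξ ^ 2)) : ℝ) : ℂ))
      (symbol n γ μ ξ - κ)⁻¹) :
    IsExpKernel σ m (green n γ μ κ) ∧ ∀ t : ℝ, t ≠ 0 →
      Tendsto (fun R : ℝ => greenTrunc n γ μ κ R t) atTop (𝓝 (green n γ μ κ t : ℂ)) := by
  have htend : ∀ t : ℝ, t ≠ 0 → Tendsto (fun R : ℝ => greenTrunc n γ μ κ R t) atTop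
      (𝓝 ((∑' k, m k * σ k / 2 * Real.exp (-σ k * |t|) : ℝ) : ℂ)) := fun t ht =>
    tendsto_fourier_trunc hσ h0 hm hs hf ht
  have hval : ∀ t : ℝ, t ≠ 0 → green n γ μ κ t =
      ∑' k, m k * σ k / 2 * Real.exp (-σ k * |t|) := fun t ht => by
    have := (Complex.continuous_re.tendsto _).comp (htend t ht)
    exact this.limUnder_eq
  refine ⟨⟨hσ, h0, hm, hs, fun t ht => ?_⟩, fun t ht => ?_⟩
  · rw [hval t ht]
    exact (summable_exp_kernel hσ h0 hm hs ht).hasSum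
  · rw [hval t ht]
    exact htend t ht

/-! ### Convolution with `e^{-σ|t|}` -/

lemma locallyIntegrable_continuous_mul {g h : ℝ → ℝ} (hg : Continuous g)
    (hh : LocallyIntegrable h volume) : LocallyIntegrable (fun s => g s * h s) volume :=
  locallyIntegrable_iff.2 fun _ hK =>
    (hh.integrableOn_isCompact hK).continuousOn_mul hg.continuousOn hK

/-- Local integrability and both growth conditions are condensed into one weighted `L¹` condition,
the only property of `h`, besides measurability, used in convolving with `G`. -/
lemma integrable_exp_mul_of_isBigO {h : ℝ → ℝ} {δ δ₀ η : ℝ} (hh : LocallyIntegrable h volume)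
    (hδ : -η < δ) (hδ₀ : -η < δ₀) (htop : h =O[atTop] fun t => Real.exp (-δ * t))
    (hbot : h =O[atBot] fun t => Real.exp (δ₀ * t)) :
    Integrable fun s => Real.exp (-η * |s|) * h s := by
  refine (locallyIntegrable_continuous_mul (by fun_prop) hh).integrable_of_isBigO_atBot_atTop
    (g := fun s => Real.exp ((η + δ₀) * s)) (g' := fun s => Real.exp (-(η + δ) * s)) ?_ ?_ ?_ ?_
  · refine ((isBigO_refl (fun s : ℝ => Real.exp (-η * |s|)) atBot).mul hbot).congr' EventuallyEq.rfl ?_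
    filter_upwards [eventually_le_atBot 0] with s hs
    rw [abs_of_nonpos hs, ← Real.exp_add]
    ring_nf
  · exact ⟨Set.Iic 0, Iic_mem_atBot 0, integrableOn_exp_mul_Iic (by linarith) 0⟩
  · refine ((isBigO_refl (fun s : ℝ => Real.exp (-η * |s|)) atTop).mul htop).congr' EventuallyEq.rfl ?_
    filter_upwards [eventually_ge_atTop 0] with s hs
    rw [abs_of_nonneg hs, ← Real.exp_add]
    ring_nf
  · exact ⟨Set.Ioi 0, Ioi_mem_atTop 0, integrableOn_exp_mul_Ioi (by linarith) 0⟩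

lemma integrable_exp_neg_abs_sub_mul {h : ℝ → ℝ} {η σ : ℝ} (hη : 0 ≤ η) (hησ : η ≤ σ)
    (hh : Integrable fun s => Real.exp (-η * |s|) * h s) (t : ℝ) :
    Integrable fun s => Real.exp (-σ * |t - s|) * h s := by
  have hm : AEStronglyMeasurable h volume := by
    have : h = fun s => Real.exp (η * |s|) * (Real.exp (-η * |s|) * h s) := by
      ext s
      rw [← mul_assoc, ← Real.exp_add]
      simp
    rw [this]
    exact (by fun_prop : Continuous fun s : ℝ => Real.exp (η * |s|)).aestronglyMeasurable.mul hh.1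
  refine (hh.norm.const_mul (Real.exp (η * |t|))).mono' ((by fun_prop : Continuous fun s : ℝ =>
    Real.exp (-σ * |t - s|)).aestronglyMeasurable.mul hm) (Eventually.of_forall fun s => ?_)
  rw [norm_mul, norm_mul, Real.norm_of_nonneg (Real.exp_pos _).le,
    Real.norm_of_nonneg (Real.exp_pos _).le, ← mul_assoc, ← Real.exp_add]
  gcongr
  have h1 : |s| ≤ |t| + |t - s| := by
    have := abs_sub_abs_le_abs_sub s t
    rw [abs_sub_comm s t] at this
    linarith
  nlinarith [abs_nonneg (t - s)]

lemma absolutelyContinuous_const_add_primitive (p : ℝ) {g : ℝ → ℝ}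
    (hg : LocallyIntegrable g volume) (a b : ℝ) :
    AbsolutelyContinuousOnInterval (fun t => p + ∫ s in (0 : ℝ)..t, g s) a b := by
  set K := max |a| |b|
  have hi : IntervalIntegrable g volume (-K) K :=
    intervalIntegrable_iff.mpr ((hg.integrableOn_isCompact isCompact_uIcc).mono_set
      Set.uIoc_subset_uIcc)
  have hK : 0 ≤ K := (abs_nonneg a).trans (le_max_left _ _)
  have h1 := hi.absolutelyContinuousOnInterval_intervalIntegral (c := 0)
    (Set.mem_uIcc.2 (Or.inl ⟨by linarith, hK⟩))
  have h2 : AbsolutelyContinuousOnInterval (fun _ : ℝ => p) (-K) K :=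
    contDiffOn_const.absolutelyContinuousOnInterval
  refine (h2.add h1).mono (Set.uIcc_subset_uIcc ?_ ?_) <;>
    refine Set.mem_uIcc.2 (Or.inl (abs_le.1 ?_))
  · exact le_max_left _ _
  · exact le_max_right _ _

section ExpConv

variable {h : ℝ → ℝ} {σ : ℝ} (hh : LocallyIntegrable h volume)
  (hint : ∀ t : ℝ, Integrable fun s => Real.exp (-σ * |t - s|) * h s)
include hint

/-- Splitting the integral at `s = t` removes the absolute value and factors the exponential. The
constants `p` and `q` are the integrals over the half-lines up to and from `0`. -/
lemma expConv_eq_primitives : ∃ p q : ℝ, ∀ t, expConv σ h t =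
    Real.exp (-σ * t) * (p + ∫ s in (0 : ℝ)..t, Real.exp (σ * s) * h s) +
      Real.exp (σ * t) * (q + -∫ s in (0 : ℝ)..t, Real.exp (-σ * s) * h s) := by
  have h1 : ∀ t, Set.EqOn (fun s => Real.exp (-σ * |t - s|) * h s)
      (fun s => Real.exp (-σ * t) * (Real.exp (σ * s) * h s)) (Set.Iic t) := fun t s hs => by
    simp only
    rw [abs_of_nonneg (sub_nonneg.2 hs), ← mul_assoc, ← Real.exp_add]
    ring_nf
  have h2 : ∀ t, Set.EqOn (fun s => Real.exp (-σ * |t - s|) * h s)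
      (fun s => Real.exp (σ * t) * (Real.exp (-σ * s) * h s)) (Set.Ioi t) := fun t s hs => by
    simp only
    rw [abs_of_nonpos (sub_nonpos.2 (le_of_lt hs)), ← mul_assoc, ← Real.exp_add]
    ring_nf
  have i1 : ∀ t, IntegrableOn (fun s => Real.exp (σ * s) * h s) (Set.Iic t) := fun t => by
    have := ((hint t).integrableOn.congr_fun (h1 t) measurableSet_Iic).const_mul (Real.exp (σ * t))
    refine this.congr (Eventually.of_forall fun s => ?_)
    simp only
    rw [← mul_assoc, ← Real.exp_add]
    simp
  have i2 : ∀ t, IntegrableOn (fun s => Real.exp (-σ * s) * h s) (Set.Ioi t) := fun t => by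
    have := ((hint t).integrableOn.congr_fun (h2 t) measurableSet_Ioi).const_mul (Real.exp (-σ * t))
    refine this.congr (Eventually.of_forall fun s => ?_)
    simp only
    rw [← mul_assoc, ← Real.exp_add]
    simp
  refine ⟨∫ s in Set.Iic 0, Real.exp (σ * s) * h s, ∫ s in Set.Ioi 0, Real.exp (-σ * s) * h s,
    fun t => ?_⟩
  rw [expConv, ← intervalIntegral.integral_Iic_add_Ioi (hint t).integrableOn (hint t).integrableOn,
    setIntegral_congr_fun measurableSet_Iic (h1 t), setIntegral_congr_fun measurableSet_Ioi (h2 t),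
    integral_const_mul, integral_const_mul, ← intervalIntegral.integral_Iic_sub_Iic (i1 0) (i1 t),
    ← intervalIntegral.integral_Ioi_sub_Ioi' (i2 0) (i2 t)]
  ring

include hh in
-- The primitives `P` and `Q` are differentiable only almost everywhere, but their contributions
-- `±h` to the first derivative cancel. What remains is the absolutely continuous function `D`, and
-- differentiating `D` produces `-2σh`.
theorem expConv_regularity :
    ContDiff ℝ 1 (expConv σ h) ∧
    (∀ a b : ℝ, AbsolutelyContinuousOnInterval (deriv (expConv σ h)) a b) ∧
    (∀ᵐ t : ℝ, DifferentiableAt ℝ (deriv (expConv σ h)) t ∧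
      deriv (deriv (expConv σ h)) t - σ ^ 2 * expConv σ h t = -2 * σ * h t) ∧
    (∀ t : ℝ, ContinuousAt h t → DifferentiableAt ℝ (deriv (expConv σ h)) t ∧
      deriv (deriv (expConv σ h)) t - σ ^ 2 * expConv σ h t = -2 * σ * h t) := by
  obtain ⟨p, q, hpq⟩ := expConv_eq_primitives hint
  have l1 : LocallyIntegrable (fun s => Real.exp (σ * s) * h s) volume :=
    locallyIntegrable_continuous_mul (by fun_prop) hh
  have l2 : LocallyIntegrable (fun s => Real.exp (-σ * s) * h s) volume :=
    locallyIntegrable_continuous_mul (by fun_prop) hh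
  set P : ℝ → ℝ := fun t => ∫ s in (0 : ℝ)..t, Real.exp (σ * s) * h s with hP
  set Q : ℝ → ℝ := fun t => ∫ s in (0 : ℝ)..t, Real.exp (-σ * s) * h s with hQ
  set D : ℝ → ℝ := fun t => σ * (Real.exp (σ * t) * (q + -Q t)) +
    -σ * (Real.exp (-σ * t) * (p + P t)) with hD
  have hw : expConv σ h = fun t => Real.exp (-σ * t) * (p + P t) + Real.exp (σ * t) * (q + -Q t) :=
    funext hpq
  have acP : ∀ a b, AbsolutelyContinuousOnInterval (fun t => p + P t) a b :=
    absolutelyContinuous_const_add_primitive p l1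
  have acQ : ∀ a b, AbsolutelyContinuousOnInterval (fun t => q + -Q t) a b := fun a b => by
    have := absolutelyContinuous_const_add_primitive q l2.neg a b
    simpa only [Pi.neg_apply, intervalIntegral.integral_neg] using this
  have acE : ∀ c a b : ℝ, AbsolutelyContinuousOnInterval (fun t => Real.exp (c * t)) a b :=
    fun c a b => ContDiffOn.absolutelyContinuousOnInterval (by fun_prop)
  have acW : ∀ a b, AbsolutelyContinuousOnInterval (expConv σ h) a b := fun a b => by
    rw [hw]
    exact ((acE _ a b).mul (acP a b)).add ((acE _ a b).mul (acQ a b))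
  have acD : ∀ a b, AbsolutelyContinuousOnInterval D a b := fun a b =>
    (((acE _ a b).mul (acQ a b)).const_mul σ).add (((acE _ a b).mul (acP a b)).const_mul (-σ))
  have hE : ∀ c t : ℝ, HasDerivAt (fun t => Real.exp (c * t)) (c * Real.exp (c * t)) t := fun c t => by
    simpa [mul_comm] using ((hasDerivAt_id t).const_mul c).exp
  have key : ∀ t, HasDerivAt P (Real.exp (σ * t) * h t) t →
      HasDerivAt Q (Real.exp (-σ * t) * h t) t →
      HasDerivAt (expConv σ h) (D t) t ∧
        HasDerivAt D (σ ^ 2 * expConv σ h t - 2 * σ * h t) t := fun t h1 h2 => by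
    have e : Real.exp (-σ * t) * Real.exp (σ * t) = 1 := by rw [← Real.exp_add]; simp
    have d1 := (hE (-σ) t).mul (h1.const_add p)
    have d2 := (hE σ t).mul (h2.neg.const_add q)
    constructor
    · rw [hw]
      exact (d1.add d2).congr_deriv (by simp only [hD, Pi.neg_apply]; ring)
    · rw [congrFun hw t]
      exact ((d2.const_mul σ).add (d1.const_mul (-σ))).congr_deriv
        (by simp only [Pi.neg_apply]; linear_combination (-2 * σ * h t) * e)
  have hae : ∀ᵐ t, HasDerivAt P (Real.exp (σ * t) * h t) t ∧
      HasDerivAt Q (Real.exp (-σ * t) * h t) t := by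
    filter_upwards [_root_.LocallyIntegrable.ae_hasDerivAt_integral l1,
      _root_.LocallyIntegrable.ae_hasDerivAt_integral l2] with t h1 h2
    exact ⟨h1 0, h2 0⟩
  have cD : Continuous D := by
    have cP : Continuous P := intervalIntegral.continuous_primitive (fun a b =>
      intervalIntegrable_iff.mpr ((l1.integrableOn_isCompact isCompact_uIcc).mono_set
        Set.uIoc_subset_uIcc)) 0
    have cQ : Continuous Q := intervalIntegral.continuous_primitive (fun a b =>
      intervalIntegrable_iff.mpr ((l2.integrableOn_isCompact isCompact_uIcc).mono_set
        Set.uIoc_subset_uIcc)) 0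
    fun_prop
  -- Upgrade from almost every `t` to every `t`: the convolution is absolutely continuous, hence the
  -- integral of its a.e. derivative `D`, which is continuous.
  have hderiv : ∀ t, HasDerivAt (expConv σ h) (D t) t := fun t => by
    have h1 : expConv σ h = fun t => expConv σ h 0 + ∫ s in (0 : ℝ)..t, D s := by
      ext t
      have h2 : ∫ s in (0 : ℝ)..t, D s = ∫ s in (0 : ℝ)..t, deriv (expConv σ h) s :=
        intervalIntegral.integral_congr_ae (hae.mono fun s hs _ => (key s hs.1 hs.2).1.deriv.symm)
      rw [h2, (acW 0 t).integral_deriv_eq_sub]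
      ring
    rw [h1]
    exact (cD.integral_hasStrictDerivAt 0 t).hasDerivAt.const_add _
  have hdW : deriv (expConv σ h) = D := funext fun t => (hderiv t).deriv
  rw [hdW]
  refine ⟨contDiff_one_iff_deriv.2 ⟨fun t => (hderiv t).differentiableAt, hdW ▸ cD⟩, acD, ?_, ?_⟩
  · filter_upwards [hae] with t ht
    have := (key t ht.1 ht.2).2
    refine ⟨this.differentiableAt, ?_⟩
    rw [this.deriv]
    ring
  · intro t ht
    have hprim : ∀ c : ℝ, LocallyIntegrable (fun s => Real.exp (c * s) * h s) volume →
        HasDerivAt (fun t => ∫ s in (0 : ℝ)..t, Real.exp (c * s) * h s) (Real.exp (c * t) * h t) t :=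
      fun c hc => intervalIntegral.integral_hasDerivAt_right
        (intervalIntegrable_iff.mpr ((hc.integrableOn_isCompact isCompact_uIcc).mono_set
          Set.uIoc_subset_uIcc)) hc.aestronglyMeasurable.stronglyMeasurableAtFilter
        (ContinuousAt.mul (by fun_prop) ht)
    have := (key t (hprim σ l1) (hprim (-σ) l2)).2
    refine ⟨this.differentiableAt, ?_⟩
    rw [this.deriv]
    ring

end ExpConv

/-! ### Convolution with a superposition of exponentials -/

namespace IsExpKernel

variable {σ m : ℕ → ℝ} {G : ℝ → ℝ} (hG : IsExpKernel σ m G) {h : ℝ → ℝ} {η : ℝ} (hη0 : 0 ≤ η)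
  (hη : η < σ 0) (hh : Integrable fun s => Real.exp (-η * |s|) * h s)

include hG hη0 hη hh

/-- The growth of `h` is paid for by the kernel: `e^{-η|·|} h` and `e^{η|·|} G` are both integrable,
so their convolution integrand is integrable on the plane. -/
lemma integrable_prod : Integrable (fun p : ℝ × ℝ =>
    Real.exp (-η * |p.2|) * h p.2 * (Real.exp (η * |p.1 - p.2|) * G (p.1 - p.2)))
    (volume.prod volume) := by
  simpa using hh.convolution_integrand (ContinuousLinearMap.mul ℝ ℝ) (hG.integrable_exp_mul hη0 hη)

lemma ae_integrable (hm : AEStronglyMeasurable h volume) :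
    ∀ᵐ t : ℝ, Integrable fun s => G (t - s) * h s := by
  filter_upwards [(hG.integrable_prod hη0 hη hh).prod_right_ae] with t ht
  refine (ht.norm.const_mul (Real.exp (η * |t|))).mono' ?_ (Eventually.of_forall fun s => ?_)
  · exact (hG.measurable.comp (by fun_prop)).aestronglyMeasurable.mul hm
  · simp only [norm_mul, Real.norm_of_nonneg (Real.exp_pos _).le]
    -- Triangle inequality `|s| ≤ |t| + |t - s|`: for fixed `t` the weights may be dropped at the
    -- cost of `e^{η|t|}`.
    have h1 : 1 ≤ Real.exp (η * |t|) * Real.exp (-η * |s|) * Real.exp (η * |t - s|) := by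
      rw [← Real.exp_add, ← Real.exp_add]
      refine Real.one_le_exp ?_
      have := abs_sub_abs_le_abs_sub s t
      rw [abs_sub_comm s t] at this
      nlinarith
    have h2 : 0 ≤ ‖G (t - s)‖ * ‖h s‖ := by positivity
    calc ‖G (t - s)‖ * ‖h s‖ ≤ (Real.exp (η * |t|) * Real.exp (-η * |s|) *
          Real.exp (η * |t - s|)) * (‖G (t - s)‖ * ‖h s‖) := le_mul_of_one_le_left h2 h1
      _ = _ := by ring

/-- Near `t` the function `h` is bounded and `G` is integrable; at distance at least `r` the kernel
is bounded by a multiple of `e^{-σ₀|t-s|}`. -/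
lemma integrable_of_continuousAt (hm : AEStronglyMeasurable h volume) {t : ℝ}
    (ht : ContinuousAt h t) : Integrable fun s => G (t - s) * h s := by
  obtain ⟨r, hr, hball⟩ := Metric.eventually_nhds_iff.1
    (ht.norm.eventually_le_const (lt_add_one ‖h t‖))
  set C := (∑' k, m k) * (Real.exp (σ 0 * r) / (2 * r)) with hC
  have hC0 : 0 ≤ C := mul_nonneg (tsum_nonneg hG.nonneg) (by positivity)
  have i1 : Integrable fun s => (‖h t‖ + 1) * G (t - s) :=
    (hG.integrable.comp_sub_left t).const_mul _
  have i2 := ((integrable_exp_neg_abs_sub_mul hη0 hη.le hh t).norm).const_mul C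
  refine (i1.add i2).mono' ?_ ?_
  · exact (hG.measurable.comp (by fun_prop)).aestronglyMeasurable.mul hm
  · have hne : ∀ᵐ s : ℝ, s ≠ t := by simp [ae_iff, measure_singleton]
    filter_upwards [hne] with s hs
    have hts : t - s ≠ 0 := sub_ne_zero.2 hs.symm
    have h0 := hG.kernel_nonneg hts
    simp only [Pi.add_apply]
    rw [norm_mul, Real.norm_of_nonneg h0, norm_mul, Real.norm_of_nonneg (Real.exp_pos _).le]
    rcases lt_or_ge |t - s| r with hd | hd
    · have h1 : ‖h s‖ ≤ ‖h t‖ + 1 := hball (by rwa [Real.dist_eq, abs_sub_comm])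
      refine le_add_of_le_of_nonneg ?_ (by positivity)
      rw [mul_comm]
      gcongr
    · refine le_add_of_nonneg_of_le (by positivity) ?_
      rw [← mul_assoc]
      gcongr
      exact hG.kernel_le hr hd

omit hη0 hη hh in
-- Positivity of the terms makes `|G(t-s)| |h(s)|` the sum of their absolute values, so absolute
-- convergence at `t` is all that dominated convergence requires.
lemma hasSum_conv (hm : AEStronglyMeasurable h volume) {t : ℝ}
    (ht : Integrable fun s => G (t - s) * h s) :
    HasSum (fun k => m k * σ k / 2 * expConv (σ k) h t) (∫ s, G (t - s) * h s) := by
  have hne : ∀ᵐ s : ℝ, t - s ≠ 0 := by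
    have : ∀ᵐ s : ℝ, s ≠ t := by simp [ae_iff, measure_singleton]
    exact this.mono fun s hs => sub_ne_zero.2 hs.symm
  have hs := hasSum_integral_of_dominated_convergence (μ := (volume : Measure ℝ))
    (F := fun k s => m k * σ k / 2 * Real.exp (-σ k * |t - s|) * h s)
    (f := fun s => G (t - s) * h s)
    (fun k s => m k * σ k / 2 * Real.exp (-σ k * |t - s|) * ‖h s‖)
    (fun k => (by fun_prop : Continuous fun s : ℝ =>
      m k * σ k / 2 * Real.exp (-σ k * |t - s|)).aestronglyMeasurable.mul hm)
    (fun k => Eventually.of_forall fun s => by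
      rw [norm_mul, Real.norm_of_nonneg (hG.term_nonneg k (t - s))])
    (hne.mono fun s hs => (hG.hasSum _ hs).summable.mul_right _)
    (ht.norm.congr (hne.mono fun s hs => by
      simp only
      rw [tsum_mul_right, (hG.hasSum _ hs).tsum_eq, norm_mul,
        Real.norm_of_nonneg (hG.kernel_nonneg hs)]))
    (hne.mono fun s hs => (hG.hasSum _ hs).mul_right _)
  have hk : ∀ k, ∫ s, m k * σ k / 2 * Real.exp (-σ k * |t - s|) * h s =
      m k * σ k / 2 * expConv (σ k) h t := fun k => by
    rw [expConv, ← integral_const_mul]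
    simp only [mul_assoc]
  simp_rw [hk] at hs
  exact hs

/-- Fubini for the pairing of `G * h` with an exponentially decaying function `L`. -/
lemma integral_conv_mul {L φ : ℝ → ℝ} {C : ℝ} (hm : AEStronglyMeasurable h volume)
    (hL : AEStronglyMeasurable L volume) (hLC : ∀ t, |L t| ≤ C * Real.exp (-η * |t|))
    (hφ : ∀ s, ∫ t, G (t - s) * L t = φ s) :
    Integrable (fun t => (∫ s, G (t - s) * h s) * L t) ∧
    ∫ t, (∫ s, G (t - s) * h s) * L t = ∫ s, h s * φ s := by
  have hint : Integrable (fun p : ℝ × ℝ => G (p.1 - p.2) * h p.2 * L p.1)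
      (volume.prod volume) := by
    refine ((hG.integrable_prod hη0 hη hh).norm.const_mul C).mono' ?_
      (Eventually.of_forall fun p => ?_)
    · exact ((hG.measurable.comp (by fun_prop)).aestronglyMeasurable.mul hm.comp_snd).mul
        hL.comp_fst
    · simp only [norm_mul, Real.norm_of_nonneg (Real.exp_pos _).le]
      have h1 : Real.exp (-η * |p.1|) ≤ Real.exp (-η * |p.2|) * Real.exp (η * |p.1 - p.2|) := by
        rw [← Real.exp_add]
        refine Real.exp_le_exp.2 ?_
        have := abs_sub_abs_le_abs_sub p.2 p.1
        rw [abs_sub_comm p.2 p.1] at this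
        nlinarith
      have hC : 0 ≤ C := by
        have := (abs_nonneg _).trans (hLC 0)
        simpa using this
      calc ‖G (p.1 - p.2)‖ * ‖h p.2‖ * ‖L p.1‖
          ≤ ‖G (p.1 - p.2)‖ * ‖h p.2‖ * (C * Real.exp (-η * |p.1|)) := by
            gcongr; exact hLC _
        _ ≤ ‖G (p.1 - p.2)‖ * ‖h p.2‖ *
            (C * (Real.exp (-η * |p.2|) * Real.exp (η * |p.1 - p.2|))) := by gcongr
        _ = _ := by ring
  constructor
  · refine hint.integral_prod_left.congr (Eventually.of_forall fun t => ?_)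
    simp only [integral_mul_const]
  · calc ∫ t, (∫ s, G (t - s) * h s) * L t = ∫ t, ∫ s, G (t - s) * h s * L t := by
          simp only [integral_mul_const]
      _ = ∫ s, ∫ t, G (t - s) * h s * L t := integral_integral_swap hint
      _ = ∫ s, h s * φ s := by
          refine integral_congr_ae (Eventually.of_forall fun s => ?_)
          simp only
          rw [← hφ, ← integral_const_mul]
          refine integral_congr_ae (Eventually.of_forall fun t => ?_)
          simp only
          ring

end IsExpKernel

/-! ### Convolutions and the Fourier transform -/

lemma conv_fourier {G L : ℝ → ℝ} {C : ℝ} (hG : Integrable G) (hLc : Continuous L)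
    (hLi : Integrable L) (hLC : ∀ t, |L t| ≤ C) :
    Continuous (fun t => ∫ s, G s * L (t - s)) ∧ Integrable (fun t => ∫ s, G s * L (t - s)) ∧
    ∀ x, 𝓕 (fun t => ((∫ s, G s * L (t - s) : ℝ) : ℂ)) x =
      𝓕 (fun t => (G t : ℂ)) x * 𝓕 (fun t => (L t : ℂ)) x := by
  have hbdd : BddAbove (Set.range fun x => ‖L x‖) := ⟨C, by rintro _ ⟨x, rfl⟩; exact hLC x⟩
  refine ⟨hbdd.continuous_convolution_right_of_integrable (ContinuousLinearMap.mul ℝ ℝ) hG hLc,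
    hG.integrable_convolution (ContinuousLinearMap.mul ℝ ℝ) hLi, fun x => ?_⟩
  have e : (fun t => ((∫ s, G s * L (t - s) : ℝ) : ℂ)) =
      convolution (fun t => (G t : ℂ)) (fun t => (L t : ℂ)) (ContinuousLinearMap.mul ℂ ℂ)
        volume := by
    ext t
    rw [convolution, ← integral_complex_ofReal]
    simp
  rw [e, ← Real.fourier_mul_convolution_eq (f₁ := fun t => (G t : ℂ)) (f₂ := fun t => (L t : ℂ))
    hG.ofReal hLi.ofReal]

/-- Exponential decay at a rate `η < σ 0` survives convolution because `e^{η|·|} G` is integrable.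
-/
lemma IsExpKernel.abs_conv_le {σ m : ℕ → ℝ} {G : ℝ → ℝ} (hG : IsExpKernel σ m G) {η : ℝ}
    (hη0 : 0 ≤ η) (hη : η < σ 0) {L : ℝ → ℝ} {C : ℝ} (hLC : ∀ t, |L t| ≤ C * Real.exp (-η * |t|))
    (t : ℝ) :
    |∫ s, G s * L (t - s)| ≤ (C * ∫ s, Real.exp (η * |s|) * G s) * Real.exp (-η * |t|) := by
  have hi := ((hG.integrable_exp_mul hη0 hη).const_mul C).mul_const (Real.exp (-η * |t|))
  rw [← Real.norm_eq_abs, ← integral_const_mul, ← integral_mul_const]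
  refine norm_integral_le_of_norm_le hi (ae_ne_zero.mono fun s hs => ?_)
  have h0 := hG.kernel_nonneg hs
  have hC : 0 ≤ C := by simpa using (abs_nonneg _).trans (hLC 0)
  rw [norm_mul, Real.norm_of_nonneg h0, Real.norm_eq_abs]
  have h1 : Real.exp (-η * |t - s|) ≤ Real.exp (η * |s|) * Real.exp (-η * |t|) := by
    rw [← Real.exp_add]
    refine Real.exp_le_exp.2 ?_
    have := abs_sub_abs_le_abs_sub t s
    nlinarith
  calc G s * |L (t - s)| ≤ G s * (C * Real.exp (-η * |t - s|)) := by
        gcongr; exact hLC _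
    _ ≤ G s * (C * (Real.exp (η * |s|) * Real.exp (-η * |t|))) := by gcongr
    _ = _ := by ring

lemma continuous_fourier_ofReal {G : ℝ → ℝ} (hG : Integrable G) :
    Continuous (𝓕 (fun t => (G t : ℂ))) :=
  VectorFourier.fourierIntegral_continuous Real.continuous_fourierChar (by fun_prop) hG.ofReal

lemma fourier_mul_add_mul {f g : ℝ → ℝ} (hf : Integrable f) (hg : Integrable g) (a b x : ℝ) :
    𝓕 (fun t => ((a * f t + b * g t : ℝ) : ℂ)) x =
      a * 𝓕 (fun t => (f t : ℂ)) x + b * 𝓕 (fun t => (g t : ℂ)) x := by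
  have i1 : Integrable fun v : ℝ => Real.fourierChar (-inner ℝ v x) • (f v : ℂ) :=
    (Real.fourierIntegral_convergent_iff x).2 hf.ofReal
  have i2 : Integrable fun v : ℝ => Real.fourierChar (-inner ℝ v x) • (g v : ℂ) :=
    (Real.fourierIntegral_convergent_iff x).2 hg.ofReal
  rw [Real.fourier_eq, Real.fourier_eq, Real.fourier_eq, ← integral_const_mul,
    ← integral_const_mul, ← integral_add (i1.const_mul _) (i2.const_mul _)]
  refine integral_congr_ae (Eventually.of_forall fun t => ?_)
  simp only [Circle.smul_def, smul_eq_mul]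
  push_cast
  ring

lemma norm_fourier_ofReal_le {G : ℝ → ℝ} (x : ℝ) : ‖𝓕 (fun t => (G t : ℂ)) x‖ ≤ ∫ t, |G t| := by
  refine (VectorFourier.norm_fourierIntegral_le_integral_norm _ _ _ _ _).trans_eq ?_
  simp

/-! ### Test functions -/

lemma integrable_fourier_of_test {φ : ℝ → ℝ} (hφ : ContDiff ℝ ∞ φ) (hc : HasCompactSupport φ) :
    Integrable (𝓕 (fun t => (φ t : ℂ))) := by
  have h1 : HasCompactSupport fun t => (φ t : ℂ) := hc.comp_left Complex.ofReal_zero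
  have h2 : ContDiff ℝ ∞ fun t => (φ t : ℂ) := Complex.ofRealCLM.contDiff.comp hφ
  have := (𝓕 (h1.toSchwartzMap h2)).integrable (μ := volume)
  exact this

lemma exists_exp_bound_of_test {φ : ℝ → ℝ} (hφ : Continuous φ) (hc : HasCompactSupport φ) (η : ℝ) :
    ∃ C, ∀ t, |φ t| ≤ C * Real.exp (-η * |t|) := by
  have h1 : HasCompactSupport fun t => φ t * Real.exp (η * |t|) := hc.mul_right
  obtain ⟨C, hC⟩ := h1.exists_bound_of_continuous (by fun_prop)
  refine ⟨C, fun t => ?_⟩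
  have h2 := hC t
  rw [norm_mul, Real.norm_of_nonneg (Real.exp_pos _).le, Real.norm_eq_abs] at h2
  rw [neg_mul, Real.exp_neg, ← div_eq_mul_inv, le_div_iff₀ (Real.exp_pos _)]
  exact h2

lemma fourier_deriv_deriv {φ : ℝ → ℝ} (hφ : ContDiff ℝ ∞ φ) (hc : HasCompactSupport φ) (x : ℝ) :
    𝓕 (fun t => ((deriv (deriv φ) t : ℝ) : ℂ)) x =
      -(2 * Real.pi * x) ^ 2 * 𝓕 (fun t => (φ t : ℂ)) x := by
  have hd : ContDiff ℝ ∞ (deriv φ) := (contDiff_infty_iff_deriv.1 hφ).2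
  have hdd : ContDiff ℝ ∞ (deriv (deriv φ)) := (contDiff_infty_iff_deriv.1 hd).2
  have key : ∀ f : ℝ → ℝ, ContDiff ℝ ∞ f → HasCompactSupport f → 𝓕 (fun t => ((deriv f t : ℝ) : ℂ)) x =
      (2 * Real.pi * Complex.I * x) * 𝓕 (fun t => (f t : ℂ)) x := fun f hf hfc => by
    have hfd : ∀ t, HasDerivAt f (deriv f t) t := fun t =>
      (hf.differentiable (by simp) t).hasDerivAt
    have e : deriv (fun t => (f t : ℂ)) = fun t => ((deriv f t : ℝ) : ℂ) :=
      funext fun t => (hfd t).ofReal_comp.deriv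
    have hcd : Continuous (deriv f) := (contDiff_infty_iff_deriv.1 hf).2.continuous
    have := Real.fourier_deriv (f := fun t => (f t : ℂ))
      (hf.continuous.integrable_of_hasCompactSupport hfc).ofReal
      (fun t => (hfd t).ofReal_comp.differentiableAt)
      (by rw [e]; exact (hcd.integrable_of_hasCompactSupport hfc.deriv).ofReal)
    rw [e] at this
    rw [this]
    simp
  rw [key _ hd hc.deriv, key _ hφ hc]
  linear_combination (4 * (Real.pi : ℂ) ^ 2 * x ^ 2 * 𝓕 (fun t => (φ t : ℂ)) x) * Complex.I_sq

/-! ### The weak equation -/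

/-- By `h2`, `𝓛φ = G' * ψ - κφ` with the test function `ψ = c(bφ - φ'')`, so it is continuous,
integrable and `O(e^{-η|t|})`. By `h1`, convolving it with the Green's function gives back `φ`. The
condition `σ 0 ≤ ρ 0` ensures that `G'` tolerates the same weight `η`. -/
theorem isWeakSolution_of_symbol {n : ℕ} {γ μ κ : ℝ} {σ m ρ m' : ℕ → ℝ} {G' : ℝ → ℝ}
    (hG : IsExpKernel σ m (green n γ μ κ)) (hG' : IsExpKernel ρ m' G') (hρ : σ 0 ≤ ρ 0) {b c : ℝ}
    (h1 : ∀ x : ℝ, (symbol n γ μ ((2 * Real.pi * x : ℝ) : ℂ) - κ) *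
      𝓕 (fun t => (green n γ μ κ t : ℂ)) x = 1)
    (h2 : ∀ x : ℝ, symbol n γ μ ((2 * Real.pi * x : ℝ) : ℂ) =
      c * (b + (2 * Real.pi * x) ^ 2) * 𝓕 (fun t => (G' t : ℂ)) x)
    {h : ℝ → ℝ} {η : ℝ} (hη0 : 0 ≤ η) (hη : η < σ 0) (hm : AEStronglyMeasurable h volume)
    (hh : Integrable fun s => Real.exp (-η * |s|) * h s) :
    IsWeakSolution n γ μ κ h (greenConv n γ μ κ h) := by
  intro φ hφ hφc
  have hdd : ContDiff ℝ ∞ (deriv (deriv φ)) :=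
    (contDiff_infty_iff_deriv.1 (contDiff_infty_iff_deriv.1 hφ).2).2
  set ψ : ℝ → ℝ := fun t => c * (b * φ t - deriv (deriv φ) t) with hψdef
  have hψ : ContDiff ℝ ∞ ψ := by fun_prop
  have hψc : HasCompactSupport ψ := by
    have : HasCompactSupport fun t => b * φ t - deriv (deriv φ) t :=
      (hφc.mul_left (f := fun _ => b)).sub hφc.deriv.deriv
    exact this.mul_left
  have iφ : Integrable φ := hφ.continuous.integrable_of_hasCompactSupport hφc
  have iψ : Integrable ψ := hψ.continuous.integrable_of_hasCompactSupport hψc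
  have idd : Integrable (deriv (deriv φ)) :=
    hdd.continuous.integrable_of_hasCompactSupport hφc.deriv.deriv
  have hFψ : ∀ x, 𝓕 (fun t => (ψ t : ℂ)) x =
      c * (b + (2 * Real.pi * x) ^ 2) * 𝓕 (fun t => (φ t : ℂ)) x := fun x => by
    have e : (fun t => (ψ t : ℂ)) =
        fun t => ((c * b * φ t + (-c) * deriv (deriv φ) t : ℝ) : ℂ) := by
      ext t
      rw [hψdef]
      congr 1
      ring
    rw [e, fourier_mul_add_mul iφ idd, fourier_deriv_deriv hφ hφc]
    push_cast
    ring
  set K : ℝ → ℝ := fun t => ∫ s, G' s * ψ (t - s) with hK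
  obtain ⟨Cψ, hCψ⟩ := hψ.continuous.bounded_above_of_compact_support hψc
  obtain ⟨cK, iK, FK⟩ := conv_fourier hG'.integrable hψ.continuous iψ hCψ
  set L : ℝ → ℝ := fun t => K t - κ * φ t with hL
  have cL : Continuous L := cK.sub (continuous_const.mul hφ.continuous)
  have iL : Integrable L := iK.sub (iφ.const_mul κ)
  have FL : ∀ x, 𝓕 (fun t => (L t : ℂ)) x =
      (symbol n γ μ ((2 * Real.pi * x : ℝ) : ℂ) - κ) * 𝓕 (fun t => (φ t : ℂ)) x := fun x => by
    have e : (fun t => (L t : ℂ)) = fun t => ((1 * K t + (-κ) * φ t : ℝ) : ℂ) := by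
      ext t
      rw [hL]
      congr 1
      ring
    rw [e, fourier_mul_add_mul iK iφ, FK, hFψ, h2]
    push_cast
    ring
  have iFL : Integrable (𝓕 (fun t => (L t : ℂ))) := by
    have e : 𝓕 (fun t => (L t : ℂ)) = fun x => 𝓕 (fun t => (G' t : ℂ)) x * 𝓕 (fun t => (ψ t : ℂ)) x -
        κ * 𝓕 (fun t => (φ t : ℂ)) x := funext fun x => by
      rw [FL, hFψ, h2]
      ring
    rw [e]
    refine Integrable.sub ?_ ((integrable_fourier_of_test hφ hφc).const_mul _)
    exact (integrable_fourier_of_test hψ hψc).bdd_mul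
      (continuous_fourier_ofReal hG'.integrable).aestronglyMeasurable
      (Eventually.of_forall norm_fourier_ofReal_le)
  have hop : ∀ t, hardyOp n γ μ κ φ t = L t := fun t => by
    rw [hardyOp]
    simp_rw [← FL]
    have : Continuous fun t => (L t : ℂ) := Complex.continuous_ofReal.comp cL
    rw [show (fun x : ℝ => 𝓕 (fun t => (L t : ℂ)) x) = 𝓕 (fun t => (L t : ℂ)) from rfl,
      congrFun (this.fourierInv_fourier_eq iL.ofReal iFL) t, Complex.ofReal_re]
  obtain ⟨C1, hC1⟩ := exists_exp_bound_of_test hψ.continuous hψc η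
  obtain ⟨C2, hC2⟩ := exists_exp_bound_of_test hφ.continuous hφc η
  have hLC : ∀ t, |L t| ≤ (C1 * (∫ s, Real.exp (η * |s|) * G' s) + |κ| * C2) *
      Real.exp (-η * |t|) := fun t => by
    have e1 := hG'.abs_conv_le hη0 (hη.trans_le hρ) hC1 t
    have e2 := mul_le_mul_of_nonneg_left (hC2 t) (abs_nonneg κ)
    rw [← abs_mul] at e2
    refine (abs_sub _ _).trans ?_
    rw [add_mul]
    linarith
  have hL' : ∀ t, |L t| ≤ C1 * (∫ s, Real.exp (η * |s|) * G' s) + |κ| * C2 := fun t => by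
    have h0 := (abs_nonneg _).trans (hLC 0)
    rw [abs_zero, mul_zero, Real.exp_zero, mul_one] at h0
    refine (hLC t).trans (mul_le_of_le_one_right h0 (Real.exp_le_one_iff.2 ?_))
    nlinarith [abs_nonneg t]
  obtain ⟨cGL, iGL, FGL⟩ := conv_fourier hG.integrable cL iL hL'
  -- Both sides are continuous and integrable with the same integrable Fourier transform, so
  -- inversion identifies them at every point.
  have hGL : ∀ s, ∫ t, green n γ μ κ t * L (s - t) = φ s := fun s => by
    have e : 𝓕 (fun t => ((∫ s, green n γ μ κ s * L (t - s) : ℝ) : ℂ)) =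
        𝓕 (fun t => (φ t : ℂ)) := funext fun x => by
      rw [FGL, FL]
      linear_combination (𝓕 (fun t => (φ t : ℂ)) x) * h1 x
    have cc : Continuous fun t => ((∫ s, green n γ μ κ s * L (t - s) : ℝ) : ℂ) :=
      Complex.continuous_ofReal.comp cGL
    have cφ : Continuous fun t => (φ t : ℂ) := Complex.continuous_ofReal.comp hφ.continuous
    have iF := integrable_fourier_of_test hφ hφc
    have e1 := congrFun (cc.fourierInv_fourier_eq iGL.ofReal (e ▸ iF)) s
    have e2 := congrFun (cφ.fourierInv_fourier_eq iφ.ofReal iF) s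
    rw [e, e2] at e1
    exact (Complex.ofReal_injective e1).symm
  have hGL' : ∀ s, ∫ t, green n γ μ κ (t - s) * L t = φ s := fun s => by
    rw [← hGL s, ← integral_sub_left_eq_self (fun t => green n γ μ κ t * L (s - t)) volume s]
    refine integral_congr_ae ?_
    have : ∀ᵐ t : ℝ, t ≠ s := by simp [ae_iff, measure_singleton]
    filter_upwards [this] with t ht
    rw [sub_sub_cancel, ← hG.kernel_neg (sub_ne_zero.2 ht), neg_sub]
  simp_rw [hop]
  exact hG.integral_conv_mul hη0 hη hh hm cL.aestronglyMeasurable hLC hGL'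

/-! ### Eigenvalues of the sphere are nonnegative -/

/-- A positive second derivative would make `a` a local minimum as well, hence `g` locally constant
and the second derivative zero. -/
lemma deriv_deriv_nonpos_of_isLocalMax {g : ℝ → ℝ} {a : ℝ} (hg : IsLocalMax g a)
    (hc : ContinuousAt g a) : deriv (deriv g) a ≤ 0 := by
  by_contra! h
  have hmin := isLocalMin_of_deriv_deriv_pos h hg.deriv_eq_zero hc
  have he : g =ᶠ[𝓝 a] fun _ => g a := by
    filter_upwards [hg, hmin] with x h1 h2 using le_antisymm h1 h2
  have : deriv (deriv g) a = 0 := by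
    rw [he.deriv.deriv_eq]
    simp
  exact h.ne' this

lemma fderiv_fderiv_apply_nonpos_of_isLocalMax {E : Type*} [NormedAddCommGroup E]
    [NormedSpace ℝ E] {F : E → ℝ} {x : E} (hF : ContDiffAt ℝ 2 F x) (hm : IsLocalMax F x) (e : E) :
    fderiv ℝ (fderiv ℝ F) x e e ≤ 0 := by
  have hl : ∀ t : ℝ, HasDerivAt (fun t : ℝ => x + t • e) e t := fun t => by
    simpa using ((hasDerivAt_id t).smul_const e).const_add x
  have h0 : x + (0 : ℝ) • e = x := by rw [zero_smul, add_zero]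
  have ht : Tendsto (fun t : ℝ => x + t • e) (𝓝 0) (𝓝 x) := by
    have := (hl 0).continuousAt.tendsto
    rwa [h0] at this
  have h1 : deriv (fun t : ℝ => F (x + t • e)) =ᶠ[𝓝 0] fun t => fderiv ℝ F (x + t • e) e := by
    have : ∀ᶠ y in 𝓝 x, DifferentiableAt ℝ F y :=
      (hF.eventually (by simp)).mono fun y hy => hy.differentiableAt (by simp)
    filter_upwards [ht.eventually this] with t hd
    exact (hd.hasFDerivAt.comp_hasDerivAt t (hl t)).deriv
  have hd : HasFDerivAt (fderiv ℝ F) (fderiv ℝ (fderiv ℝ F) x) (x + (0 : ℝ) • e) := by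
    rw [h0]
    exact ((hF.fderiv_right (m := 1) (by norm_num)).differentiableAt (by simp)).hasFDerivAt
  have h2 : HasDerivAt (fun t : ℝ => fderiv ℝ F (x + t • e) e) (fderiv ℝ (fderiv ℝ F) x e e) 0 := by
    have := hd.comp_hasDerivAt (f := fun t : ℝ => x + t • e) 0 (hl 0)
    exact (ContinuousLinearMap.apply ℝ ℝ e).hasFDerivAt.comp_hasDerivAt (𝕜 := ℝ) 0 this
  have h3 : IsLocalMax (fun t : ℝ => F (x + t • e)) 0 := by
    have : ∀ᶠ t : ℝ in 𝓝 0, F (x + t • e) ≤ F x := ht.eventually hm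
    rw [IsLocalMax, IsMaxFilter, h0]
    exact this
  have h4 := deriv_deriv_nonpos_of_isLocalMax h3 (by
    refine ContinuousAt.comp (f := fun t : ℝ => x + t • e) ?_ (hl 0).continuousAt
    rw [h0]
    exact hF.continuousAt)
  rwa [h1.deriv_eq, h2.deriv] at h4

lemma laplacian_nonpos_of_isLocalMax {E : Type*} [NormedAddCommGroup E] [InnerProductSpace ℝ E]
    [FiniteDimensional ℝ E] {F : E → ℝ} {x : E} (hF : ContDiffAt ℝ 2 F x) (hm : IsLocalMax F x) :
    (Δ F) x ≤ 0 := by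
  rw [InnerProductSpace.laplacian_eq_iteratedFDeriv_stdOrthonormalBasis]
  refine Finset.sum_nonpos fun i _ => ?_
  rw [iteratedFDeriv_two_apply]
  exact fderiv_fderiv_apply_nonpos_of_isLocalMax hF hm _

/-- Maximum principle: by homogeneity the maximum of `|F|` on the sphere is a maximum over all
nonzero points. There `ΔF` and `F` cannot have the same strict sign, while `ΔF = -μF` with `F ≠ 0`.
-/
theorem IsSphereEigenvalue.nonneg {n : ℕ} {μ : ℝ} (h : IsSphereEigenvalue n μ) : 0 ≤ μ := by
  obtain ⟨F, hF, hr, ⟨x₁, hx₁, hFx₁⟩, hΔ⟩ := h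
  have hproj : ∀ x : EuclideanSpace ℝ (Fin n), x ≠ 0 → ‖‖x‖⁻¹ • x‖ = 1 ∧ F (‖x‖⁻¹ • x) = F x :=
    fun x hx => ⟨norm_smul_inv_norm hx, hr _ (inv_pos.2 (norm_pos_iff.2 hx)) x⟩
  have hsub : Metric.sphere (0 : EuclideanSpace ℝ (Fin n)) 1 ⊆ {0}ᶜ := fun x hx h0 => by
    simp [Set.mem_singleton_iff.1 h0] at hx
  obtain ⟨x, hx, hmax⟩ := (isCompact_sphere (0 : EuclideanSpace ℝ (Fin n)) 1).exists_isMaxOn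
    ⟨‖x₁‖⁻¹ • x₁, mem_sphere_zero_iff_norm.2 (hproj x₁ hx₁).1⟩ (hF.continuousOn.mono hsub).abs
  have hx0 : x ≠ 0 := hsub hx
  rw [mem_sphere_zero_iff_norm] at hx
  have hall : ∀ y, y ≠ 0 → |F y| ≤ |F x| := fun y hy => by
    have := hmax (mem_sphere_zero_iff_norm.2 (hproj y hy).1)
    simpa only [Set.mem_ofPred_eq, (hproj y hy).2] using this
  have hpos : 0 < |F x| := (abs_pos.2 hFx₁).trans_le (hall x₁ hx₁)
  have hnhds : ∀ᶠ y in 𝓝 x, y ≠ 0 := isOpen_ne.mem_nhds hx0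
  have hFx : ContDiffAt ℝ 2 F x :=
    (hF.contDiffAt (isOpen_compl_singleton.mem_nhds hx0)).of_le
      (WithTop.coe_le_coe.2 le_top)
  have hΔx := hΔ x hx
  rcases lt_or_gt_of_ne (abs_pos.1 hpos) with h0 | h0
  · have hm : IsLocalMax (-F) x := hnhds.mono fun y hy => by
      have := hall y hy
      rw [abs_of_neg h0] at this
      exact (neg_le_abs _).trans this
    have := laplacian_nonpos_of_isLocalMax (F := -F) hFx.neg hm
    rw [InnerProductSpace.laplacian_neg] at this
    simp only [Pi.neg_apply] at this
    nlinarith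
  · have hm : IsLocalMax F x := hnhds.mono fun y hy => by
      have := hall y hy
      rw [abs_of_pos h0] at this
      exact (le_abs_self _).trans this
    have := laplacian_nonpos_of_isLocalMax hFx hm
    nlinarith

/-! ### Positivity of the symbol minus the Hardy constant -/

/-- Log-convexity of `Γ`: `x + γ` and `y` are convex combinations of `x` and `y + γ` with exchanged
weights, so adding the two convexity inequalities gives the claim. -/
lemma gamma_ratio_mono {γ x y : ℝ} (hγ : 0 ≤ γ) (hx : 0 < x) (hxy : x ≤ y) :
    Real.Gamma (x + γ) / Real.Gamma x ≤ Real.Gamma (y + γ) / Real.Gamma y := by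
  have hy := hx.trans_le hxy
  have g1 := Real.Gamma_pos_of_pos hx
  have g2 := Real.Gamma_pos_of_pos hy
  have g3 := Real.Gamma_pos_of_pos (by linarith : 0 < x + γ)
  have g4 := Real.Gamma_pos_of_pos (by linarith : 0 < y + γ)
  rcases hγ.eq_or_lt with rfl | hγ
  · simp [g1.ne', g2.ne']
  rcases hxy.eq_or_lt with rfl | hxy
  · rfl
  have key : Real.log (Real.Gamma (x + γ)) + Real.log (Real.Gamma y) ≤
      Real.log (Real.Gamma (y + γ)) + Real.log (Real.Gamma x) := by
    have hc := Real.convexOn_log_Gamma.2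
    have hd : 0 < y - x + γ := by linarith
    have e1 := hc (Set.mem_Ioi.2 hx) (Set.mem_Ioi.2 (by linarith : 0 < y + γ))
      (a := (y - x) / (y - x + γ)) (b := γ / (y - x + γ)) (div_nonneg (by linarith) hd.le)
      (div_nonneg (by linarith) hd.le)
      (by rw [← add_div, div_self hd.ne'])
    have e2 := hc (Set.mem_Ioi.2 hx) (Set.mem_Ioi.2 (by linarith : 0 < y + γ))
      (a := γ / (y - x + γ)) (b := (y - x) / (y - x + γ)) (div_nonneg (by linarith) hd.le)
      (div_nonneg (by linarith) hd.le)
      (by rw [← add_div, add_comm, div_self hd.ne'])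
    have p1 : (y - x) / (y - x + γ) * x + γ / (y - x + γ) * (y + γ) = x + γ := by
      field_simp
      ring
    have p2 : γ / (y - x + γ) * x + (y - x) / (y - x + γ) * (y + γ) = y := by
      field_simp
      ring
    have p3 : (y - x) / (y - x + γ) + γ / (y - x + γ) = 1 := by
      rw [← add_div, div_self hd.ne']
    simp only [smul_eq_mul, p1, p2, Function.comp] at e1 e2
    refine (add_le_add e1 e2).trans_eq ?_
    linear_combination (Real.log (Real.Gamma (y + γ)) + Real.log (Real.Gamma x)) * p3
  rw [← Real.log_mul g3.ne' g2.ne', ← Real.log_mul g4.ne' g1.ne',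
    Real.log_le_log_iff (mul_pos g3 g2) (mul_pos g4 g1)] at key
  rwa [div_le_div_iff₀ g1 g2]

lemma constA_eq (n : ℕ) (γ μ : ℝ) : constA n γ μ = constB n γ μ + γ := by
  rw [constA, constB]; ring

lemma le_constB {n : ℕ} {γ μ : ℝ} (hμ : 0 ≤ μ) : ((n : ℝ) - 2 * γ) / 4 ≤ constB n γ μ := by
  have : (n : ℝ) / 2 - 1 ≤ Real.sqrt (((n : ℝ) / 2 - 1) ^ 2 + μ) :=
    Real.le_sqrt_of_sq_le (by linarith)
  rw [constB]
  linarith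

/-- The right-hand side is `Θ(0)`, so `κ` below the Hardy constant yields `κ < Θ(0)` for every
eigenvalue `μ`. -/
lemma hardyConstant_le {n : ℕ} {γ μ : ℝ} (hγ : 0 ≤ γ) (hn : 2 * γ < (n : ℝ)) (hμ : 0 ≤ μ) :
    hardyConstant n γ ≤ (2 : ℝ) ^ (2 * γ) *
      (Real.Gamma (constA n γ μ) / Real.Gamma (constB n γ μ)) ^ 2 := by
  have h0 : 0 < ((n : ℝ) - 2 * γ) / 4 := by linarith
  have h1 : 0 < ((n : ℝ) + 2 * γ) / 4 := by linarith
  have := gamma_ratio_mono hγ h0 (le_constB hμ)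
  rw [← constA_eq, show ((n : ℝ) - 2 * γ) / 4 + γ = ((n : ℝ) + 2 * γ) / 4 by ring] at this
  rw [hardyConstant]
  have := (div_pos (Real.Gamma_pos_of_pos h1) (Real.Gamma_pos_of_pos h0)).le
  gcongr

/-! ### The symbol in terms of reciprocal Gamma functions -/

lemma symbol_eq (n : ℕ) (γ μ : ℝ) (z : ℂ) :
    symbol n γ μ z = (((2 : ℝ) ^ (2 * γ) : ℝ) : ℂ) * gammaInv (constB n γ μ) (z * Complex.I / 2) /
      gammaInv (constA n γ μ) (z * Complex.I / 2) := by
  rw [symbol, gammaInv, gammaInv, ← mul_inv, ← mul_inv, div_inv_eq_mul, div_eq_mul_inv]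
  ring

lemma symbol_sub_eq {n : ℕ} {γ μ κ : ℝ} {z : ℂ}
    (hz : gammaInv (constA n γ μ) (z * Complex.I / 2) ≠ 0) :
    symbol n γ μ z - κ = (((2 : ℝ) ^ (2 * γ) : ℝ) : ℂ) *
      (gammaInv (constB n γ μ) (z * Complex.I / 2) -
        ((κ / (2 : ℝ) ^ (2 * γ) : ℝ) : ℂ) * gammaInv (constA n γ μ) (z * Complex.I / 2)) /
      gammaInv (constA n γ μ) (z * Complex.I / 2) := by
  have hT : (((2 : ℝ) ^ (2 * γ) : ℝ) : ℂ) ≠ 0 :=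
    Complex.ofReal_ne_zero.2 (Real.rpow_pos_of_pos two_pos _).ne'
  rw [symbol_eq, Complex.ofReal_div]
  field_simp

/-- At `w = iξ/2` the extracted factor is `(4B² + ξ²)/4`. It replaces `B` by `B + 1`, which lies
above `A`. -/
lemma gammaInv_eq_mul_gammaInv_add_one (B : ℝ) (w : ℂ) :
    gammaInv B w = ((B : ℂ) ^ 2 - w ^ 2) * gammaInv (B + 1) w := by
  rw [gammaInv, gammaInv, Complex.one_div_Gamma_eq_self_mul_one_div_Gamma_add_one (B + w),
    Complex.one_div_Gamma_eq_self_mul_one_div_Gamma_add_one (B - w)]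
  push_cast
  rw [show (B : ℂ) + w + 1 = B + 1 + w by ring, show (B : ℂ) - w + 1 = B + 1 - w by ring]
  ring

lemma sq_ofReal_mul_I_div_two (ξ : ℝ) :
    ((ξ : ℂ) * Complex.I / 2) ^ 2 = ((-(ξ ^ 2 / 4) : ℝ) : ℂ) := by
  rw [div_pow, mul_pow, Complex.I_sq]
  push_cast
  ring

lemma gammaInv_ofReal_mul_I_ne_zero {A : ℝ} (hA : 0 < A) (ξ : ℝ) :
    gammaInv A ((ξ : ℂ) * Complex.I / 2) ≠ 0 := fun h => by
  have := gammaInv_pos hA (sq_ofReal_mul_I_div_two ξ) (by nlinarith [sq_nonneg ξ, pow_pos hA 2])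
  rw [h] at this
  exact this.false

lemma hasSum_stieltjes_two_sqrt {s b : ℕ → ℝ} (hs : ∀ k, 0 < s k) (hb : ∀ k, 0 ≤ b k)
    (hsum : Summable b) (ξ : ℝ) :
    HasSum (fun k => ((b k * ((2 * √(s k)) ^ 2 / ((2 * √(s k)) ^ 2 + ξ ^ 2)) : ℝ) : ℂ))
      (∑' k, (b k : ℂ) * (s k / (s k - ((ξ : ℂ) * Complex.I / 2) ^ 2))) := by
  have e : ∀ k, (b k : ℂ) * (s k / (s k - ((ξ : ℂ) * Complex.I / 2) ^ 2)) =
      ((b k * ((2 * √(s k)) ^ 2 / ((2 * √(s k)) ^ 2 + ξ ^ 2)) : ℝ) : ℂ) := fun k => by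
    have h0 : 0 < 4 * s k + ξ ^ 2 := by nlinarith [sq_nonneg ξ, hs k]
    have h1 : s k / (s k - -(ξ ^ 2 / 4)) = 4 * s k / (4 * s k + ξ ^ 2) := by
      rw [div_eq_div_iff (by linarith) h0.ne']
      ring
    rw [sq_ofReal_mul_I_div_two, mul_pow, Real.sq_sqrt (hs k).le, ← Complex.ofReal_sub,
      ← Complex.ofReal_div, ← Complex.ofReal_mul, h1]
    norm_num
  simp_rw [e]
  refine Summable.hasSum (Complex.summable_ofReal.2 (hsum.of_nonneg_of_le (fun k => ?_) fun k => ?_))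
  · exact mul_nonneg (hb k) (by positivity)
  · refine mul_le_of_le_one_right (hb k) (div_le_one_of_le₀ ?_ (by positivity))
    linarith [sq_nonneg ξ]

lemma two_sqrt_strictMono {A B : ℝ} (hB : 0 < B) (hBA : B < A) {s : ℕ → ℝ} (h0 : ∀ k, 0 < s k)
    (h1 : ∀ k : ℕ, s k ≤ (B + k) ^ 2) (h2 : ∀ k : ℕ, (A + k) ^ 2 ≤ s (k + 1)) :
    StrictMono fun k => 2 * √(s k) := by
  refine strictMono_nat_of_lt_succ fun k => ?_
  have : s k < s (k + 1) := (h1 k).trans_lt (lt_of_lt_of_le (by gcongr) (h2 k))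
  have := Real.sqrt_lt_sqrt (h0 k).le this
  linarith

lemma pos_of_interlacing {A : ℝ} (hA : 0 < A) {s : ℕ → ℝ} {ε : ℝ} (hε : 0 < ε) (h0 : ε ≤ s 0)
    (h2 : ∀ k : ℕ, (A + k) ^ 2 ≤ s (k + 1)) : ∀ k, 0 < s k
  | 0 => hε.trans_le h0
  | k + 1 => (show (0 : ℝ) < (A + k) ^ 2 by positivity).trans_le (h2 k)

/-- `Θ(ξ) / (ξ² + 4B²)` is a Stieltjes function of `ξ²`. -/
theorem exists_symbol_kernel {n : ℕ} {γ μ : ℝ} (hγ0 : 0 < γ) (hγ1 : γ < 1)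
    (hB : 0 < constB n γ μ) :
    ∃ ρ m : ℕ → ℝ, 2 * constB n γ μ ≤ ρ 0 ∧ StrictMono ρ ∧ (∀ k, 0 ≤ m k) ∧ Summable m ∧
      ∀ ξ : ℝ, ∃ S : ℂ, HasSum (fun k => ((m k * (ρ k ^ 2 / (ρ k ^ 2 + ξ ^ 2)) : ℝ) : ℂ)) S ∧
        symbol n γ μ ξ = (((2 : ℝ) ^ (2 * γ) / 4 : ℝ) : ℂ) *
          (((4 * constB n γ μ ^ 2 : ℝ) : ℂ) + (ξ : ℂ) ^ 2) * S := by
  have hAB := constA_eq n γ μ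
  have hA : 0 < constA n γ μ := by linarith
  have hBA : constB n γ μ < constA n γ μ := by linarith
  -- The pair `(B + 1, A)` interlaces as well, because `A < B + 1 < A + 1`. The choice `ε = B²`
  -- yields the lower bound `ρ 0 ≥ 2B`, later compared with `σ 0 ≤ 2B`.
  obtain ⟨s, b, hs0, hs1, hs2, hb, hsum, hexp, -⟩ := exists_stieltjes_expansion
    (A := constB n γ μ + 1) (B := constA n γ μ) (κ := 0) (ε := constB n γ μ ^ 2) hA (by linarith)
    (by linarith) le_rfl (by positivity) (by gcongr)
    (by simpa using gammaInv_pos hA (w := 0) (x := 0) (by simp) (by positivity))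
    (by
      rw [Real.sqrt_sq hB.le]
      simpa using gammaInv_pos hA (w := (constB n γ μ : ℂ)) (x := constB n γ μ ^ 2)
        (by push_cast; rfl) (by gcongr))
  have hpos := pos_of_interlacing (by linarith : 0 < constB n γ μ + 1) (by positivity) hs0 hs2
  refine ⟨fun k => 2 * √(s k), b, ?_,
    two_sqrt_strictMono hA (by linarith) hpos hs1 hs2, hb, hsum, fun ξ =>
    ⟨_, hasSum_stieltjes_two_sqrt hpos hb hsum ξ, ?_⟩⟩
  · have := Real.sqrt_le_sqrt hs0
    rw [Real.sqrt_sq hB.le] at this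
    simpa using this
  · have hne : ∀ k, ((ξ : ℂ) * Complex.I / 2) ^ 2 ≠ s k := fun k h => by
      rw [sq_ofReal_mul_I_div_two, Complex.ofReal_inj] at h
      nlinarith [hpos k, sq_nonneg ξ]
    have h1 := hexp _ hne
    have h2 := gammaInv_ofReal_mul_I_ne_zero hA ξ
    rw [symbol_eq, gammaInv_eq_mul_gammaInv_add_one (constB n γ μ), h1, sq_ofReal_mul_I_div_two]
    simp only [Complex.ofReal_zero, zero_mul, sub_zero]
    rw [div_eq_iff h2]
    push_cast
    ring

/-! ### Poles -/

/-- Up to a constant `1/(Θ-κ)` is a quotient of entire functions whose numerator and denominator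
have no common zero, so its poles are exactly the zeros of the denominator. -/
lemma isResolventPole_iff {n : ℕ} {γ μ κ : ℝ} (hγ0 : 0 < γ) (hγ1 : γ < 1)
    (hB : 0 < constB n γ μ) (hH0 : gammaInv (constB n γ μ) 0 -
      ((κ / (2 : ℝ) ^ (2 * γ) : ℝ) : ℂ) * gammaInv (constA n γ μ) 0 ≠ 0) (z : ℂ) :
    IsResolventPole n γ μ κ z ↔ gammaInv (constB n γ μ) (z * Complex.I / 2) -
      ((κ / (2 : ℝ) ^ (2 * γ) : ℝ) : ℂ) * gammaInv (constA n γ μ) (z * Complex.I / 2) = 0 := by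
  have hAB := constA_eq n γ μ
  have hA : 0 < constA n γ μ := by linarith
  set κ' := κ / (2 : ℝ) ^ (2 * γ)
  set a : ℂ → ℂ := fun ζ => gammaInv (constA n γ μ) (ζ * Complex.I / 2) with ha
  set H : ℂ → ℂ := fun ζ => gammaInv (constB n γ μ) (ζ * Complex.I / 2) - κ' * a ζ with hH
  set T : ℂ := (((2 : ℝ) ^ (2 * γ) : ℝ) : ℂ) with hTdef
  have hT : T ≠ 0 := Complex.ofReal_ne_zero.2 (Real.rpow_pos_of_pos two_pos _).ne'
  have da : Differentiable ℂ a := (differentiable_gammaInv _).comp (by fun_prop)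
  have dH : Differentiable ℂ H :=
    ((differentiable_gammaInv _).comp (by fun_prop)).sub (da.const_mul _)
  have hev : ∀ {f : ℂ → ℂ}, Differentiable ℂ f → f 0 ≠ 0 → ∀ᶠ ζ in 𝓝[≠] z, f ζ ≠ 0 :=
    fun {f} hf hf0 => by
      have han : AnalyticOnNhd ℂ f Set.univ := fun ζ _ => hf.analyticAt ζ
      refine (han z trivial).eventually_eq_zero_or_eventually_ne_zero.resolve_left fun h => hf0 ?_
      exact han.eqOn_zero_of_preconnected_of_eventuallyEq_zero isPreconnected_univ trivial h trivial
  have ha0 : a 0 ≠ 0 := by simpa [ha] using gammaInv_ofReal_mul_I_ne_zero hA 0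
  have hH0' : H 0 ≠ 0 := by simpa [hH, ha] using hH0
  have eva := hev da ha0
  have evH := hev dH hH0'
  -- Where `a` vanishes the symbol has a pole and its assigned value is meaningless, so the identity
  -- is used only on a punctured neighbourhood.
  have heq : (fun ζ => symbol n γ μ ζ - κ) =ᶠ[𝓝[≠] z] fun ζ => T * H ζ / a ζ :=
    eva.mono fun ζ h => symbol_sub_eq h
  change _ ↔ H z = 0
  rw [IsResolventPole]
  constructor
  · contrapose!
    intro hz
    have h1 : (fun ζ => (symbol n γ μ ζ - κ)⁻¹) =ᶠ[𝓝[≠] z] fun ζ => a ζ / (T * H ζ) :=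
      heq.mono fun ζ (h : symbol n γ μ ζ - κ = T * H ζ / a ζ) => by
        change (symbol n γ μ ζ - κ)⁻¹ = a ζ / (T * H ζ)
        rw [h, inv_div]
    rw [meromorphicOrderAt_congr h1]
    exact ((da.analyticAt z).div ((dH.const_mul T).analyticAt z)
      (mul_ne_zero hT hz)).meromorphicOrderAt_nonneg
  · intro hz
    have haz : a z ≠ 0 := fun h0 => by
      have hbz : gammaInv (constB n γ μ) (z * Complex.I / 2) = 0 := by
        simpa only [hH, h0, mul_zero, sub_zero] using hz
      obtain ⟨j, hj⟩ := gammaInv_eq_zero_iff.1 h0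
      obtain ⟨k, hk⟩ := gammaInv_eq_zero_iff.1 hbz
      have h1 : (constA n γ μ + j) ^ 2 = (constB n γ μ + k) ^ 2 :=
        Complex.ofReal_injective (hj.symm.trans hk)
      have h2 := (sq_eq_sq₀ (by positivity) (by positivity)).1 h1
      have h3 : (j : ℝ) < k := by linarith
      have h4 : (k : ℝ) < j + 1 := by linarith
      have h5 : j < k := by exact_mod_cast h3
      have h6 : k < j + 1 := by exact_mod_cast h4
      omega
    have hq : AnalyticAt ℂ (fun ζ => T * H ζ / a ζ) z :=
      ((dH.const_mul T).analyticAt z).div (da.analyticAt z) haz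
    change meromorphicOrderAt (fun ζ => symbol n γ μ ζ - κ)⁻¹ z < 0
    rw [meromorphicOrderAt_inv, meromorphicOrderAt_congr heq]
    have h1 : 0 < meromorphicOrderAt (fun ζ => T * H ζ / a ζ) z := by
      rw [← tendsto_zero_iff_meromorphicOrderAt_pos hq.meromorphicAt]
      have := hq.continuousAt.tendsto.mono_left (nhdsWithin_le_nhds (s := {z}ᶜ))
      simpa only [hz, mul_zero, zero_div] using this
    have h2 : meromorphicOrderAt (fun ζ => T * H ζ / a ζ) z ≠ ⊤ := by
      rw [meromorphicOrderAt_ne_top_iff_eventually_ne_zero hq.meromorphicAt]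
      filter_upwards [eva, evH] with ζ e1 e2 using div_ne_zero (mul_ne_zero hT e2) e1
    lift meromorphicOrderAt (fun ζ => T * H ζ / a ζ) z to ℤ using h2 with o
    have h3 : 0 < o := by exact_mod_cast h1
    exact_mod_cast (by omega : -o < 0)

lemma sq_mul_I_div_two_eq_iff {z : ℂ} {s : ℝ} (hs : 0 ≤ s) :
    (z * Complex.I / 2) ^ 2 = s ↔
      z = ((2 * √s : ℝ) : ℂ) * Complex.I ∨ z = -(((2 * √s : ℝ) : ℂ) * Complex.I) := by
  rw [← sq_eq_sq_iff_eq_or_eq_neg, mul_pow, ← Complex.ofReal_pow, mul_pow 2, Real.sq_sqrt hs,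
    div_pow, mul_pow, Complex.I_sq]
  push_cast
  constructor <;> intro h
  · linear_combination (-4) * h
  · linear_combination (-1 / 4) * h

/-- Partial fractions of `1 / (Θ - κ)` on the real line, and its poles. -/
theorem exists_resolvent_expansion {n : ℕ} {γ μ κ : ℝ} (hγ0 : 0 < γ) (hγ1 : γ < 1)
    (hB : 0 < constB n γ μ) (hκ0 : 0 ≤ κ) (hκ1 : κ < (2 : ℝ) ^ (2 * γ) *
      (Real.Gamma (constA n γ μ) / Real.Gamma (constB n γ μ)) ^ 2) :
    ∃ σ m : ℕ → ℝ, 0 < σ 0 ∧ σ 0 ≤ 2 * constB n γ μ ∧ StrictMono σ ∧ (∀ k, 0 ≤ m k) ∧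
      Summable m ∧
      (∀ ξ : ℝ, HasSum (fun k => ((m k * (σ k ^ 2 / (σ k ^ 2 + ξ ^ 2)) : ℝ) : ℂ))
        (symbol n γ μ ξ - κ)⁻¹) ∧
      (∀ ξ : ℝ, symbol n γ μ ξ - κ ≠ 0) ∧
      ∀ z : ℂ, IsResolventPole n γ μ κ z ↔
        ∃ j : ℕ, z = (σ j : ℂ) * Complex.I ∨ z = -((σ j : ℂ) * Complex.I) := by
  have hAB := constA_eq n γ μ
  have hBA : constB n γ μ < constA n γ μ := by linarith
  have hA : 0 < constA n γ μ := by linarith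
  have hT : 0 < (2 : ℝ) ^ (2 * γ) := Real.rpow_pos_of_pos two_pos _
  have hTc : (((2 : ℝ) ^ (2 * γ) : ℝ) : ℂ) ≠ 0 := Complex.ofReal_ne_zero.2 hT.ne'
  have gA := Real.Gamma_pos_of_pos hA
  have gB := Real.Gamma_pos_of_pos hB
  set κ' := κ / (2 : ℝ) ^ (2 * γ) with hκ'
  have hH0 : 0 < (gammaInv (constB n γ μ) 0 - κ' * gammaInv (constA n γ μ) 0).re := by
    have e : ∀ C : ℝ, gammaInv C 0 = (((Real.Gamma C ^ 2)⁻¹ : ℝ) : ℂ) := fun C => by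
      rw [gammaInv, add_zero, sub_zero, Complex.Gamma_ofReal]
      push_cast
      ring
    rw [e, e, ← Complex.ofReal_mul, ← Complex.ofReal_sub, Complex.ofReal_re, sub_pos]
    have : κ' < (Real.Gamma (constA n γ μ) / Real.Gamma (constB n γ μ)) ^ 2 := by
      rw [hκ', div_lt_iff₀ hT, mul_comm]
      exact hκ1
    calc κ' * (Real.Gamma (constA n γ μ) ^ 2)⁻¹ <
        (Real.Gamma (constA n γ μ) / Real.Gamma (constB n γ μ)) ^ 2 *
          (Real.Gamma (constA n γ μ) ^ 2)⁻¹ := by gcongr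
      _ = _ := by field_simp
  -- Positivity at `0` persists at `√ε` for small `ε > 0` by continuity; this `ε` bounds all the
  -- zeros `s k` from below.
  obtain ⟨ε, hε0, hεB, hHε⟩ : ∃ ε : ℝ, 0 < ε ∧ ε ≤ constB n γ μ ^ 2 ∧
      0 < (gammaInv (constB n γ μ) (√ε : ℝ) - κ' * gammaInv (constA n γ μ) (√ε : ℝ)).re := by
    have hc : Continuous fun ε : ℝ =>
        (gammaInv (constB n γ μ) (√ε : ℝ) - κ' * gammaInv (constA n γ μ) (√ε : ℝ)).re := by
      have h1 := (differentiable_gammaInv (constA n γ μ)).continuous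
      have h2 := (differentiable_gammaInv (constB n γ μ)).continuous
      have h3 : Continuous fun ε : ℝ => ((√ε : ℝ) : ℂ) := by fun_prop
      exact Complex.continuous_re.comp
        ((h2.comp h3).sub (continuous_const.mul (h1.comp h3)))
    have h1 : ∀ᶠ ε : ℝ in 𝓝 0, 0 <
        (gammaInv (constB n γ μ) (√ε : ℝ) - κ' * gammaInv (constA n γ μ) (√ε : ℝ)).re :=
      hc.continuousAt.eventually (lt_mem_nhds (by simpa using hH0))
    have h2 : ∀ᶠ ε : ℝ in 𝓝 0, ε < constB n γ μ ^ 2 := gt_mem_nhds (by positivity)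
    obtain ⟨ε, ⟨h1, h2⟩, h3⟩ := (((h1.and h2).filter_mono nhdsWithin_le_nhds).and
      (self_mem_nhdsWithin (s := Set.Ioi (0 : ℝ)))).exists
    exact ⟨ε, h3, h2.le, h1⟩
  obtain ⟨s, b, hs0, hs1, hs2, hb, hsum, hexp, hzero⟩ := exists_stieltjes_expansion hB hBA
    (by linarith) (by positivity : 0 ≤ κ') hε0 hεB hH0 hHε
  have hpos := pos_of_interlacing hA hε0 hs0 hs2
  have hκne : ∀ ξ : ℝ, gammaInv (constB n γ μ) (ξ * Complex.I / 2) -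
      κ' * gammaInv (constA n γ μ) (ξ * Complex.I / 2) ≠ 0 := fun ξ h => by
    obtain ⟨k, hk⟩ := sq_eq_of_zero hB hBA (by linarith) hexp h
    rw [sq_ofReal_mul_I_div_two, Complex.ofReal_inj] at hk
    nlinarith [hpos k, sq_nonneg ξ]
  refine ⟨fun k => 2 * √(s k), fun k => ((2 : ℝ) ^ (2 * γ))⁻¹ * b k,
    mul_pos two_pos (Real.sqrt_pos.2 (hpos 0)), ?_, two_sqrt_strictMono hB hBA hpos hs1 hs2,
    fun k => mul_nonneg (inv_nonneg.2 hT.le) (hb k), hsum.mul_left _, fun ξ => ?_, fun ξ => ?_,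
    fun z => ?_⟩
  · have := hs1 0
    rw [Nat.cast_zero, add_zero] at this
    exact mul_le_mul_of_nonneg_left (Real.sqrt_le_iff.2 ⟨hB.le, this⟩) two_pos.le
  · have hne : ∀ k, ((ξ : ℂ) * Complex.I / 2) ^ 2 ≠ s k := fun k h => by
      rw [sq_ofReal_mul_I_div_two, Complex.ofReal_inj] at h
      nlinarith [hpos k, sq_nonneg ξ]
    have h1 := (hasSum_stieltjes_two_sqrt hpos hb hsum ξ).mul_left
      ((((2 : ℝ) ^ (2 * γ) : ℝ) : ℂ)⁻¹)
    have e : (symbol n γ μ ξ - κ)⁻¹ = (((2 : ℝ) ^ (2 * γ) : ℝ) : ℂ)⁻¹ *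
        ∑' k, (b k : ℂ) * (s k / (s k - ((ξ : ℂ) * Complex.I / 2) ^ 2)) := by
      rw [symbol_sub_eq (gammaInv_ofReal_mul_I_ne_zero hA ξ), inv_div, ← hκ',
        div_eq_iff (mul_ne_zero hTc (hκne ξ))]
      linear_combination hexp _ hne - (gammaInv (constB n γ μ) (ξ * Complex.I / 2) -
        κ' * gammaInv (constA n γ μ) (ξ * Complex.I / 2)) *
        (∑' k, (b k : ℂ) * (s k / (s k - ((ξ : ℂ) * Complex.I / 2) ^ 2))) *
        inv_mul_cancel₀ hTc
    rw [e]
    refine h1.congr_fun fun k => ?_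
    push_cast
    ring
  · rw [symbol_sub_eq (gammaInv_ofReal_mul_I_ne_zero hA ξ)]
    exact div_ne_zero (mul_ne_zero hTc (hκne ξ)) (gammaInv_ofReal_mul_I_ne_zero hA ξ)
  · rw [isResolventPole_iff hγ0 hγ1 hB (fun h => by rw [h] at hH0; exact hH0.false)]
    simp_rw [← sq_mul_I_div_two_eq_iff (hpos _).le]
    exact ⟨fun h => sq_eq_of_zero hB hBA (by linarith) hexp h, fun ⟨k, hk⟩ => hzero _ k hk⟩

theorem isWeakSolution_greenConv {n : ℕ} {γ μ κ : ℝ} (hγ0 : 0 < γ) (hγ1 : γ < 1)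
    (hB : 0 < constB n γ μ) {σ m : ℕ → ℝ} (hG : IsExpKernel σ m (green n γ μ κ))
    (hσB : σ 0 ≤ 2 * constB n γ μ)
    (hf : ∀ ξ : ℝ, HasSum (fun k => ((m k * (σ k ^ 2 / (σ k ^ 2 + ξ ^ 2)) : ℝ) : ℂ))
      (symbol n γ μ ξ - κ)⁻¹)
    (hne : ∀ ξ : ℝ, symbol n γ μ ξ - κ ≠ 0) {h : ℝ → ℝ} {η : ℝ} (hη0 : 0 ≤ η) (hη : η < σ 0)
    (hm : AEStronglyMeasurable h volume)
    (hh : Integrable fun s => Real.exp (-η * |s|) * h s) :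
    IsWeakSolution n γ μ κ h (greenConv n γ μ κ h) := by
  obtain ⟨ρ, m', hρB, hρ, hm', hsum', hS⟩ := exists_symbol_kernel (μ := μ) hγ0 hγ1 hB
  have hρ0 : 0 < ρ 0 := by linarith
  have hG' : IsExpKernel ρ m'
      (fun t => ∑' k, m' k * ρ k / 2 * Real.exp (-ρ k * |t|)) :=
    ⟨hρ, hρ0, hm', hsum', fun t ht => (summable_exp_kernel hρ hρ0 hm' hsum' ht).hasSum⟩
  refine isWeakSolution_of_symbol hG hG' (hσB.trans hρB) (b := 4 * constB n γ μ ^ 2)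
    (c := (2 : ℝ) ^ (2 * γ) / 4) (fun x => ?_) (fun x => ?_) hη0 hη hm hh
  · rw [(hG.hasSum_fourier x).unique (hf (2 * Real.pi * x))]
    exact mul_inv_cancel₀ (hne _)
  · obtain ⟨S, hS1, hS2⟩ := hS (2 * Real.pi * x)
    rw [(hG'.hasSum_fourier x).unique hS1, hS2]
    push_cast
    ring

end HardyGreen

end

theorem mainTheorem4 (n : ℕ) (γ μ κ : ℝ)
    (hγ0 : 0 < γ) (hγ1 : γ < 1) (hn : 2 * γ < (n : ℝ))
    (hμ : HardyGreen.IsSphereEigenvalue n μ)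
    (hκ0 : 0 ≤ κ) (hκ1 : κ < HardyGreen.hardyConstant n γ)
    -- all `τ_j` vanish
    (hτ : ∀ z : ℂ, HardyGreen.IsResolventPole n γ μ κ z → z.re = 0) :
    ∃ σ c : ℕ → ℝ,
      0 < σ 0 ∧ StrictMono σ ∧
      -- the poles of `1 / (Θ - κ)` are exactly `± i σ_j`
      (∀ z : ℂ, HardyGreen.IsResolventPole n γ μ κ z ↔
        ∃ j : ℕ, z = (σ j : ℂ) * Complex.I ∨ z = -((σ j : ℂ) * Complex.I)) ∧
      -- the Green's function is well defined away from the origin, with expansion `∑ c_j e^{-σ_j|t|}`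
      (∀ t : ℝ, t ≠ 0 →
        Tendsto (fun R : ℝ => HardyGreen.greenTrunc n γ μ κ R t) atTop
          (𝓝 (HardyGreen.green n γ μ κ t : ℂ)) ∧
        HasSum (fun j => c j * Real.exp (-σ j * |t|)) (HardyGreen.green n γ μ κ t)) ∧
      ∀ (h : ℝ → ℝ) (δ δ₀ : ℝ),
        LocallyIntegrable h volume → -σ 0 < δ → -σ 0 < δ₀ →
        (h =O[atTop] fun t => Real.exp (-δ * t)) →
        (h =O[atBot] fun t => Real.exp (δ₀ * t)) →
        -- `w = 𝓖 * h` is defined almost everywhere, and at all points of continuity of `h`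
        (∀ᵐ t : ℝ, Integrable (fun s => HardyGreen.green n γ μ κ (t - s) * h s)) ∧
        (∀ t : ℝ, ContinuousAt h t →
          Integrable (fun s => HardyGreen.green n γ μ κ (t - s) * h s)) ∧
        -- `w` solves the non-local equation
        HardyGreen.IsWeakSolution n γ μ κ h (HardyGreen.greenConv n γ μ κ h) ∧
        -- `w = ∑ c_j w_j` wherever `w` is defined
        (∀ t : ℝ, Integrable (fun s => HardyGreen.green n γ μ κ (t - s) * h s) →
          HasSum (fun j => c j * HardyGreen.expConv (σ j) h t)
            (HardyGreen.greenConv n γ μ κ h t)) ∧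
        -- each `w_j` is well defined and solves `w_j'' - σ_j² w_j = -2 σ_j h`
        (∀ j : ℕ,
          (∀ t : ℝ, Integrable (fun s => Real.exp (-σ j * |t - s|) * h s)) ∧
          ContDiff ℝ 1 (HardyGreen.expConv (σ j) h) ∧
          (∀ a b : ℝ, AbsolutelyContinuousOnInterval (deriv (HardyGreen.expConv (σ j) h)) a b) ∧
          (∀ᵐ t : ℝ, DifferentiableAt ℝ (deriv (HardyGreen.expConv (σ j) h)) t ∧
            deriv (deriv (HardyGreen.expConv (σ j) h)) t
              - σ j ^ 2 * HardyGreen.expConv (σ j) h t = -2 * σ j * h t) ∧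
          (∀ t : ℝ, ContinuousAt h t →
            DifferentiableAt ℝ (deriv (HardyGreen.expConv (σ j) h)) t ∧
            deriv (deriv (HardyGreen.expConv (σ j) h)) t
              - σ j ^ 2 * HardyGreen.expConv (σ j) h t = -2 * σ j * h t)) ∧
        -- if `h = f(t, w)`, the `w_j` solve a system coupled only through the right-hand sides
        (∀ f : ℝ → ℝ → ℝ, (∀ᵐ t : ℝ, h t = f t (HardyGreen.greenConv n γ μ κ h t)) →
          ∀ j : ℕ, ∀ᵐ t : ℝ,
            deriv (deriv (HardyGreen.expConv (σ j) h)) t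
              - σ j ^ 2 * HardyGreen.expConv (σ j) h t
              = -2 * σ j * f t (∑' k, c k * HardyGreen.expConv (σ k) h t)) := by
  have hμ0 := hμ.nonneg
  have hB : 0 < HardyGreen.constB n γ μ := (by linarith : 0 < ((n : ℝ) - 2 * γ) / 4).trans_le
    (HardyGreen.le_constB hμ0)
  obtain ⟨σ, m, hσ0, hσB, hσ, hm, hsum, hf, hne, hpole⟩ :=
    HardyGreen.exists_resolvent_expansion hγ0 hγ1 hB hκ0
      (hκ1.trans_le (HardyGreen.hardyConstant_le hγ0.le hn hμ0))
  obtain ⟨hG, hlim⟩ := HardyGreen.green_isExpKernel hσ hσ0 hm hsum hf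
  refine ⟨σ, fun k => m k * σ k / 2, hσ0, hσ, hpole, fun t ht => ⟨hlim t ht, hG.hasSum t ht⟩,
    fun h δ δ₀ hh hδ hδ₀ htop hbot => ?_⟩
  -- One weight for everything: `η` lies above `0`, `-δ` and `-δ₀`, so that `e^{-η|·|} h` is
  -- integrable, and below `σ 0`, so that `e^{η|·|} 𝓖` is.
  obtain ⟨η, hη1, hη⟩ := exists_between
    (max_lt hσ0 (max_lt (neg_lt.1 hδ) (neg_lt.1 hδ₀)))
  obtain ⟨hη0, hη1⟩ := max_lt_iff.1 hη1
  obtain ⟨hηδ, hηδ₀⟩ := max_lt_iff.1 hη1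
  have hmeas := hh.aestronglyMeasurable
  have hint := HardyGreen.integrable_exp_mul_of_isBigO hh (neg_lt.1 hηδ) (neg_lt.1 hηδ₀) htop hbot
  have hae := hG.ae_integrable hη0.le hη hint hmeas
  have hconv : ∀ j t, Integrable (fun s => Real.exp (-σ j * |t - s|) * h s) := fun j =>
    HardyGreen.integrable_exp_neg_abs_sub_mul hη0.le (hη.le.trans (hσ.monotone j.zero_le)) hint
  refine ⟨hae, fun t ht => hG.integrable_of_continuousAt hη0.le hη hint hmeas ht,
    HardyGreen.isWeakSolution_greenConv hγ0 hγ1 hB hG hσB hf hne hη0.le hη hmeas hint,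
    fun t ht => hG.hasSum_conv hmeas ht,
    fun j => ⟨hconv j, HardyGreen.expConv_regularity hh (hconv j)⟩, fun f hf j => ?_⟩
  filter_upwards [hae, hf, (HardyGreen.expConv_regularity hh (hconv j)).2.2.1] with t h1 h2 h3
  have h4 : HardyGreen.greenConv n γ μ κ h t = ∑' k, m k * σ k / 2 * HardyGreen.expConv (σ k) h t :=
    (hG.hasSum_conv hmeas h1).tsum_eq.symm
  rw [h3.2, h2, h4]
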